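/- Let $A\in\mathbb R^{n\times n}$, $B\in\mathbb R^{n\times m}$ with $(A,B)$ controllable, let $Q\in\mathbb R^{n\times n}$, $R\in\mathbb R^{m\times m}$ be symmetric positive definite, and let $\rho_0$ be a probability measure on $\mathbb R^n$ with full support and finite second moment. For a policy $\pi:\mathbb R^n\to\mathbb R^m$ and $\gamma\in[0,1]$ put $$C_\gamma(\pi)=\mathbb E_{x_0\sim\rho_0}\Big[\sum_{t\ge 0}\gamma^t\big(x_t^{\top}Qx_t+\pi(x_t)^{\top}R\,\pi(x_t)\big)\Big]\in[0,\infty],\qquad x_{t+1}=Ax_t+B\pi(x_t),$$ and call $\pi$ $\gamma$-optimal if it minimizes $C_\gamma$ among all measurable policies. Let $f_1,\dots,f_d:\mathbb R^n\to\mathbb R^m$ be globally Lipschitz and linearly independent, such that for every $\gamma\in[0,1]$ the $\gamma$-optimal linear gain $x\mapsto K_\gamma^*x$ lies in $\mathrm{Span}\{f_k\}$. Write $\pi_\theta=\sum_k\theta_kf_k$ and $C_\gamma(\theta)=C_\gamma(\pi_\theta)$ for $\theta\in\mathbb R^d$. A policy-gradient flow for $C_\gamma$ is a locally absolutely continuous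 curve $\theta:[0,\infty)\to\mathbb R^d$, running through points near which $C_\gamma$ is finite and Lipschitz, with $\dot\theta(s)\in-\partial C_\gamma(\theta(s))$ for almost every $s$, where $\partial$ is the Clarke generalized gradient (so $\dot\theta=-\nabla C_\gamma(\theta)$ wherever $C_\gamma$ is $C^1$). We write $\mathrm{PG}(\theta,\gamma)=\theta'$ if a policy-gradient flow for $C_\gamma$ starting at $\theta$ exists, every such flow converges to $\theta'$ as $s\to\infty$, and $\theta'$ is a fixed point of the flow, i.e. $C_\gamma$ is finite and Lipschitz near $\theta'$ and $0\in\partial C_\gamma(\theta')$. The homotopy algorithm with increasing discount factors $\gamma_0<\gamma_1<\cdots$ and initial parameters $\theta_0$ computes $\vartheta_0=\theta_0$, $\vartheta_{k+1}=\mathrm{PG}(\vartheta_k,\gamma_k)$. Then there is a unique $\theta^*\in\mathbb R^d$ for which $\pi_{\theta^*}$ is optimal for the undiscounted problem ($\gamma=1$), and, for every sufficiently fine sequence of discount factors and any initial parameters, the homotopy algorithm is well defined and converges to $\theta^*$. Precisely: (a) There is a positive non-increasing function $\delta:[0,1)\to(0,\infty)$ such that sequences $0=\gamma_0<\gamma_1<\cdots<1$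 with $\gamma_k\to1$ and $\gamma_{k+1}-\gamma_k\le\delta(\gamma_k)$ for all $k$ exist, and for every such sequence and every $\theta_0\in\mathbb R^d$, all stages $\vartheta_{k+1}=\mathrm{PG}(\vartheta_k,\gamma_k)$ are defined and $\vartheta_k\to\theta^*$. (b) If moreover the undiscounted cost $C_1(\theta)$ is finite for all $\theta$ in a neighbourhood of $\theta^*$, then there is $\delta>0$ such that for every finite sequence $0=\gamma_0<\gamma_1<\cdots<\gamma_N=1$ with $\gamma_{k+1}-\gamma_k\le\delta$ and every $\theta_0\in\mathbb R^d$, all $N+1$ stages are defined and the returned value is $\vartheta_{N+1}=\theta^*$. -/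

import Mathlib

open MeasureTheory Filter Topology Set
open scoped ENNReal NNReal RealInnerProductSpace

noncomputable section

/-- `ℝᵏ` with its Euclidean norm and inner product. -/
abbrev Euc (k : ℕ) : Type := EuclideanSpace ℝ (Fin k)

/-! ### The linear-quadratic regulator -/

/-- The data of an LQR problem with state space `ℝⁿ` and action space `ℝᵐ`. -/
structure LQR (n m : ℕ) where
  /-- transition map acting on the state -/
  A : Euc n →L[ℝ] Euc n
  /-- transition map acting on the control -/
  B : Euc m →L[ℝ] Euc n
  /-- state cost -/
  Q : Euc n →L[ℝ] Euc n
  /-- control cost -/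
  R : Euc m →L[ℝ] Euc m

/-- A symmetric positive definite operator on `ℝᵏ`. -/
def IsPosDefOp {k : ℕ} (T : Euc k →L[ℝ] Euc k) : Prop :=
  (∀ x y, ⟪T x, y⟫ = ⟪x, T y⟫) ∧ ∀ x, x ≠ 0 → 0 < ⟪x, T x⟫

namespace LQR

variable {n m : ℕ}

/-- Controllability of `(A, B)` (Kalman): the ranges of `B, AB, …, Aⁿ⁻¹B` together span `ℝⁿ`. -/
def Controllable (S : LQR n m) : Prop :=
  (⨆ k : Fin n, LinearMap.range (((S.A ^ (k : ℕ)).comp S.B : Euc m →L[ℝ] Euc n) :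
    Euc m →ₗ[ℝ] Euc n)) = ⊤

/-- The trajectory `xₜ₊₁ = A xₜ + B π(xₜ)` of the policy `π` from the initial state `x₀`. -/
def traj (S : LQR n m) (π : Euc n → Euc m) (x₀ : Euc n) : ℕ → Euc n
  | 0 => x₀
  | t + 1 => S.A (S.traj π x₀ t) + S.B (π (S.traj π x₀ t))

/-- The cost `xᵀ Q x + uᵀ R u` of one time step. -/
def stageCost (S : LQR n m) (x : Euc n) (u : Euc m) : ℝ :=
  ⟪x, S.Q x⟫ + ⟪u, S.R u⟫

/-- The discounted cost `∑ₜ γᵗ (xₜᵀ Q xₜ + uₜᵀ R uₜ) ∈ [0, ∞]` of the policy `π` from `x₀`. -/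
def costFrom (S : LQR n m) (γ : ℝ) (π : Euc n → Euc m) (x₀ : Euc n) : ℝ≥0∞ :=
  ∑' t : ℕ, ENNReal.ofReal (γ ^ t * S.stageCost (S.traj π x₀ t) (π (S.traj π x₀ t)))

/-- The cost `C_γ(π) ∈ [0, ∞]`: expectation of the discounted cost over `x₀ ∼ ρ`. -/
def cost (S : LQR n m) (ρ : Measure (Euc n)) (γ : ℝ) (π : Euc n → Euc m) : ℝ≥0∞ :=
  ∫⁻ x₀, S.costFrom γ π x₀ ∂ρ

/-- `π` is an optimal policy for the discount factor `γ`: it minimizes the expected cost among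
all (measurable) policies. -/
def IsOptimalPolicy (S : LQR n m) (ρ : Measure (Euc n)) (γ : ℝ) (π : Euc n → Euc m) : Prop :=
  ∀ π' : Euc n → Euc m, Measurable π' → S.cost ρ γ π ≤ S.cost ρ γ π'

end LQR

/-- The policy `π_θ(x) = ∑ₖ θₖ fₖ(x)`. -/
def linPolicy {n m d : ℕ} (f : Fin d → Euc n → Euc m) (θ : Euc d) (x : Euc n) : Euc m :=
  ∑ k, θ k • f k x

/-- The cost `C_γ(θ) = C_γ(π_θ)` as a function of the parameters. -/
def LQR.paramCost {n m d : ℕ} (S : LQR n m) (ρ : Measure (Euc n)) (f : Fin d → Euc n → Euc m)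
    (γ : ℝ) (θ : Euc d) : ℝ≥0∞ :=
  S.cost ρ γ (linPolicy f θ)

/-! ### Policy-gradient flow

The policies are only Lipschitz in the state, so the cost need not be differentiable in the
parameters. The gradient flow `dθ/ds = -∇C(θ)` is therefore the Clarke (sub)gradient flow
`dθ/ds ∈ -∂C(θ)`; it is the ordinary gradient flow wherever `C` is continuously differentiable. -/

/-- The Clarke generalized gradient of `g` at `θ`: all `v` with `⟪v, h⟫ ≤ g°(θ; h)` for every
direction `h`, where `g°(θ; h) = limsup_{y → θ, t ↓ 0} (g (y + t h) - g y) / t`. -/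
def clarkeGradient {d : ℕ} (g : Euc d → ℝ) (θ : Euc d) : Set (Euc d) :=
  {v | ∀ h : Euc d, ((⟪v, h⟫ : ℝ) : EReal) ≤
    limsup (fun p : Euc d × ℝ => (((g (p.1 + p.2 • h) - g p.1) / p.2 : ℝ) : EReal))
      (𝓝 θ ×ˢ 𝓝[>] (0 : ℝ))}

/-- Near `θ`, the extended-valued function `C` is finite and Lipschitz. -/
def FiniteLipschitzNear {d : ℕ} (C : Euc d → ℝ≥0∞) (θ : Euc d) : Prop :=
  ∃ s ∈ 𝓝 θ, (∀ y ∈ s, C y ≠ ∞) ∧ ∃ L : ℝ≥0, LipschitzOnWith L (fun y => (C y).toReal) s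

/-- `θ : [0, ∞) → ℝᵈ` is a (locally absolutely continuous) trajectory of the gradient flow
`dθ/ds ∈ -∂C(θ)` started at `θ₀`, running through points near which `C` is finite and Lipschitz. -/
structure IsGradientFlow {d : ℕ} (C : Euc d → ℝ≥0∞) (θ₀ : Euc d) (θ : ℝ → Euc d) : Prop where
  init : θ 0 = θ₀
  absCont : ∀ T : ℝ, 0 ≤ T → AbsolutelyContinuousOnInterval θ 0 T
  finiteLipschitz : ∀ s : ℝ, 0 ≤ s → FiniteLipschitzNear C (θ s)
  flow : ∀ᵐ s ∂(volume.restrict (Ioi (0 : ℝ))), ∃ v : Euc d,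
    HasDerivAt θ v s ∧ -v ∈ clarkeGradient (fun y => (C y).toReal) (θ s)

/-- `θ` is a fixed point of the gradient flow of `C`. -/
def IsFlowFixedPoint {d : ℕ} (C : Euc d → ℝ≥0∞) (θ : Euc d) : Prop :=
  FiniteLipschitzNear C θ ∧ (0 : Euc d) ∈ clarkeGradient (fun y => (C y).toReal) θ

/-- `PG(θ₀) = θ₁` for the cost `C`: there is a gradient flow of `C` from `θ₀`, every such flow
converges to `θ₁`, and `θ₁` is a fixed point. (So `θ₁` is determined by `C` and `θ₀`.) -/
def PolicyGradientYields {d : ℕ} (C : Euc d → ℝ≥0∞) (θ₀ θ₁ : Euc d) : Prop :=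
  (∃ θ : ℝ → Euc d, IsGradientFlow C θ₀ θ) ∧
  (∀ θ : ℝ → Euc d, IsGradientFlow C θ₀ θ → Tendsto θ atTop (𝓝 θ₁)) ∧
  IsFlowFixedPoint C θ₁

/-- `ϑ 0 = θ₀, ϑ 1, ϑ 2, …` are the successive values of the homotopy algorithm with the discount
factors `γ 0, γ 1, …`: each `ϑ (k + 1)` is `PG(ϑ k, γ k)`, for the `N ≤ ∞` stages `k < N`. -/
def IsHomotopyRun {d : ℕ} (C : ℝ → Euc d → ℝ≥0∞) (γ : ℕ → ℝ) (N : ℕ∞) (θ₀ : Euc d)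
    (ϑ : ℕ → Euc d) : Prop :=
  ϑ 0 = θ₀ ∧ ∀ k : ℕ, (k : ℕ∞) < N → PolicyGradientYields (C (γ k)) (ϑ k) (ϑ (k + 1))

/-- An infinite schedule `0 = γ₀ < γ₁ < …` of discount factors below one, tending to one, with
steps bounded by `γₖ₊₁ - γₖ ≤ δ(γₖ)`. -/
structure IsSchedule (δ : ℝ → ℝ) (γ : ℕ → ℝ) : Prop where
  zero : γ 0 = 0
  strictMono : StrictMono γ
  lt_one : ∀ k, γ k < 1
  tendsto_one : Tendsto γ atTop (𝓝 1)
  step : ∀ k, γ (k + 1) - γ k ≤ δ (γ k)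

/-- A finite schedule `0 = γ₀ < γ₁ < … < γ_N = 1` of discount factors with steps at most `δ`. -/
structure IsFiniteSchedule (δ : ℝ) (N : ℕ) (γ : ℕ → ℝ) : Prop where
  zero : γ 0 = 0
  last : γ N = 1
  lt_succ : ∀ k < N, γ k < γ (k + 1)
  step : ∀ k < N, γ (k + 1) - γ k ≤ δ

end

noncomputable section

/-! Let `P` solve the Riccati equation for `γ`, let `M = R + γ Bᵀ P B`, and let `θ_γ` be the
parameter of the optimal gain. Completing the square at every time step and telescoping gives, near
`θ_γ`, the identity `C_γ(y) = E⟪x₀, P x₀⟫ + H_y(y - θ_γ)` (`paramCost_eq`). Here `H_y(u)` is the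
expected discounted sum of `⟪π_u(x_t), M π_u(x_t)⟫` along the trajectories of `π_y`. It is a convex
quadratic form in `u`. It is at least `m‖u‖²`: the term `t = 0` alone suffices, by full support and
linear independence. It is at most `L'‖u‖²`, and Lipschitz in `y` with a constant proportional to
`‖u‖²`; these two bounds come from stability of the optimal closed loop under small perturbations
(`exists_trajectory_bound`).

No differentiability is needed: on a small ball around `θ_γ` convexity in `u` dominates the
dependence on `y`, so every Clarke gradient `v` satisfies `⟪v, y - θ_γ⟫ ≥ (m/2)‖y - θ_γ‖²`
(`clarkeGradient_coercive`). Flows exist (`exists_clarke_flow`), remain in the ball and converge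
exponentially to `θ_γ` (`flow_mem_ball_and_tendsto`). For `γ = 0` the form does not depend on `y`,
and the ball is arbitrary.

The ball can be chosen uniformly for discount factors near a given one, and `θ_γ` is continuous in
`γ`. A Lebesgue number then gives a step size for which `θ_γ` lies in the basin of the next optimum
(`exists_uniform_step`). Near `γ = 1` uniformity requires features vanishing at the origin;
finiteness of `C_1` near the optimum forces this. Otherwise compactness is used on `[0, T]` with `T
< 1`, and the step shrinks as `T → 1`. -/

/-! ### Exponential decay along flows with a coercive right-hand side. -/

theorem AbsolutelyContinuousOnInterval.dist_const {X : Type*} [PseudoMetricSpace X] {f : ℝ → X}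
    {a b : ℝ} (hf : AbsolutelyContinuousOnInterval f a b) (c : X) :
    AbsolutelyContinuousOnInterval (fun s => dist (f s) c) a b := by
  rw [absolutelyContinuousOnInterval_iff] at hf ⊢
  intro ε hε
  obtain ⟨δ, hδ, h⟩ := hf ε hε
  refine ⟨δ, hδ, fun E hE hs => lt_of_le_of_lt (Finset.sum_le_sum fun i _ => ?_) (h E hE hs)⟩
  rw [Real.dist_eq]
  exact abs_dist_sub_le _ _ _

/-- Exponential decay of the squared distance to `c` along a curve on which it satisfies a
differential inequality. -/
theorem exp_mul_dist_sq_le {E : Type*} [NormedAddCommGroup E] [InnerProductSpace ℝ E] {θ : ℝ → E}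
    {c : E} {μ T : ℝ} (hT : 0 ≤ T) (hac : AbsolutelyContinuousOnInterval θ 0 T)
    (h : ∀ᵐ s ∂(volume.restrict (Ioc 0 T)), ∃ v, HasDerivAt θ v s ∧
      ⟪v, θ s - c⟫ ≤ -μ * ‖θ s - c‖ ^ 2) :
    Real.exp (2 * μ * T) * ‖θ T - c‖ ^ 2 ≤ ‖θ 0 - c‖ ^ 2 := by
  -- The differential inequality makes the derivative of `w` nonpositive almost everywhere; absolute
  -- continuity turns this into `w T ≤ w 0`.
  set w : ℝ → ℝ := fun s => Real.exp (2 * μ * s) * (dist (θ s) c * dist (θ s) c) with hw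
  have hwac : AbsolutelyContinuousOnInterval w 0 T := by
    have h1 : AbsolutelyContinuousOnInterval (fun s : ℝ => Real.exp (2 * μ * s)) 0 T := by
      apply ContDiffOn.absolutelyContinuousOnInterval
      fun_prop
    exact h1.mul ((hac.dist_const c).mul (hac.dist_const c))
  have h2 := hwac.integral_deriv_eq_sub
  have h3 : ∫ x in (0 : ℝ)..T, deriv w x ≤ 0 := by
    rw [intervalIntegral.integral_of_le hT]
    apply setIntegral_nonpos_of_ae_restrict
    filter_upwards [h] with s ⟨v, hv, hle⟩
    have hd : HasDerivAt w (Real.exp (2 * μ * s) * (2 * μ) * ‖θ s - c‖ ^ 2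
        + Real.exp (2 * μ * s) * (2 * ⟪θ s - c, v⟫)) s := by
      have e1 : HasDerivAt (fun s : ℝ => Real.exp (2 * μ * s)) (Real.exp (2 * μ * s) * (2 * μ)) s := by
        simpa using ((hasDerivAt_id s).const_mul (2 * μ)).exp
      have e2 := (hv.sub_const c).norm_sq
      have e3 : w = (fun s : ℝ => Real.exp (2 * μ * s)) * fun x => ‖θ x - c‖ ^ 2 := by
        ext x
        simp [hw, dist_eq_norm, sq]
      rw [e3]
      exact e1.mul e2
    rw [hd.deriv]
    have : 0 < Real.exp (2 * μ * s) := Real.exp_pos _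
    rw [real_inner_comm]
    show _ ≤ (0 : ℝ)
    nlinarith
  rw [h2] at h3
  simp only [hw, dist_eq_norm, mul_zero, Real.exp_zero, one_mul] at h3
  nlinarith

/-- Coercivity is available only inside the ball, so invariance comes first: up to a first exit time
the distance to `c` cannot have grown, hence there is no exit. The decay estimate then holds for all
times. -/
theorem flow_mem_ball_and_tendsto {d : ℕ} {g : Euc d → ℝ} {c : Euc d} {r μ : ℝ} (hμ : 0 < μ)
    (hco : ∀ x ∈ Metric.ball c r, ∀ v ∈ clarkeGradient g x, μ * ‖x - c‖ ^ 2 ≤ ⟪v, x - c⟫)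
    {θ : ℝ → Euc d} (h0 : θ 0 ∈ Metric.ball c r)
    (hac : ∀ T : ℝ, 0 ≤ T → AbsolutelyContinuousOnInterval θ 0 T)
    (hflow : ∀ᵐ s ∂(volume.restrict (Ioi (0 : ℝ))), ∃ v : Euc d,
      HasDerivAt θ v s ∧ -v ∈ clarkeGradient g (θ s)) :
    (∀ s, 0 ≤ s → θ s ∈ Metric.ball c r) ∧ Tendsto θ atTop (𝓝 c) := by
  -- Membership is required only for `s < T`, so that `T` may be the exit time itself; the endpoint
  -- is a null set.
  have key : ∀ T, 0 ≤ T → (∀ s, 0 ≤ s → s < T → θ s ∈ Metric.ball c r) →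
      Real.exp (2 * μ * T) * ‖θ T - c‖ ^ 2 ≤ ‖θ 0 - c‖ ^ 2 := by
    intro T hT hin
    apply exp_mul_dist_sq_le hT (hac T hT)
    have hne : ∀ᵐ s ∂(volume.restrict (Ioc (0 : ℝ) T)), s ≠ T :=
      ae_restrict_of_ae (by simp [ae_iff, measure_singleton])
    have hfl := ae_restrict_of_ae_restrict_of_subset 
      (show Ioc 0 T ⊆ Ioi (0 : ℝ) from fun x hx => hx.1) hflow
    filter_upwards [hne, hfl, ae_restrict_mem measurableSet_Ioc] with s hs ⟨v, hv, hvc⟩ hsm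
    refine ⟨v, hv, ?_⟩
    have := hco (θ s) (hin s hsm.1.le (lt_of_le_of_ne hsm.2 hs)) _ hvc
    rw [inner_neg_left] at this
    linarith
  have hball : ∀ s, 0 ≤ s → θ s ∈ Metric.ball c r := by
    intro T hT
    by_contra hcon
    have hcont : ContinuousOn θ (Icc 0 T) := by
      have := (hac T hT).continuousOn
      rwa [uIcc_of_le hT] at this
    have hcl : IsCompact {s ∈ Icc (0 : ℝ) T | θ s ∈ (Metric.ball c r)ᶜ} := by
      have := hcont.preimage_isClosed_of_isClosed isClosed_Icc (Metric.isOpen_ball (x := c) (ε := r)).isClosed_compl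
      exact isCompact_Icc.of_isClosed_subset this inter_subset_left
    obtain ⟨s, hs, hleast⟩ := hcl.exists_isLeast ⟨T, ⟨hT, le_rfl⟩, hcon⟩
    have h1 := key s hs.1.1 (fun t ht hts => by
      by_contra hc
      exact absurd (hleast ⟨⟨ht, hts.le.trans hs.1.2⟩, hc⟩) (not_le.2 hts))
    have h2 : r ≤ ‖θ s - c‖ := by
      have := hs.2
      simpa [dist_eq_norm] using this
    have h3 : ‖θ 0 - c‖ < r := by simpa [dist_eq_norm] using h0
    have h4 : 1 ≤ Real.exp (2 * μ * s) := Real.one_le_exp (by have := hs.1.1; positivity)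
    nlinarith [norm_nonneg (θ 0 - c), norm_nonneg (θ s - c), sq_nonneg (‖θ s - c‖)]
  refine ⟨hball, ?_⟩
  have hlim : Tendsto (fun T => Real.exp (-(2 * μ * T)) * ‖θ 0 - c‖ ^ 2) atTop (𝓝 0) := by
    have := (Real.tendsto_exp_neg_atTop_nhds_zero.comp (?_ : Tendsto (fun T => 2 * μ * T) atTop
      atTop)).mul_const (‖θ 0 - c‖ ^ 2)
    · simpa using this
    exact tendsto_id.const_mul_atTop (by positivity)
  rw [tendsto_iff_norm_sub_tendsto_zero]
  have hsq : Tendsto (fun T => ‖θ T - c‖ ^ 2) atTop (𝓝 0) := by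
    refine tendsto_of_tendsto_of_tendsto_of_le_of_le' tendsto_const_nhds hlim
      (Eventually.of_forall fun _ => by positivity) ?_
    filter_upwards [eventually_ge_atTop 0] with T hT
    have := key T hT (fun s hs _ => hball s hs)
    rw [Real.exp_neg, ← div_eq_inv_mul, le_div_iff₀ (Real.exp_pos _)]
    linarith
  have := hsq.sqrt
  simpa [Real.sqrt_sq] using this

/-! ### Existence of Clarke gradient flows. -/

theorem inner_gradient_le_of_eventually {d : ℕ} {g : Euc d → ℝ} {y w : Euc d} {c : ℝ}
    (hg : DifferentiableAt ℝ g y) (h : ∀ᶠ t in 𝓝[>] (0 : ℝ), (g (y + t • w) - g y) / t < c) :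
    ⟪gradient g y, w⟫ ≤ c := by
  have h1 : HasLineDerivAt ℝ g (⟪gradient g y, w⟫) y w := by
    have := hg.hasGradientAt.hasFDerivAt.hasLineDerivAt w
    simpa using this
  refine le_of_tendsto h1.tendsto_slope_zero_right ?_
  filter_upwards [h] with t ht
  rw [smul_eq_mul, ← div_eq_inv_mul]
  exact ht.le

/-- Half-space bounds survive averaging over Euler steps and passage to the limit, although the
gradients themselves need not converge. Since the Clarke gradient is an intersection of half-spaces,
such bounds suffice. -/
theorem euler_inner_le {E : Type*} [NormedAddCommGroup E] [InnerProductSpace ℝ E] {X V : ℕ → E}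
    {h c : ℝ} (hh : 0 ≤ h) (hX : ∀ k, X (k + 1) = X k - h • V k) (w : E) {a b : ℕ} (hab : a ≤ b)
    (hc : ∀ k, a ≤ k → k < b → ⟪V k, w⟫ ≤ c) :
    ⟪-(X b - X a), w⟫ ≤ h * ((b : ℝ) - a) * c := by
  induction b, hab using Nat.le_induction with
  | base => simp
  | succ b hab ih =>
    have h1 := ih fun k hk hkb => hc k hk (hkb.trans (Nat.lt_succ_self b))
    have h2 := hc b hab (Nat.lt_succ_self b)
    have h3 : -(X (b + 1) - X a) = -(X b - X a) + h • V b := by rw [hX]; abel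
    rw [h3, inner_add_left, real_inner_smul_left]
    push_cast
    nlinarith [mul_le_mul_of_nonneg_left h2 hh]

theorem euler_dist_le {E : Type*} [NormedAddCommGroup E] [InnerProductSpace ℝ E] {X V : ℕ → E}
    {h L : ℝ} (hh : 0 ≤ h) (hX : ∀ k, X (k + 1) = X k - h • V k) (hV : ∀ k, ‖V k‖ ≤ L)
    {a b : ℕ} (hab : a ≤ b) : dist (X a) (X b) ≤ L * (h * ((b : ℝ) - a)) := by
  induction b, hab using Nat.le_induction with
  | base => simp
  | succ b hab ih =>
    have h2 : dist (X b) (X (b + 1)) ≤ h * L := by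
      rw [hX, dist_eq_norm]
      simp only [sub_sub_cancel, norm_smul, Real.norm_eq_abs, abs_of_nonneg hh]
      exact mul_le_mul_of_nonneg_left (hV b) hh
    have h3 := dist_triangle (X a) (X b) (X (b + 1))
    push_cast
    nlinarith

theorem tendsto_floor_sub_floor {a b : ℝ} (ha : 0 ≤ a) (hb : 0 ≤ b) :
    Tendsto (fun n : ℕ => (1 / ((n : ℝ) + 1)) *
      (((⌊b * ((n : ℝ) + 1)⌋₊ : ℕ) : ℝ) - ((⌊a * ((n : ℝ) + 1)⌋₊ : ℕ) : ℝ))) atTop (𝓝 (b - a)) := by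
  have h0 : Tendsto (fun n : ℕ => (n : ℝ) + 1) atTop atTop :=
    tendsto_atTop_add_const_right _ _ tendsto_natCast_atTop_atTop
  have h1 := (tendsto_nat_floor_mul_div_atTop hb).comp h0
  have h2 := (tendsto_nat_floor_mul_div_atTop ha).comp h0
  refine (h1.sub h2).congr fun n => ?_
  simp only [Function.comp]
  ring

/-- Existence of Clarke gradient flows of globally Lipschitz functions: limits of Euler schemes
along gradients at nearby points of differentiability. -/
theorem exists_clarke_flow {d : ℕ} {g : Euc d → ℝ} {L : ℝ≥0} (hg : LipschitzWith L g)
    (θ₀ : Euc d) : ∃ θ : ℝ → Euc d, θ 0 = θ₀ ∧ LipschitzOnWith L θ (Ici 0) ∧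
      ∀ᵐ s ∂(volume.restrict (Ioi (0 : ℝ))), ∃ v : Euc d,
        HasDerivAt θ v s ∧ -v ∈ clarkeGradient g (θ s) := by
  -- By Rademacher, differentiability points are dense; the `n`-th scheme uses the gradient at such
  -- a point within `1/(n+1)` of the current iterate.
  have hdense : ∀ (n : ℕ) (x : Euc d), ∃ y, dist y x < 1 / ((n : ℝ) + 1) ∧ DifferentiableAt ℝ g y := by
    intro n x
    have h1 : Dense {y | DifferentiableAt ℝ g y} :=
      Measure.dense_of_ae (hg.ae_differentiableAt (μ := (volume : Measure (Euc d))))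
    obtain ⟨y, hy, hd⟩ := h1.exists_dist_lt x (show (0 : ℝ) < 1 / ((n : ℝ) + 1) by positivity)
    exact ⟨y, by rwa [dist_comm], hy⟩
  choose Y hYd hYg using hdense
  set X : ℕ → ℕ → Euc d := fun n k =>
    Nat.rec θ₀ (fun _ x => x - (1 / ((n : ℝ) + 1)) • gradient g (Y n x)) k with hX
  have hX0 : ∀ n, X n 0 = θ₀ := fun n => rfl
  have hXs : ∀ n k, X n (k + 1) = X n k - (1 / ((n : ℝ) + 1)) • gradient g (Y n (X n k)) :=
    fun n k => rfl
  have hh : ∀ n : ℕ, (0 : ℝ) ≤ 1 / ((n : ℝ) + 1) := fun n => by positivity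
  have hV : ∀ n k, ‖gradient g (Y n (X n k))‖ ≤ L := by
    intro n k
    rw [gradient, LinearIsometryEquiv.norm_map]
    exact norm_fderiv_le_of_lipschitz ℝ hg
  have hU : ((hyperfilter ℕ : Ultrafilter ℕ) : Filter ℕ) ≤ atTop := Nat.hyperfilter_le_atTop
  set S : ℕ → ℝ → Euc d := fun n s => X n ⌊s * ((n : ℝ) + 1)⌋₊ with hS
  have hSd : ∀ (n : ℕ) (a b : ℝ), a ≤ b → dist (S n a) (S n b) ≤ L * ((1 / ((n : ℝ) + 1)) *
      (((⌊b * ((n : ℝ) + 1)⌋₊ : ℕ) : ℝ) - ((⌊a * ((n : ℝ) + 1)⌋₊ : ℕ) : ℝ))) := by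
    intro n a b hab
    exact euler_dist_le (hh n) (hXs n) (hV n) (Nat.floor_mono (by gcongr))
  -- Limits along a fixed ultrafilter exist at all times simultaneously, since the schemes stay in
  -- compact balls. This replaces the extraction of a subsequence.
  have hlim : ∀ s : ℝ, ∃ x, 0 ≤ s → Tendsto (fun n => S n s) (hyperfilter ℕ) (𝓝 x) := by
    intro s
    by_cases hs : 0 ≤ s
    · have hb : ∀ n, S n s ∈ Metric.closedBall θ₀ (L * s) := by
        intro n
        have h1 := hSd n 0 s hs
        simp only [hS, zero_mul, Nat.floor_zero, hX0, Nat.cast_zero, sub_zero] at h1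
        rw [Metric.mem_closedBall, dist_comm]
        refine h1.trans (mul_le_mul_of_nonneg_left ?_ L.2)
        have := Nat.floor_le (show 0 ≤ s * ((n : ℝ) + 1) by positivity)
        rw [one_div, inv_mul_le_iff₀ (by positivity)]
        linarith
      have hc := (isCompact_closedBall θ₀ (L * s)).ultrafilter_le_nhds
        ((hyperfilter ℕ).map fun n => S n s)
        (le_principal_iff.2 (Ultrafilter.mem_map.2 (univ_mem' hb)))
      obtain ⟨x, _, hx⟩ := hc
      exact ⟨x, fun _ => hx⟩
    · exact ⟨0, fun h => absurd h hs⟩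
  choose θ hθ using hlim
  have hlip : LipschitzOnWith L θ (Ici 0) := by
    apply LipschitzOnWith.of_dist_le_mul
    have key : ∀ a b : ℝ, 0 ≤ a → a ≤ b → dist (θ a) (θ b) ≤ L * dist a b := by
      intro a b ha hab
      have h1 := (hθ a ha).dist (hθ b (ha.trans hab))
      have h2 := ((tendsto_floor_sub_floor ha (ha.trans hab)).mono_left hU).const_mul (L : ℝ)
      rw [dist_comm a b, Real.dist_eq, abs_of_nonneg (by linarith)]
      exact le_of_tendsto_of_tendsto' h1 h2 fun n => hSd n a b hab
    intro a ha b hb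
    rcases le_total a b with hab | hab
    · exact key a b ha hab
    · rw [dist_comm, dist_comm a b]
      exact key b a hb hab
  refine ⟨θ, ?_, hlip, ?_⟩
  · have h1 := hθ 0 le_rfl
    simp only [hS, zero_mul, Nat.floor_zero, hX0] at h1
    exact tendsto_nhds_unique h1 tendsto_const_nhds
  have hdiff : ∀ᵐ s ∂(volume.restrict (Ioi (0 : ℝ))), DifferentiableAt ℝ θ s := by
    rw [ae_restrict_iff' measurableSet_Ioi]
    filter_upwards [hlip.ae_differentiableWithinAt_of_mem (μ := volume)] with s hs hs0
    exact (hs (mem_Ici.2 (le_of_lt hs0))).differentiableAt (Ici_mem_nhds hs0)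
  filter_upwards [hdiff, ae_restrict_mem measurableSet_Ioi] with s hd hs
  refine ⟨deriv θ s, hd.hasDerivAt, fun w => ?_⟩
  rw [mem_Ioi] at hs
  refine le_of_forall_gt fun c' hc' => ?_
  obtain ⟨c, hc1, hc2⟩ := EReal.lt_iff_exists_real_btwn.1 hc'
  refine lt_of_le_of_lt ?_ hc2
  rw [EReal.coe_le_coe_iff]
  have hev := eventually_lt_of_limsup_lt hc1
  obtain ⟨pa, hpa, pb, hpb, hab⟩ := eventually_prod_iff.1 hev
  obtain ⟨r, hr, hball⟩ := Metric.eventually_nhds_iff.1 hpa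
  -- `c` is any real above the limsup in direction `w`, so difference quotients near `θ s` are below
  -- `c`, and so are gradients.
  have hgrad : ∀ y, dist y (θ s) < r → DifferentiableAt ℝ g y → ⟪gradient g y, w⟫ ≤ c := by
    intro y hy hyd
    refine inner_gradient_le_of_eventually hyd ?_
    filter_upwards [hpb] with t ht
    have := hab (hball hy) ht
    exact EReal.coe_lt_coe_iff.1 this
  -- The three thirds of `r` pay for the passage from the iterate to its differentiability point,
  -- the Euler drift since time `s`, and the distance from `S n s` to `θ s`.
  have hinc : ∀ b, s < b → L * (b - s) < r / 3 → ⟪-(θ b - θ s), w⟫ ≤ (b - s) * c := by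
    intro b hb hbr
    have hb0 : 0 ≤ b := hs.le.trans hb.le
    have hfl := (tendsto_floor_sub_floor hs.le hb0).mono_left hU
    have h1 : Tendsto (fun n => ⟪-(S n b - S n s), w⟫) (hyperfilter ℕ) (𝓝 ⟪-(θ b - θ s), w⟫) :=
      (((hθ b hb0).sub (hθ s hs.le)).neg).inner tendsto_const_nhds
    refine le_of_tendsto_of_tendsto h1 (hfl.mul_const c) ?_
    have e1 := (hfl.const_mul (L : ℝ)).eventually_lt_const hbr
    have e2 := (tendsto_iff_dist_tendsto_zero.1 (hθ s hs.le)).eventually_lt_const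
      (show (0 : ℝ) < r / 3 by positivity)
    have e3 := ((tendsto_one_div_add_atTop_nhds_zero_nat (𝕜 := ℝ)).mono_left hU).eventually_lt_const
      (show (0 : ℝ) < r / 3 by positivity)
    filter_upwards [e1, e2, e3] with n h1 h2 h3
    refine euler_inner_le (hh n) (hXs n) w (Nat.floor_mono (by gcongr)) fun k hk1 hk2 => ?_
    refine hgrad _ ?_ (hYg n _)
    have h4 := hYd n (X n k)
    have h5 : dist (S n s) (X n k) < r / 3 := by
      refine lt_of_le_of_lt (euler_dist_le (hh n) (hXs n) (hV n) hk1) (lt_of_le_of_lt ?_ h1)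
      have : (k : ℝ) ≤ (⌊b * ((n : ℝ) + 1)⌋₊ : ℕ) := by exact_mod_cast hk2.le
      have hL : (0 : ℝ) ≤ L := L.2
      have := hh n
      gcongr
    have h6 := dist_triangle4 (Y n (X n k)) (X n k) (S n s) (θ s)
    rw [dist_comm (X n k)] at h6
    linarith
  have hslope := hd.hasDerivAt.tendsto_slope_zero_right
  have h2 : Tendsto (fun t : ℝ => ⟪-(t⁻¹ • (θ (s + t) - θ s)), w⟫) (𝓝[>] 0)
      (𝓝 ⟪-(deriv θ s), w⟫) := (hslope.neg).inner tendsto_const_nhds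
  refine le_of_tendsto h2 ?_
  have h3 : ∀ᶠ t in 𝓝[>] (0 : ℝ), L * t < r / 3 := by
    have : Tendsto (fun t : ℝ => L * t) (𝓝[>] 0) (𝓝 (L * 0)) :=
      (tendsto_id.const_mul _).mono_left nhdsWithin_le_nhds
    exact this.eventually_lt_const (by rw [mul_zero]; positivity)
  filter_upwards [h3, self_mem_nhdsWithin] with t ht ht0
  rw [mem_Ioi] at ht0
  have h4 := hinc (s + t) (by linarith) (by simpa using ht)
  rw [← smul_neg, real_inner_smul_left, inv_mul_le_iff₀ ht0]
  simpa using h4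

/-! ### Coercive Clarke gradients and local convergence. -/

theorem clarkeGradient_congr {d : ℕ} {g g' : Euc d → ℝ} {x : Euc d} (h : g =ᶠ[𝓝 x] g') :
    clarkeGradient g x = clarkeGradient g' x := by
  ext v
  refine forall_congr' fun w => ?_
  rw [limsup_congr]
  have h1 : Tendsto (fun p : Euc d × ℝ => p.1 + p.2 • w) (𝓝 x ×ˢ 𝓝[>] (0 : ℝ)) (𝓝 x) := by
    have : Tendsto (fun p : Euc d × ℝ => p.1 + p.2 • w) (𝓝 (x, (0 : ℝ))) (𝓝 (x + (0 : ℝ) • w)) :=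
      Continuous.tendsto (by fun_prop) _
    rw [zero_smul, add_zero, nhds_prod_eq] at this
    exact this.mono_left (prod_mono_right _ nhdsWithin_le_nhds)
  filter_upwards [h1.eventually h, tendsto_fst.eventually h] with p h2 h3
  rw [h2, h3]

theorem zero_mem_clarkeGradient_of_isLocalMin {d : ℕ} {g : Euc d → ℝ} {x : Euc d}
    (h : IsLocalMin g x) : (0 : Euc d) ∈ clarkeGradient g x := by
  intro w
  rw [inner_zero_left]
  refine le_limsup_of_frequently_le ?_ (by isBoundedDefault)
  -- For a lower bound on the limsup it is enough to freeze the base point at `x`, where minimality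
  -- makes the quotients nonnegative.
  have hle : (pure x : Filter (Euc d)) ×ˢ 𝓝[>] (0 : ℝ) ≤ 𝓝 x ×ˢ 𝓝[>] (0 : ℝ) :=
    prod_mono_left _ (pure_le_nhds x)
  refine Frequently.filter_mono (Eventually.frequently ?_) hle
  rw [pure_prod, eventually_map]
  have h1 : Tendsto (fun t : ℝ => x + t • w) (𝓝[>] (0 : ℝ)) (𝓝 x) := by
    have : Tendsto (fun t : ℝ => x + t • w) (𝓝 (0 : ℝ)) (𝓝 (x + (0 : ℝ) • w)) :=
      Continuous.tendsto (by fun_prop) _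
    rw [zero_smul, add_zero] at this
    exact this.mono_left nhdsWithin_le_nhds
  filter_upwards [h1.eventually h, self_mem_nhdsWithin] with t ht ht0
  rw [mem_Ioi] at ht0
  rw [EReal.coe_le_coe_iff]
  exact div_nonneg (by linarith) ht0.le

theorem policyGradientYields_of_coercive {d : ℕ} {C : Euc d → ℝ≥0∞} {c θ₀ : Euc d} {r μ : ℝ}
    {L : ℝ≥0} (hμ : 0 < μ) (hfin : ∀ y ∈ Metric.ball c r, C y ≠ ∞)
    (hlip : LipschitzOnWith L (fun y => (C y).toReal) (Metric.ball c r))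
    (hmin : ∀ y ∈ Metric.ball c r, (C c).toReal ≤ (C y).toReal)
    (hco : ∀ x ∈ Metric.ball c r, ∀ v ∈ clarkeGradient (fun y => (C y).toReal) x,
      μ * ‖x - c‖ ^ 2 ≤ ⟪v, x - c⟫)
    (hθ₀ : θ₀ ∈ Metric.ball c r) : PolicyGradientYields C θ₀ c := by
  have hr : 0 < r := Metric.pos_of_mem_ball hθ₀
  have hnear : ∀ x ∈ Metric.ball c r, FiniteLipschitzNear C x := fun x hx =>
    ⟨_, Metric.isOpen_ball.mem_nhds hx, hfin, L, hlip⟩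
  refine ⟨?_, ?_, hnear c (Metric.mem_ball_self hr), ?_⟩
  -- The existence theorem needs a globally Lipschitz function. A flow of the extension never leaves
  -- the ball, where the Clarke gradients agree.
  · obtain ⟨g, hg, hgeq⟩ := hlip.extend_real
    obtain ⟨θ, h0, hθL, hθ⟩ := exists_clarke_flow hg θ₀
    have hac : ∀ T : ℝ, 0 ≤ T → AbsolutelyContinuousOnInterval θ 0 T := fun T hT => by
      refine (hθL.mono ?_).absolutelyContinuousOnInterval (K := L)
      rw [uIcc_of_le hT]
      exact fun x hx => hx.1
    have hcl : ∀ x ∈ Metric.ball c r,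
        clarkeGradient (fun y => (C y).toReal) x = clarkeGradient g x := fun x hx =>
      clarkeGradient_congr (hgeq.eventuallyEq_of_mem (Metric.isOpen_ball.mem_nhds hx))
    have hball := (flow_mem_ball_and_tendsto hμ (g := g)
      (fun x hx v hv => hco x hx v (by rwa [hcl x hx])) (h0 ▸ hθ₀) hac hθ).1
    refine ⟨θ, h0, hac, fun s hs => hnear _ (hball s hs), ?_⟩
    filter_upwards [hθ, ae_restrict_mem measurableSet_Ioi] with s ⟨v, hv, hvc⟩ hs
    exact ⟨v, hv, by rwa [hcl _ (hball s (le_of_lt hs))]⟩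
  · intro θ hθ
    exact (flow_mem_ball_and_tendsto hμ hco (hθ.init ▸ hθ₀) hθ.absCont hθ.flow).2
  · apply zero_mem_clarkeGradient_of_isLocalMin
    filter_upwards [Metric.isOpen_ball.mem_nhds (Metric.mem_ball_self hr)] with y hy using hmin y hy

/-- Clarke gradients of `y ↦ e + H y (y - c)`, where `H` is convex and coercive in its second
argument and Lipschitz in the first one, point away from `c`. -/
theorem clarkeGradient_coercive {d : ℕ} {g : Euc d → ℝ} {c : Euc d} {r m L' L e : ℝ}
    (hL : 0 ≤ L) {H : Euc d → Euc d → ℝ}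
    (hg : ∀ y ∈ Metric.ball c r, g y = e + H y (y - c))
    (hconv : ∀ y ∈ Metric.ball c r, ConvexOn ℝ univ (H y))
    (hlow : ∀ y ∈ Metric.ball c r, ∀ u, m * ‖u‖ ^ 2 ≤ H y u)
    (hup : ∀ y ∈ Metric.ball c r, ∀ u, H y u ≤ L' * ‖u‖ ^ 2)
    (hlip : ∀ y ∈ Metric.ball c r, ∀ y' ∈ Metric.ball c r, ∀ u,
      |H y u - H y' u| ≤ L * ‖y - y'‖ * ‖u‖ ^ 2)
    (hLr : L * r ≤ m / 2) {x : Euc d} (hx : x ∈ Metric.ball c r) {v : Euc d}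
    (hv : v ∈ clarkeGradient g x) : m / 2 * ‖x - c‖ ^ 2 ≤ ⟪v, x - c⟫ := by
  set Δ := x - c with hΔ
  -- The test direction points from `x` towards `c`; `b` will bound the difference quotients in this
  -- direction.
  have h1 := hv (-Δ)
  set b : Euc d × ℝ → ℝ := fun p =>
    L * ‖Δ‖ * ‖p.1 - c - p.2 • Δ‖ ^ 2 - m * ‖p.1 - c‖ ^ 2 + L' * ‖p.1 - x‖ ^ 2 with hb
  have hbt : Tendsto b (𝓝 x ×ˢ 𝓝[>] (0 : ℝ)) (𝓝 (L * ‖Δ‖ * ‖Δ‖ ^ 2 - m * ‖Δ‖ ^ 2)) := by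
    have : Tendsto b (𝓝 (x, (0 : ℝ))) (𝓝 (b (x, 0))) := Continuous.tendsto (by fun_prop) _
    simp only [hb, zero_smul, sub_zero, sub_self, norm_zero] at this
    rw [nhds_prod_eq] at this
    simpa [hΔ] using this.mono_left (prod_mono_right _ nhdsWithin_le_nhds)
  have hyt : Tendsto (fun p : Euc d × ℝ => p.1 + p.2 • (-Δ)) (𝓝 x ×ˢ 𝓝[>] (0 : ℝ)) (𝓝 x) := by
    have : Tendsto (fun p : Euc d × ℝ => p.1 + p.2 • (-Δ)) (𝓝 (x, (0 : ℝ)))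
      (𝓝 (x + (0 : ℝ) • (-Δ))) := Continuous.tendsto (by fun_prop) _
    rw [zero_smul, add_zero, nhds_prod_eq] at this
    exact this.mono_left (prod_mono_right _ nhdsWithin_le_nhds)
  have hxb := Metric.isOpen_ball.mem_nhds hx
  have hle : limsup (fun p : Euc d × ℝ => (((g (p.1 + p.2 • (-Δ)) - g p.1) / p.2 : ℝ) : EReal))
      (𝓝 x ×ˢ 𝓝[>] (0 : ℝ)) ≤ ((L * ‖Δ‖ * ‖Δ‖ ^ 2 - m * ‖Δ‖ ^ 2 : ℝ) : EReal) := by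
    have hbe : Tendsto (fun p => (b p : EReal)) (𝓝 x ×ˢ 𝓝[>] (0 : ℝ))
        (𝓝 ((L * ‖Δ‖ * ‖Δ‖ ^ 2 - m * ‖Δ‖ ^ 2 : ℝ) : EReal)) :=
      (continuous_coe_real_ereal.tendsto _).comp hbt
    rw [← hbe.limsup_eq]
    refine limsup_le_limsup ?_
    have ht : ∀ᶠ t in 𝓝[>] (0 : ℝ), t < 1 := by
      filter_upwards [Ioo_mem_nhdsGT (zero_lt_one' ℝ)] with t ht using ht.2
    have ht0 : ∀ᶠ t in 𝓝[>] (0 : ℝ), 0 < t := self_mem_nhdsWithin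
    filter_upwards [tendsto_fst.eventually hxb, hyt.eventually hxb, tendsto_snd.eventually ht,
      tendsto_snd.eventually ht0] with p hp1 hp2 hp3 hp4
    rw [EReal.coe_le_coe_iff, div_le_iff₀ hp4, hg _ hp1, hg _ hp2]
    set D := p.1 - c with hD
    set t := p.2
    have e1 : p.1 + t • (-Δ) - c = D - t • Δ := by rw [hD, smul_neg]; abel
    -- The base point `p.1` moves while the direction stays fixed, so the convex combination ends at
    -- `p.1 - x` instead of `0`; the resulting `L'` term vanishes in the limit.
    have e2 : D - t • Δ = (1 - t) • D + t • (p.1 - x) := by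
      rw [hD, hΔ]; module
    have h2 := (abs_le.1 (hlip _ hp2 _ hp1 (D - t • Δ))).2
    have e3 : ‖p.1 + t • (-Δ) - p.1‖ = t * ‖Δ‖ := by
      rw [add_sub_cancel_left, norm_smul, norm_neg, Real.norm_eq_abs, abs_of_pos hp4]
    rw [e3] at h2
    have h3 := (hconv _ hp1).2 (mem_univ D) (mem_univ (p.1 - x)) (sub_nonneg.2 hp3.le) hp4.le
      (by ring)
    rw [← e2, smul_eq_mul, smul_eq_mul] at h3
    have h4 := mul_le_mul_of_nonneg_left (hlow _ hp1 D) hp4.le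
    have h5 := mul_le_mul_of_nonneg_left (hup _ hp1 (p.1 - x)) hp4.le
    rw [e1]
    simp only [hb, ← hD]
    nlinarith
  have h2 := EReal.coe_le_coe_iff.1 (h1.trans hle)
  rw [inner_neg_right] at h2
  have h3 : ‖Δ‖ ≤ r := by
    rw [Metric.mem_ball, dist_eq_norm] at hx
    exact hx.le
  have h4 : L * ‖Δ‖ * ‖Δ‖ ^ 2 ≤ m / 2 * ‖Δ‖ ^ 2 :=
    mul_le_mul_of_nonneg_right ((mul_le_mul_of_nonneg_left h3 hL).trans hLr) (by positivity)
  linarith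

/-- The segment from `w` through `u` is prolonged to length `2r`; its endpoint has norm at most
`3r`. Convexity compares slopes, whence `(3r)² / (2r) = 9r/2`. -/
theorem sub_le_of_convexOn {E : Type*} [NormedAddCommGroup E] [NormedSpace ℝ E] {h : E → ℝ}
    {L' r : ℝ} (hr : 0 < r) (hL' : 0 ≤ L') (hconv : ConvexOn ℝ univ h) (hpos : ∀ u, 0 ≤ h u)
    (hup : ∀ u, h u ≤ L' * ‖u‖ ^ 2) {u w : E} (hw : ‖w‖ ≤ r) (huw : ‖u - w‖ ≤ 2 * r) :
    h u - h w ≤ L' * (9 * r / 2) * ‖u - w‖ := by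
  rcases eq_or_ne u w with rfl | hne
  · simp
  have hpos' : 0 < ‖u - w‖ := norm_pos_iff.2 (sub_ne_zero.2 hne)
  set t := ‖u - w‖ / (2 * r) with ht
  have ht0 : 0 < t := by positivity
  have ht1 : t ≤ 1 := by rw [ht, div_le_one (by positivity)]; exact huw
  have e : u = (1 - t) • w + t • (w + t⁻¹ • (u - w)) := by
    rw [smul_add, smul_smul, mul_inv_cancel₀ ht0.ne']; module
  have h1 := hconv.2 (mem_univ w) (mem_univ (w + t⁻¹ • (u - w))) (sub_nonneg.2 ht1) ht0.le (by ring)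
  rw [← e, smul_eq_mul, smul_eq_mul] at h1
  have h2 : ‖w + t⁻¹ • (u - w)‖ ≤ 3 * r := by
    refine (norm_add_le _ _).trans ?_
    rw [norm_smul, Real.norm_eq_abs, abs_of_pos (by positivity), ht, inv_div]
    have : 2 * r / ‖u - w‖ * ‖u - w‖ = 2 * r := by field_simp
    linarith
  have h3 : h (w + t⁻¹ • (u - w)) ≤ L' * (3 * r) ^ 2 :=
    (hup _).trans (by gcongr)
  have h4 : t * (L' * (3 * r) ^ 2) = L' * (9 * r / 2) * ‖u - w‖ := by
    rw [ht]; field_simp; ring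
  nlinarith [mul_le_mul_of_nonneg_left h3 ht0.le, mul_nonneg ht0.le (hpos w)]

/-- The interface between the analysis of flows and the control problem. The Lipschitz constant of
the cost adds `L r²` from the first argument of `H` and `L' (9r/2)` from the second. -/
theorem policyGradientYields_of_quadratic {d : ℕ} {C : Euc d → ℝ≥0∞} {c θ₀ : Euc d}
    {r m L' L e : ℝ} (hm : 0 < m) (hL : 0 ≤ L) (hL' : 0 ≤ L') {H : Euc d → Euc d → ℝ}
    (hfin : ∀ y ∈ Metric.ball c r, C y ≠ ∞)
    (hg : ∀ y ∈ Metric.ball c r, (C y).toReal = e + H y (y - c))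
    (hconv : ∀ y ∈ Metric.ball c r, ConvexOn ℝ univ (H y))
    (hlow : ∀ y ∈ Metric.ball c r, ∀ u, m * ‖u‖ ^ 2 ≤ H y u)
    (hup : ∀ y ∈ Metric.ball c r, ∀ u, H y u ≤ L' * ‖u‖ ^ 2)
    (hlip : ∀ y ∈ Metric.ball c r, ∀ y' ∈ Metric.ball c r, ∀ u,
      |H y u - H y' u| ≤ L * ‖y - y'‖ * ‖u‖ ^ 2)
    (hLr : L * r ≤ m / 2) (hθ₀ : θ₀ ∈ Metric.ball c r) : PolicyGradientYields C θ₀ c := by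
  have hr : 0 < r := Metric.pos_of_mem_ball hθ₀
  have hnn : ∀ y ∈ Metric.ball c r, ∀ u, 0 ≤ H y u := fun y hy u =>
    (by positivity : (0 : ℝ) ≤ m * ‖u‖ ^ 2).trans (hlow y hy u)
  have hcost : LipschitzOnWith (L * r ^ 2 + L' * (9 * r / 2)).toNNReal (fun y => (C y).toReal)
      (Metric.ball c r) := by
    apply LipschitzOnWith.of_dist_le_mul
    rw [Real.coe_toNNReal _ (by positivity)]
    have key : ∀ y ∈ Metric.ball c r, ∀ y' ∈ Metric.ball c r, (C y).toReal - (C y').toReal ≤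
        (L * r ^ 2 + L' * (9 * r / 2)) * dist y y' := by
      intro y hy y' hy'
      rw [hg y hy, hg y' hy', dist_eq_norm]
      have hyn : ‖y - c‖ ≤ r := by rw [← dist_eq_norm]; exact (Metric.mem_ball.1 hy).le
      have hyn' : ‖y' - c‖ ≤ r := by rw [← dist_eq_norm]; exact (Metric.mem_ball.1 hy').le
      have e1 : y - c - (y' - c) = y - y' := by abel
      have h1 := (abs_le.1 (hlip y hy y' hy' (y - c))).2
      have h2 := sub_le_of_convexOn (u := y - c) (w := y' - c) hr hL' (hconv y' hy') (hnn y' hy')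
        (hup y' hy') hyn' ((norm_sub_le _ _).trans (by linarith))
      rw [e1] at h2
      have h3 : L * ‖y - y'‖ * ‖y - c‖ ^ 2 ≤ L * ‖y - y'‖ * r ^ 2 := by gcongr
      linarith
    intro y hy y' hy'
    rw [Real.dist_eq, abs_le]
    constructor
    · have := key y' hy' y hy
      rw [dist_comm] at this
      linarith
    · exact key y hy y' hy'
  refine policyGradientYields_of_coercive (μ := m / 2) (by positivity) hfin hcost ?_
    (fun x hx v hv => clarkeGradient_coercive hL hg hconv hlow hup hlip hLr hx hv) hθ₀
  intro y hy
  have hc := Metric.mem_ball_self (x := c) hr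
  rw [hg y hy, hg c hc]
  have h1 := hup c hc (c - c)
  have h2 := hnn y hy (y - c)
  simp only [sub_self, norm_zero, ne_eq, OfNat.ofNat_ne_zero, not_false_eq_true, zero_pow,
    mul_zero] at h1 ⊢
  linarith

/-! ### Positive semidefinite operators. -/

/-- A symmetric positive semidefinite operator on `ℝᵏ`. -/
def IsPosSemidefOp {k : ℕ} (T : Euc k →L[ℝ] Euc k) : Prop :=
  (∀ x y, ⟪T x, y⟫ = ⟪x, T y⟫) ∧ ∀ x, 0 ≤ ⟪x, T x⟫

theorem IsPosDefOp.isPosSemidefOp {k : ℕ} {T : Euc k →L[ℝ] Euc k} (h : IsPosDefOp T) :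
    IsPosSemidefOp T := by
  refine ⟨h.1, fun x => ?_⟩
  rcases eq_or_ne x 0 with rfl | hx
  · simp
  · exact (h.2 x hx).le

theorem isPosSemidefOp_zero {k : ℕ} : IsPosSemidefOp (0 : Euc k →L[ℝ] Euc k) := by
  constructor <;> simp

theorem inner_map_add_self {k : ℕ} {T : Euc k →L[ℝ] Euc k} (h : ∀ x y, ⟪T x, y⟫ = ⟪x, T y⟫)
    (x y : Euc k) : ⟪x + y, T (x + y)⟫ = ⟪x, T x⟫ + 2 * ⟪y, T x⟫ + ⟪y, T y⟫ := by
  have : ⟪x, T y⟫ = ⟪y, T x⟫ := by rw [← h, real_inner_comm]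
  simp only [map_add, inner_add_left, inner_add_right, this]
  ring

theorem eq_of_inner_map_self_eq {k : ℕ} {P T : Euc k →L[ℝ] Euc k}
    (hP : ∀ x y, ⟪P x, y⟫ = ⟪x, P y⟫) (hT : ∀ x y, ⟪T x, y⟫ = ⟪x, T y⟫)
    (h : ∀ x, ⟪x, P x⟫ = ⟪x, T x⟫) : P = T := by
  ext1 x
  refine ext_inner_left ℝ fun y => ?_
  have h1 := inner_map_add_self hP x y
  have h2 := inner_map_add_self hT x y
  rw [h, h, h] at h1
  linarith

/-- Young's inequality for a positive semidefinite form. -/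
theorem IsPosSemidefOp.inner_add_le {k : ℕ} {T : Euc k →L[ℝ] Euc k} (h : IsPosSemidefOp T)
    {η : ℝ} (hη : 0 < η) (x y : Euc k) :
    ⟪x + y, T (x + y)⟫ ≤ (1 + η) * ⟪x, T x⟫ + (1 + η⁻¹) * ⟪y, T y⟫ := by
  have h1 := h.2 (η • x + (-1 : ℝ) • y)
  rw [inner_map_add_self h.1] at h1 ⊢
  simp only [map_smul, inner_smul_left, inner_smul_right, RCLike.conj_to_real] at h1
  have h2 := mul_nonneg (inv_nonneg.2 hη.le) h1
  have h3 : η⁻¹ * (η * (η * ⟪x, T x⟫) + 2 * (η * (-1 * ⟪y, T x⟫)) + -1 * (-1 * ⟪y, T y⟫)) =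
      η * ⟪x, T x⟫ - 2 * ⟪y, T x⟫ + η⁻¹ * ⟪y, T y⟫ := by
    field_simp; ring
  linarith

theorem IsPosDefOp.exists_pos_le {k : ℕ} {T : Euc k →L[ℝ] Euc k} (h : IsPosDefOp T) :
    ∃ c : ℝ, 0 < c ∧ ∀ x, c * ‖x‖ ^ 2 ≤ ⟪x, T x⟫ := by
  rcases (Metric.sphere (0 : Euc k) 1).eq_empty_or_nonempty with he | hne
  · refine ⟨1, one_pos, fun x => ?_⟩
    have : x = 0 := by
      by_contra hx
      have : ‖x‖⁻¹ • x ∈ Metric.sphere (0 : Euc k) 1 := by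
        simp [norm_smul, inv_mul_cancel₀ (norm_ne_zero_iff.2 hx)]
      rw [he] at this
      exact this
    simp [this]
  · obtain ⟨z, hz, hmin⟩ := (isCompact_sphere (0 : Euc k) 1).exists_isMinOn hne
      (f := fun x => ⟪x, T x⟫) (by fun_prop)
    have hz0 : z ≠ 0 := by
      rintro rfl
      simp at hz
    refine ⟨⟪z, T z⟫, h.2 z hz0, fun x => ?_⟩
    rcases eq_or_ne x 0 with rfl | hx
    · simp
    have h1 : ‖x‖⁻¹ • x ∈ Metric.sphere (0 : Euc k) 1 := by
      simp [norm_smul, inv_mul_cancel₀ (norm_ne_zero_iff.2 hx)]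
    have h2 : ⟪z, T z⟫ ≤ ⟪‖x‖⁻¹ • x, T (‖x‖⁻¹ • x)⟫ := hmin h1
    simp only [map_smul, inner_smul_left, inner_smul_right, RCLike.conj_to_real] at h2
    have h3 := norm_pos_iff.2 hx
    have h4 : ⟪x, T x⟫ = ‖x‖ ^ 2 * (‖x‖⁻¹ * (‖x‖⁻¹ * ⟪x, T x⟫)) := by field_simp
    rw [h4, mul_comm]
    gcongr

theorem inner_map_self_le {k : ℕ} (T : Euc k →L[ℝ] Euc k) (x : Euc k) :
    ⟪x, T x⟫ ≤ ‖T‖ * ‖x‖ ^ 2 := by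
  refine (real_inner_le_norm _ _).trans ?_
  have := mul_le_mul_of_nonneg_left (T.le_opNorm x) (norm_nonneg x)
  linarith

theorem IsPosSemidefOp.convexOn {k : ℕ} {T : Euc k →L[ℝ] Euc k} (h : IsPosSemidefOp T) :
    ConvexOn ℝ univ fun x : Euc k => ⟪x, T x⟫ := by
  refine ⟨convex_univ, fun x _ y _ a b ha hb hab => ?_⟩
  have h1 := mul_nonneg (mul_nonneg ha hb) (h.2 (x + (-1 : ℝ) • y))
  have hb' : b = 1 - a := by linarith
  subst hb'
  dsimp only
  rw [inner_map_add_self h.1] at h1 ⊢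
  simp only [map_smul, inner_smul_left, inner_smul_right, RCLike.conj_to_real, smul_eq_mul] at h1 ⊢
  nlinarith

/-- A pointwise bounded set of positive semidefinite operators is compact. -/
theorem isCompact_posSemidefOp {k : ℕ} (J : Euc k → ℝ) :
    IsCompact {T : Euc k →L[ℝ] Euc k | IsPosSemidefOp T ∧ ∀ x, ⟪x, T x⟫ ≤ J x} := by
  set 𝒦 := {T : Euc k →L[ℝ] Euc k | IsPosSemidefOp T ∧ ∀ x, ⟪x, T x⟫ ≤ J x}
  have hcl : IsClosed 𝒦 := by
    have : 𝒦 = ((⋂ x, ⋂ y, {T | ⟪T x, y⟫ = ⟪x, T y⟫}) ∩ ⋂ x, {T | 0 ≤ ⟪x, T x⟫}) ∩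
        ⋂ x, {T | ⟪x, T x⟫ ≤ J x} := by
      ext T
      simp [𝒦, IsPosSemidefOp]
    rw [this]
    refine ((isClosed_iInter fun x => isClosed_iInter fun y => isClosed_eq ?_ ?_).inter
      (isClosed_iInter fun x => isClosed_le ?_ ?_)).inter
      (isClosed_iInter fun x => isClosed_le ?_ ?_) <;> fun_prop
  -- Nonnegativity of the form at `x + y` and `x - y` bounds the off-diagonal entries by the
  -- diagonal ones; two applications of Banach–Steinhaus then bound the operator norms.
  have hpt : ∀ x y, ∀ T : 𝒦, ‖⟪(T : Euc k →L[ℝ] Euc k) x, y⟫‖ ≤ (J x + J y) / 2 := by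
    rintro x y ⟨T, hT, hJ⟩
    have h1 := hT.2 (x + y)
    have h2 := hT.2 (x + (-1 : ℝ) • y)
    rw [inner_map_add_self hT.1] at h1 h2
    simp only [map_smul, inner_smul_left, inner_smul_right, RCLike.conj_to_real] at h2
    have h3 := hJ x
    have h4 := hJ y
    dsimp only
    rw [real_inner_comm, Real.norm_eq_abs, abs_le]
    constructor <;> linarith
  have hpt' : ∀ x, ∃ C, ∀ T : 𝒦, ‖(T : Euc k →L[ℝ] Euc k) x‖ ≤ C := by
    intro x
    obtain ⟨C, hC⟩ := banach_steinhaus (g := fun T : 𝒦 => innerSL ℝ ((T : Euc k →L[ℝ] Euc k) x))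
      (fun y => ⟨_, fun T => hpt x y T⟩)
    exact ⟨C, fun T => by simpa using hC T⟩
  obtain ⟨C, hC⟩ := banach_steinhaus (g := fun T : 𝒦 => (T : Euc k →L[ℝ] Euc k)) hpt'
  refine Metric.isCompact_of_isClosed_isBounded hcl ?_
  exact isBounded_iff_forall_norm_le.2 ⟨C, fun T hT => hC ⟨T, hT⟩⟩

/-! ### The Riccati operator. -/

namespace LQR

variable {n m : ℕ} (S : LQR n m)

/-- The Hessian `R + γ Bᵀ P B` in the control of the one-step cost with terminal cost `P`. -/
def hess (γ : ℝ) (P : Euc n →L[ℝ] Euc n) : Euc m →L[ℝ] Euc m :=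
  S.R + γ • (S.B.adjoint ∘L P ∘L S.B)

/-- The gain minimizing the one-step cost with terminal cost `P`. -/
def gain (γ : ℝ) (P : Euc n →L[ℝ] Euc n) : Euc n →L[ℝ] Euc m :=
  -(γ • (Ring.inverse (S.hess γ P) ∘L (S.B.adjoint ∘L P ∘L S.A)))

/-- The closed-loop transition map of a linear gain. -/
def closedLoop (K : Euc n →L[ℝ] Euc m) : Euc n →L[ℝ] Euc n :=
  S.A + S.B ∘L K

/-- The Riccati operator: the minimal one-step cost with terminal cost `P`. -/
def riccati (γ : ℝ) (P : Euc n →L[ℝ] Euc n) : Euc n →L[ℝ] Euc n :=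
  S.Q + (S.gain γ P).adjoint ∘L S.R ∘L S.gain γ P +
    γ • ((S.closedLoop (S.gain γ P)).adjoint ∘L P ∘L S.closedLoop (S.gain γ P))

variable {S}

theorem isPosDefOp_hess (hR : IsPosDefOp S.R) {γ : ℝ} (hγ : 0 ≤ γ) {P : Euc n →L[ℝ] Euc n}
    (hP : IsPosSemidefOp P) : IsPosDefOp (S.hess γ P) := by
  constructor
  · intro x y
    simp only [hess, add_apply, smul_apply, ContinuousLinearMap.coe_comp, Function.comp,
      inner_add_left, inner_add_right, inner_smul_left, inner_smul_right, RCLike.conj_to_real,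
      hR.1, ContinuousLinearMap.adjoint_inner_left, ContinuousLinearMap.adjoint_inner_right, hP.1]
  · intro x hx
    have h1 := hR.2 x hx
    have h2 := mul_nonneg hγ (hP.2 (S.B x))
    simp only [hess, add_apply, smul_apply,
      ContinuousLinearMap.coe_comp, Function.comp, inner_add_right, inner_smul_right,
      ContinuousLinearMap.adjoint_inner_right]
    linarith

/-- `Ring.inverse` is `0` at non-units, so invertibility is what makes `gain` satisfy its normal
equation. -/
theorem isUnit_hess (hR : IsPosDefOp S.R) {γ : ℝ} (hγ : 0 ≤ γ) {P : Euc n →L[ℝ] Euc n}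
    (hP : IsPosSemidefOp P) : IsUnit (S.hess γ P) := by
  have h := isPosDefOp_hess hR hγ hP
  rw [ContinuousLinearMap.isUnit_iff_bijective]
  have hinj : Function.Injective (S.hess γ P : Euc m →ₗ[ℝ] Euc m) := by
    rw [injective_iff_map_eq_zero]
    intro x hx
    by_contra hne
    have := h.2 x hne
    have hx' : S.hess γ P x = 0 := hx
    rw [hx', inner_zero_right] at this
    exact lt_irrefl _ this
  exact ⟨hinj, LinearMap.injective_iff_surjective.1 hinj⟩

theorem hess_gain (hR : IsPosDefOp S.R) {γ : ℝ} (hγ : 0 ≤ γ) {P : Euc n →L[ℝ] Euc n}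
    (hP : IsPosSemidefOp P) (x : Euc n) :
    S.hess γ P (S.gain γ P x) = -(γ • S.B.adjoint (P (S.A x))) := by
  have h := Ring.mul_inverse_cancel _ (isUnit_hess hR hγ hP)
  have h1 : ∀ z, S.hess γ P (Ring.inverse (S.hess γ P) z) = z := fun z => by
    have := congrArg (fun T : Euc m →L[ℝ] Euc m => T z) h
    simpa using this
  simp [gain, h1]

theorem isPosSemidefOp_riccati (hQ : IsPosDefOp S.Q) (hR : IsPosDefOp S.R) {γ : ℝ} (hγ : 0 ≤ γ)
    {P : Euc n →L[ℝ] Euc n} (hP : IsPosSemidefOp P) : IsPosSemidefOp (S.riccati γ P) := by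
  constructor
  · intro x y
    simp only [riccati, ContinuousLinearMap.coe_comp, Function.comp,
      inner_add_left, inner_add_right, inner_smul_left, inner_smul_right, RCLike.conj_to_real,
      hR.1, hQ.1, ContinuousLinearMap.adjoint_inner_left, ContinuousLinearMap.adjoint_inner_right,
      hP.1, add_apply, smul_apply]
  · intro x
    have h1 := hQ.isPosSemidefOp.2 x
    have h2 := mul_nonneg hγ (hP.2 (S.closedLoop (S.gain γ P) x))
    have h3 := hR.isPosSemidefOp.2 (S.gain γ P x)
    simp only [riccati, add_apply, smul_apply,
      ContinuousLinearMap.coe_comp, Function.comp, inner_add_right, inner_smul_right,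
      ContinuousLinearMap.adjoint_inner_right]
    linarith

/-- Completing the square in the one-step cost. -/
theorem stageCost_add_eq (hR : IsPosDefOp S.R) {γ : ℝ} (hγ : 0 ≤ γ) {P : Euc n →L[ℝ] Euc n}
    (hP : IsPosSemidefOp P) (x : Euc n) (u : Euc m) :
    S.stageCost x u + γ * ⟪S.A x + S.B u, P (S.A x + S.B u)⟫ =
      ⟪x, S.riccati γ P x⟫ +
        ⟪u - S.gain γ P x, S.hess γ P (u - S.gain γ P x)⟫ := by
  obtain ⟨w, rfl⟩ : ∃ w, u = S.gain γ P x + w := ⟨u - S.gain γ P x, by abel⟩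
  have h1 := hess_gain hR hγ hP x
  have e1 : S.A x + S.B (S.gain γ P x + w) = S.closedLoop (S.gain γ P) x + S.B w := by
    simp [closedLoop, add_assoc]
  rw [e1, add_sub_cancel_left, stageCost, inner_map_add_self hR.1, inner_map_add_self hP.1]
  -- The normal equation `hess_gain` says exactly that the part linear in `w` vanishes.
  have h2 : ⟪w, S.R (S.gain γ P x)⟫ + γ * ⟪S.B w, P (S.closedLoop (S.gain γ P) x)⟫ = 0 := by
    have h3 : ⟪w, S.hess γ P (S.gain γ P x)⟫ = -(γ * ⟪S.B w, P (S.A x)⟫) := by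
      rw [h1, inner_neg_right, inner_smul_right, ContinuousLinearMap.adjoint_inner_right]
    simp only [hess, add_apply, smul_apply,
      ContinuousLinearMap.coe_comp, Function.comp, inner_add_right, inner_smul_right,
      ContinuousLinearMap.adjoint_inner_right] at h3
    simp only [closedLoop, add_apply, ContinuousLinearMap.coe_comp,
      Function.comp, map_add, inner_add_right]
    linarith
  simp only [riccati, hess, add_apply, smul_apply,
    ContinuousLinearMap.coe_comp, Function.comp, inner_add_right, inner_smul_right,
    ContinuousLinearMap.adjoint_inner_right]
  linarith

theorem continuousAt_inverse_hess (hR : IsPosDefOp S.R) {γ : ℝ} (hγ : 0 ≤ γ)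
    {P : Euc n →L[ℝ] Euc n} (hP : IsPosSemidefOp P) :
    ContinuousAt (fun p : ℝ × (Euc n →L[ℝ] Euc n) => Ring.inverse (S.hess p.1 p.2)) (γ, P) := by
  obtain ⟨M, hM⟩ := isUnit_hess hR hγ hP
  have h1 : ContinuousAt (fun p : ℝ × (Euc n →L[ℝ] Euc n) => S.hess p.1 p.2) (γ, P) := by
    unfold hess
    fun_prop
  have h2 := NormedRing.inverse_continuousAt M
  rw [hM] at h2
  exact ContinuousAt.comp (f := fun p : ℝ × (Euc n →L[ℝ] Euc n) => S.hess p.1 p.2)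
    (x := (γ, P)) h2 h1

theorem continuousAt_gain (hR : IsPosDefOp S.R) {γ : ℝ} (hγ : 0 ≤ γ) {P : Euc n →L[ℝ] Euc n}
    (hP : IsPosSemidefOp P) :
    ContinuousAt (fun p : ℝ × (Euc n →L[ℝ] Euc n) => S.gain p.1 p.2) (γ, P) := by
  have h := continuousAt_inverse_hess hR hγ hP
  unfold gain
  fun_prop

theorem continuousAt_riccati (hR : IsPosDefOp S.R) {γ : ℝ} (hγ : 0 ≤ γ)
    {P : Euc n →L[ℝ] Euc n} (hP : IsPosSemidefOp P) :
    ContinuousAt (fun p : ℝ × (Euc n →L[ℝ] Euc n) => S.riccati p.1 p.2) (γ, P) := by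
  have h := continuousAt_gain hR hγ hP
  have h1 : ContinuousAt (fun p : ℝ × (Euc n →L[ℝ] Euc n) => (S.gain p.1 p.2).adjoint) (γ, P) :=
    ContinuousAt.comp (ContinuousLinearMap.adjoint (𝕜 := ℝ) (E := Euc n)
      (F := Euc m)).continuous.continuousAt h
  have h2 : ContinuousAt (fun p : ℝ × (Euc n →L[ℝ] Euc n) => S.closedLoop (S.gain p.1 p.2))
      (γ, P) := by
    unfold closedLoop
    fun_prop
  have h3 : ContinuousAt (fun p : ℝ × (Euc n →L[ℝ] Euc n) =>
      (S.closedLoop (S.gain p.1 p.2)).adjoint) (γ, P) :=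
    ContinuousAt.comp (ContinuousLinearMap.adjoint (𝕜 := ℝ) (E := Euc n)
      (F := Euc n)).continuous.continuousAt h2
  unfold riccati
  fun_prop

end LQR

namespace LQR

variable {n m : ℕ} {S : LQR n m}

theorem stageCost_nonneg (hQ : IsPosDefOp S.Q) (hR : IsPosDefOp S.R) (x : Euc n) (u : Euc m) :
    0 ≤ S.stageCost x u :=
  add_nonneg (hQ.isPosSemidefOp.2 x) (hR.isPosSemidefOp.2 u)

/-! ### Open-loop controls -/

/-- The trajectory under an open-loop control. -/
def ctrlTraj (S : LQR n m) (u : ℕ → Euc m) (x₀ : Euc n) : ℕ → Euc n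
  | 0 => x₀
  | t + 1 => S.A (S.ctrlTraj u x₀ t) + S.B (u t)

theorem ctrlTraj_succ' (u : ℕ → Euc m) (x₀ : Euc n) (t : ℕ) :
    S.ctrlTraj u x₀ (t + 1) = S.ctrlTraj (fun s => u (s + 1)) (S.A x₀ + S.B (u 0)) t := by
  induction t with
  | zero => rfl
  | succ t ih => rw [ctrlTraj, ih, ctrlTraj]

theorem ctrlTraj_eq_sum (u : ℕ → Euc m) (x₀ : Euc n) (t : ℕ) :
    S.ctrlTraj u x₀ t = (S.A ^ t) x₀ +
      ∑ s ∈ Finset.range t, (S.A ^ (t - 1 - s)) (S.B (u s)) := by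
  induction t with
  | zero => simp [ctrlTraj]
  | succ t ih =>
    rw [ctrlTraj, ih, map_add, map_sum, Finset.sum_range_succ, add_assoc, pow_succ']
    congr 2
    swap
    · simp
    rw [Nat.add_sub_cancel]
    refine Finset.sum_congr rfl fun s hs => ?_
    rw [Finset.mem_range] at hs
    have : t - s = t - 1 - s + 1 := by omega
    rw [this, pow_succ']
    rfl

theorem Controllable.exists_steering (hS : S.Controllable) (x₀ : Euc n) :
    ∃ u : ℕ → Euc m, S.ctrlTraj u x₀ n = 0 ∧ ∀ t, n ≤ t → u t = 0 := by
  have h1 : -(S.A ^ n) x₀ ∈ (⊤ : Submodule ℝ (Euc n)) := trivial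
  rw [← hS, Submodule.mem_iSup_iff_exists_finsupp] at h1
  obtain ⟨g, hg, hsum⟩ := h1
  choose w hw using hg
  -- The control at time `t` reaches time `n` through `A ^ (n - 1 - t)`, so Kalman's vectors are
  -- applied in reverse order.
  refine ⟨fun t => if h : t < n then w ⟨n - 1 - t, by omega⟩ else 0, ?_, fun t ht => by simp [ht]⟩
  rw [ctrlTraj_eq_sum]
  have h2 : ∑ s ∈ Finset.range n, (S.A ^ (n - 1 - s)) (S.B (if h : s < n then
      w ⟨n - 1 - s, by omega⟩ else 0)) =
      ∑ s ∈ Finset.range n, (fun k => if h : k < n then g ⟨k, h⟩ else 0) (n - 1 - s) := by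
    refine Finset.sum_congr rfl fun s hs => ?_
    rw [Finset.mem_range] at hs
    have h3 : n - 1 - s < n := by omega
    simp only [hs, h3, dif_pos]
    exact hw ⟨n - 1 - s, h3⟩
  rw [h2, Finset.sum_range_reflect (fun k => if h : k < n then g ⟨k, h⟩ else 0) n,
    Finset.sum_range]
  rw [Finsupp.sum_fintype _ _ (fun _ => rfl)] at hsum
  simp [hsum]

/-! ### Value iteration -/

/-- Value iteration, started at `0`. -/
def valueIter (S : LQR n m) (γ : ℝ) : ℕ → Euc n →L[ℝ] Euc n
  | 0 => 0
  | k + 1 => S.riccati γ (S.valueIter γ k)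

theorem isPosSemidefOp_valueIter (hQ : IsPosDefOp S.Q) (hR : IsPosDefOp S.R) {γ : ℝ} (hγ : 0 ≤ γ)
    (k : ℕ) : IsPosSemidefOp (S.valueIter γ k) := by
  induction k with
  | zero => exact isPosSemidefOp_zero
  | succ k ih => exact isPosSemidefOp_riccati hQ hR hγ ih

theorem riccati_le (hR : IsPosDefOp S.R) {γ : ℝ} (hγ : 0 ≤ γ) {P : Euc n →L[ℝ] Euc n}
    (hP : IsPosSemidefOp P) (x : Euc n) (u : Euc m) :
    ⟪x, S.riccati γ P x⟫ ≤ S.stageCost x u + γ * ⟪S.A x + S.B u, P (S.A x + S.B u)⟫ := by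
  rw [stageCost_add_eq hR hγ hP]
  exact le_add_of_nonneg_right ((isPosDefOp_hess hR hγ hP).isPosSemidefOp.2 _)

/-- Dynamic programming: the first control is split off and the induction hypothesis is applied to
the shifted control. -/
theorem valueIter_le (hQ : IsPosDefOp S.Q) (hR : IsPosDefOp S.R) {γ : ℝ} (hγ : 0 ≤ γ) (k : ℕ)
    (u : ℕ → Euc m) (x₀ : Euc n) : ⟪x₀, S.valueIter γ k x₀⟫ ≤
      ∑ t ∈ Finset.range k, γ ^ t * S.stageCost (S.ctrlTraj u x₀ t) (u t) := by
  induction k generalizing u x₀ with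
  | zero => simp [valueIter]
  | succ k ih =>
    refine (riccati_le hR hγ (isPosSemidefOp_valueIter hQ hR hγ k) x₀ (u 0)).trans ?_
    rw [Finset.sum_range_succ', add_comm]
    have h1 := mul_le_mul_of_nonneg_left (ih (fun s => u (s + 1)) (S.A x₀ + S.B (u 0))) hγ
    simp only [← ctrlTraj_succ', Finset.mul_sum] at h1
    refine add_le_add (h1.trans (le_of_eq ?_)) (le_of_eq ?_)
    · exact Finset.sum_congr rfl fun t _ => by ring
    · simp [ctrlTraj]

theorem riccati_mono (hR : IsPosDefOp S.R) {γ : ℝ} (hγ : 0 ≤ γ) {P P' : Euc n →L[ℝ] Euc n}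
    (hP : IsPosSemidefOp P) (hP' : IsPosSemidefOp P') (h : ∀ x, ⟪x, P x⟫ ≤ ⟪x, P' x⟫) (x : Euc n) :
    ⟪x, S.riccati γ P x⟫ ≤ ⟪x, S.riccati γ P' x⟫ := by
  have h1 := stageCost_add_eq hR hγ hP' x (S.gain γ P' x)
  rw [sub_self, inner_zero_left, add_zero] at h1
  rw [← h1]
  refine (riccati_le hR hγ hP x (S.gain γ P' x)).trans ?_
  have := mul_le_mul_of_nonneg_left (h (S.A x + S.B (S.gain γ P' x))) hγ
  linarith

theorem valueIter_mono (hQ : IsPosDefOp S.Q) (hR : IsPosDefOp S.R) {γ : ℝ} (hγ : 0 ≤ γ)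
    (x : Euc n) : Monotone fun k => ⟪x, S.valueIter γ k x⟫ := by
  refine monotone_nat_of_le_succ fun k => ?_
  induction k generalizing x with
  | zero =>
    simp only [valueIter, zero_apply, inner_zero_right]
    exact (isPosSemidefOp_valueIter hQ hR hγ 1).2 x
  | succ k ih =>
    exact riccati_mono hR hγ (isPosSemidefOp_valueIter hQ hR hγ k)
      (isPosSemidefOp_valueIter hQ hR hγ (k + 1)) ih x

/-- The Riccati equation has a solution for every discount factor, bounded uniformly. -/
theorem exists_riccati_fixed (hQ : IsPosDefOp S.Q) (hR : IsPosDefOp S.R) (hS : S.Controllable) :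
    ∃ J : Euc n → ℝ, ∀ γ ∈ Icc (0 : ℝ) 1, ∃ P : Euc n →L[ℝ] Euc n,
      IsPosSemidefOp P ∧ S.riccati γ P = P ∧ ∀ x, ⟪x, P x⟫ ≤ J x := by
  choose u hu0 hu using hS.exists_steering
  have hzero : ∀ x k, S.ctrlTraj (u x) x (n + k) = 0 := by
    intro x k
    induction k with
    | zero => exact hu0 x
    | succ k ih => rw [← add_assoc, ctrlTraj, ih, hu x _ (Nat.le_add_right n k)]; simp
  -- `J` is the undiscounted cost of steering to the origin in `n` steps; after that nothing is
  -- paid, so it dominates value iteration for every horizon and every `γ ≤ 1`.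
  refine ⟨fun x => ∑ t ∈ Finset.range n, S.stageCost (S.ctrlTraj (u x) x t) (u x t),
    fun γ hγ => ?_⟩
  have hb : ∀ k x, ⟪x, S.valueIter γ k x⟫ ≤
      ∑ t ∈ Finset.range n, S.stageCost (S.ctrlTraj (u x) x t) (u x t) := by
    intro k x
    refine (valueIter_mono hQ hR hγ.1 x (Nat.le_add_left k n)).trans ?_
    refine (valueIter_le hQ hR hγ.1 (n + k) (u x) x).trans ?_
    rw [Finset.sum_range_add]
    have h1 : ∑ t ∈ Finset.range k, γ ^ (n + t) *
        S.stageCost (S.ctrlTraj (u x) x (n + t)) (u x (n + t)) = 0 := by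
      refine Finset.sum_eq_zero fun t _ => ?_
      rw [hzero, hu x _ (Nat.le_add_right n t)]
      simp [stageCost]
    rw [h1, add_zero]
    exact Finset.sum_le_sum fun t _ => mul_le_of_le_one_left (stageCost_nonneg hQ hR _ _)
      (pow_le_one₀ hγ.1 hγ.2)
  obtain ⟨P, ⟨hP, hPJ⟩, hlim⟩ := (isCompact_posSemidefOp _).ultrafilter_le_nhds
    ((hyperfilter ℕ).map fun k => S.valueIter γ k) (le_principal_iff.2 (Ultrafilter.mem_map.2
      (univ_mem' fun k => ⟨isPosSemidefOp_valueIter hQ hR hγ.1 k, hb k⟩)))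
  have hlim' : Tendsto (fun k => S.valueIter γ k) (hyperfilter ℕ) (𝓝 P) := hlim
  refine ⟨P, hP, ?_, hPJ⟩
  refine eq_of_inner_map_self_eq (isPosSemidefOp_riccati hQ hR hγ.1 hP).1 hP.1 fun x => ?_
  have hU : ((hyperfilter ℕ : Ultrafilter ℕ) : Filter ℕ) ≤ atTop := Nat.hyperfilter_le_atTop
  have h1 : Tendsto (fun k => S.valueIter γ (k + 1)) (hyperfilter ℕ) (𝓝 (S.riccati γ P)) :=
    Tendsto.comp (f := fun k => (γ, S.valueIter γ k)) (continuousAt_riccati hR hγ.1 hP)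
      (tendsto_const_nhds.prodMk_nhds hlim')
  have happ : Continuous fun T : Euc n →L[ℝ] Euc n => ⟪x, T x⟫ := by fun_prop
  have h2 := (happ.tendsto _).comp hlim'
  have h3 := (happ.tendsto _).comp h1
  -- Monotonicity makes the whole sequence of forms converge, so the iteration and its shift have
  -- the same limit; continuity of `riccati` makes this limit a fixed point.
  have h4 := tendsto_atTop_ciSup (valueIter_mono hQ hR hγ.1 x)
    ⟨_, forall_mem_range.2 fun k => hb k x⟩
  have h5 := tendsto_nhds_unique h2 (h4.mono_left hU)
  have h6 := tendsto_nhds_unique h3 (((tendsto_add_atTop_iff_nat 1).2 h4).mono_left hU)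
  rw [h5, h6]

/-! ### Costs of policies -/

/-- The completed square at time `t`, weighted by `γ ^ t`: at a fixed point the values `⟪x_t, P
x_t⟫` cancel between consecutive times. -/
theorem telescope (hR : IsPosDefOp S.R) {γ : ℝ} (hγ : 0 ≤ γ) {P : Euc n →L[ℝ] Euc n}
    (hP : IsPosSemidefOp P) (hfix : S.riccati γ P = P) (π : Euc n → Euc m) (x₀ : Euc n) (T : ℕ) :
    ⟪x₀, P x₀⟫ + ∑ t ∈ Finset.range T, γ ^ t *
        ⟪π (S.traj π x₀ t) - S.gain γ P (S.traj π x₀ t),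
          S.hess γ P (π (S.traj π x₀ t) - S.gain γ P (S.traj π x₀ t))⟫ =
      ∑ t ∈ Finset.range T, γ ^ t * S.stageCost (S.traj π x₀ t) (π (S.traj π x₀ t)) +
        γ ^ T * ⟪S.traj π x₀ T, P (S.traj π x₀ T)⟫ := by
  induction T with
  | zero => simp [traj]
  | succ T ih =>
    rw [Finset.sum_range_succ, Finset.sum_range_succ, ← add_assoc, ih]
    have h := stageCost_add_eq hR hγ hP (S.traj π x₀ T) (π (S.traj π x₀ T))
    rw [hfix] at h
    rw [traj, pow_succ]
    linear_combination (-γ ^ T) * h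

theorem summable_of_costFrom_ne_top (hQ : IsPosDefOp S.Q) (hR : IsPosDefOp S.R) {γ : ℝ}
    (hγ : 0 ≤ γ) {π : Euc n → Euc m} {x₀ : Euc n} (h : S.costFrom γ π x₀ ≠ ∞) :
    Summable fun t => γ ^ t * S.stageCost (S.traj π x₀ t) (π (S.traj π x₀ t)) := by
  have h1 := ENNReal.summable_toReal h
  refine h1.congr fun t => ENNReal.toReal_ofReal ?_
  exact mul_nonneg (by positivity) (stageCost_nonneg hQ hR _ _)

theorem tendsto_pow_mul_norm_sq (hQ : IsPosDefOp S.Q) (hR : IsPosDefOp S.R) {γ : ℝ}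
    (hγ : 0 ≤ γ) {π : Euc n → Euc m} {x₀ : Euc n} (h : S.costFrom γ π x₀ ≠ ∞) :
    Tendsto (fun t => γ ^ t * ‖S.traj π x₀ t‖ ^ 2) atTop (𝓝 0) ∧
    Tendsto (fun t => γ ^ t * ‖π (S.traj π x₀ t)‖ ^ 2) atTop (𝓝 0) := by
  have h1 := (summable_of_costFrom_ne_top hQ hR hγ h).tendsto_atTop_zero
  obtain ⟨c, hc, hcQ⟩ := hQ.exists_pos_le
  obtain ⟨c', hc', hcR⟩ := hR.exists_pos_le
  have h2 := h1.const_mul c⁻¹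
  have h3 := h1.const_mul c'⁻¹
  rw [mul_zero] at h2 h3
  constructor
  · refine squeeze_zero (fun t => by positivity) (fun t => ?_) h2
    rw [← div_eq_inv_mul, le_div_iff₀ hc, mul_assoc]
    refine mul_le_mul_of_nonneg_left ?_ (by positivity)
    have e1 := hcQ (S.traj π x₀ t)
    have e2 := hR.isPosSemidefOp.2 (π (S.traj π x₀ t))
    rw [stageCost]
    linarith
  · refine squeeze_zero (fun t => by positivity) (fun t => ?_) h3
    rw [← div_eq_inv_mul, le_div_iff₀ hc', mul_assoc]
    refine mul_le_mul_of_nonneg_left ?_ (by positivity)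
    have e1 := hcR (π (S.traj π x₀ t))
    have e2 := hQ.isPosSemidefOp.2 (S.traj π x₀ t)
    rw [stageCost]
    linarith

/-- The performance difference of a policy of finite cost. -/
theorem costFrom_eq (hQ : IsPosDefOp S.Q) (hR : IsPosDefOp S.R) {γ : ℝ}
    (hγ : 0 ≤ γ) {P : Euc n →L[ℝ] Euc n} (hP : IsPosSemidefOp P) (hfix : S.riccati γ P = P)
    {π : Euc n → Euc m} {x₀ : Euc n} (h : S.costFrom γ π x₀ ≠ ∞) :
    S.costFrom γ π x₀ = ENNReal.ofReal ⟪x₀, P x₀⟫ + ∑' t, ENNReal.ofReal (γ ^ t *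
        ⟪π (S.traj π x₀ t) - S.gain γ P (S.traj π x₀ t),
          S.hess γ P (π (S.traj π x₀ t) - S.gain γ P (S.traj π x₀ t))⟫) := by
  have hsum := summable_of_costFrom_ne_top hQ hR hγ h
  have hM := (isPosDefOp_hess hR hγ hP).isPosSemidefOp
  have ha : ∀ t, 0 ≤ γ ^ t * S.stageCost (S.traj π x₀ t) (π (S.traj π x₀ t)) := fun t =>
    mul_nonneg (by positivity) (stageCost_nonneg hQ hR _ _)
  have hb : ∀ t, 0 ≤ γ ^ t * ⟪π (S.traj π x₀ t) - S.gain γ P (S.traj π x₀ t),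
      S.hess γ P (π (S.traj π x₀ t) - S.gain γ P (S.traj π x₀ t))⟫ := fun t =>
    mul_nonneg (by positivity) (hM.2 _)
  -- Finite cost makes the stage costs summable, and they dominate `‖x_T‖²` because `Q` is positive
  -- definite; hence the boundary term vanishes, even for `γ = 1`.
  have hend : Tendsto (fun T => γ ^ T * ⟪S.traj π x₀ T, P (S.traj π x₀ T)⟫) atTop (𝓝 0) := by
    have h1 := (tendsto_pow_mul_norm_sq hQ hR hγ h).1.const_mul ‖P‖
    rw [mul_zero] at h1
    refine squeeze_zero (fun t => mul_nonneg (by positivity) (hP.2 _)) (fun t => ?_) h1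
    have := mul_le_mul_of_nonneg_left (inner_map_self_le P (S.traj π x₀ t)) (pow_nonneg hγ t)
    linarith
  have hbs : HasSum (fun t => γ ^ t * ⟪π (S.traj π x₀ t) - S.gain γ P (S.traj π x₀ t),
      S.hess γ P (π (S.traj π x₀ t) - S.gain γ P (S.traj π x₀ t))⟫)
      ((∑' t, γ ^ t * S.stageCost (S.traj π x₀ t) (π (S.traj π x₀ t))) - ⟪x₀, P x₀⟫) := by
    rw [hasSum_iff_tendsto_nat_of_nonneg hb]
    have h1 := (hsum.hasSum.tendsto_sum_nat.add hend).sub_const ⟪x₀, P x₀⟫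
    rw [add_zero] at h1
    refine h1.congr fun T => ?_
    rw [← telescope hR hγ hP hfix π x₀ T]
    ring
  rw [costFrom, ← ENNReal.ofReal_tsum_of_nonneg ha hsum,
    ← ENNReal.ofReal_tsum_of_nonneg hb hbs.summable, hbs.tsum_eq,
    ← ENNReal.ofReal_add (hP.2 _) (hbs.nonneg hb)]
  congr 1
  ring

theorem le_costFrom (hQ : IsPosDefOp S.Q) (hR : IsPosDefOp S.R) {γ : ℝ}
    (hγ : 0 ≤ γ) {P : Euc n →L[ℝ] Euc n} (hP : IsPosSemidefOp P) (hfix : S.riccati γ P = P)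
    (π : Euc n → Euc m) (x₀ : Euc n) : ENNReal.ofReal ⟪x₀, P x₀⟫ ≤ S.costFrom γ π x₀ := by
  by_cases h : S.costFrom γ π x₀ = ∞
  · rw [h]; exact le_top
  · rw [costFrom_eq hQ hR hγ hP hfix h]
    exact le_self_add

/-- Finiteness is not known beforehand, so the upper bound comes from partial sums in `telescope`,
where all deviations are zero and the boundary term has the right sign. -/
theorem costFrom_gain (hQ : IsPosDefOp S.Q) (hR : IsPosDefOp S.R) {γ : ℝ}
    (hγ : 0 ≤ γ) {P : Euc n →L[ℝ] Euc n} (hP : IsPosSemidefOp P) (hfix : S.riccati γ P = P)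
    (x₀ : Euc n) : S.costFrom γ (fun x => S.gain γ P x) x₀ = ENNReal.ofReal ⟪x₀, P x₀⟫ := by
  refine le_antisymm ?_ (le_costFrom hQ hR hγ hP hfix _ x₀)
  rw [costFrom, ENNReal.tsum_eq_iSup_nat]
  refine iSup_le fun T => ?_
  rw [← ENNReal.ofReal_sum_of_nonneg fun t _ =>
    mul_nonneg (by positivity) (stageCost_nonneg hQ hR _ _)]
  refine ENNReal.ofReal_le_ofReal ?_
  have h := telescope hR hγ hP hfix (fun x => S.gain γ P x) x₀ T
  simp only [sub_self, inner_zero_left, mul_zero, Finset.sum_const_zero, add_zero] at h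
  rw [h]
  exact le_add_of_nonneg_right (mul_nonneg (by positivity) (hP.2 _))

/-- Each form is the cost of its own gain and a lower bound for the cost of every policy. -/
theorem riccati_fixed_unique (hQ : IsPosDefOp S.Q) (hR : IsPosDefOp S.R) {γ : ℝ}
    (hγ : 0 ≤ γ) {P P' : Euc n →L[ℝ] Euc n} (hP : IsPosSemidefOp P) (hfix : S.riccati γ P = P)
    (hP' : IsPosSemidefOp P') (hfix' : S.riccati γ P' = P') : P = P' := by
  refine eq_of_inner_map_self_eq hP.1 hP'.1 fun x => le_antisymm ?_ ?_
  · have h := le_costFrom hQ hR hγ hP hfix (fun x => S.gain γ P' x) x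
    rw [costFrom_gain hQ hR hγ hP' hfix'] at h
    exact (ENNReal.ofReal_le_ofReal_iff (hP'.2 x)).1 h
  · have h := le_costFrom hQ hR hγ hP' hfix' (fun x => S.gain γ P x) x
    rw [costFrom_gain hQ hR hγ hP hfix] at h
    exact (ENNReal.ofReal_le_ofReal_iff (hP.2 x)).1 h

/-- The solutions of the Riccati equations, depending continuously on the discount factor. -/
theorem exists_continuousOn_riccati_fixed (hQ : IsPosDefOp S.Q) (hR : IsPosDefOp S.R)
    (hS : S.Controllable) : ∃ P : ℝ → Euc n →L[ℝ] Euc n, ContinuousOn P (Icc 0 1) ∧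
      ∀ γ ∈ Icc (0 : ℝ) 1, IsPosSemidefOp (P γ) ∧ S.riccati γ (P γ) = P γ := by
  obtain ⟨J, hJ⟩ := exists_riccati_fixed hQ hR hS
  have hJ' : ∀ γ : ℝ, ∃ P : Euc n →L[ℝ] Euc n, γ ∈ Icc (0 : ℝ) 1 →
      IsPosSemidefOp P ∧ S.riccati γ P = P ∧ ∀ x, ⟪x, P x⟫ ≤ J x := fun γ => by
    by_cases h : γ ∈ Icc (0 : ℝ) 1
    · obtain ⟨P, hP⟩ := hJ γ h
      exact ⟨P, fun _ => hP⟩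
    · exact ⟨0, fun h' => absurd h' h⟩
  choose P hP using hJ'
  refine ⟨P, fun γ hγ => ?_, fun γ hγ => ⟨(hP γ hγ).1, (hP γ hγ).2.1⟩⟩
  -- Along any ultrafilter the solutions have a limit in the compact set bounded by `J`; it solves
  -- the limiting equation, hence is the unique solution.
  rw [ContinuousWithinAt, tendsto_iff_ultrafilter]
  intro U hU
  have hmem : ∀ᶠ γ' in (U : Filter ℝ), γ' ∈ Icc (0 : ℝ) 1 := hU self_mem_nhdsWithin
  obtain ⟨P', ⟨hP', -⟩, hlim⟩ := (isCompact_posSemidefOp J).ultrafilter_le_nhds (U.map P)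
    (le_principal_iff.2 (Ultrafilter.mem_map.2 (by
      filter_upwards [hmem] with γ' h using ⟨(hP γ' h).1, (hP γ' h).2.2⟩)))
  have hlim' : Tendsto P U (𝓝 P') := hlim
  have hid : Tendsto (fun γ' : ℝ => γ') U (𝓝 γ) := hU.trans nhdsWithin_le_nhds
  have h1 : Tendsto (fun γ' => S.riccati γ' (P γ')) U (𝓝 (S.riccati γ P')) :=
    Tendsto.comp (f := fun γ' => (γ', P γ')) (continuousAt_riccati hR hγ.1 hP')
      (hid.prodMk_nhds hlim')
  have h2 : S.riccati γ P' = P' := by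
    refine tendsto_nhds_unique h1 (hlim'.congr' ?_)
    filter_upwards [hmem] with γ' h using (hP γ' h).2.1.symm
  rwa [riccati_fixed_unique hQ hR hγ.1 (hP γ hγ).1 (hP γ hγ).2.1 hP' h2]

end LQR

/-! ### Discounted trajectory bounds. -/

/-- A discounted discrete Gronwall bound. Only `γ α < 1` matters; the undiscounted rate `α` may
exceed one, as the optimal closed loop need not be stable. -/
theorem discounted_sum_le {a c : ℕ → ℝ} {γ α ς : ℝ} (hγ : 0 ≤ γ) (hγ1 : γ ≤ 1)
    (ha : ∀ t, 0 ≤ a t) (hc : ∀ t, 0 ≤ c t) (hrec : ∀ t, a (t + 1) ≤ α * a t + c t)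
    (hς : γ * α ≤ ς) (hς1 : ς < 1) (T : ℕ) :
    ∑ t ∈ Finset.range T, γ ^ t * a t ≤
      (1 - ς)⁻¹ * (a 0 + ∑ t ∈ Finset.range T, γ ^ t * c t) := by
  have key : (1 - ς) * ∑ t ∈ Finset.range T, γ ^ t * a t + γ ^ T * a T ≤
      a 0 + ∑ t ∈ Finset.range T, γ ^ t * c t := by
    induction T with
    | zero => simp
    | succ T ih =>
      rw [Finset.sum_range_succ, Finset.sum_range_succ]
      have h1 : γ * a (T + 1) ≤ ς * a T + c T := by
        have e1 := mul_le_mul_of_nonneg_left (hrec T) hγ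
        have e2 := mul_le_mul_of_nonneg_right hς (ha T)
        have e3 := mul_le_mul_of_nonneg_right hγ1 (hc T)
        linarith
      have h2 := mul_le_mul_of_nonneg_left h1 (pow_nonneg hγ T)
      rw [pow_succ]
      linarith
  rw [← div_eq_inv_mul, le_div_iff₀ (by linarith)]
  have := mul_nonneg (pow_nonneg hγ T) (ha T)
  linarith

theorem linPolicy_add {n m d : ℕ} (f : Fin d → Euc n → Euc m) (u v : Euc d) (x : Euc n) :
    linPolicy f (u + v) x = linPolicy f u x + linPolicy f v x := by
  simp [linPolicy, add_smul, Finset.sum_add_distrib]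

theorem linPolicy_smul {n m d : ℕ} (f : Fin d → Euc n → Euc m) (c : ℝ) (u : Euc d) (x : Euc n) :
    linPolicy f (c • u) x = c • linPolicy f u x := by
  simp [linPolicy, Finset.smul_sum, smul_smul]

theorem linPolicy_sub {n m d : ℕ} (f : Fin d → Euc n → Euc m) (u v : Euc d) (x : Euc n) :
    linPolicy f (u - v) x = linPolicy f u x - linPolicy f v x := by
  simp [linPolicy, sub_smul, Finset.sum_sub_distrib]

/-- Lipschitz and growth bounds of the policies `linPolicy f u`; the offset `b` may be `0` if the
features vanish at the origin. -/
structure FeatureBound {n m d : ℕ} (f : Fin d → Euc n → Euc m) (Λ b : ℝ) : Prop where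
  nonneg : 0 ≤ Λ
  offset_nonneg : 0 ≤ b
  lipschitz : ∀ u x y, ‖linPolicy f u x - linPolicy f u y‖ ^ 2 ≤ Λ * ‖u‖ ^ 2 * ‖x - y‖ ^ 2
  growth : ∀ u x, ‖linPolicy f u x‖ ^ 2 ≤ Λ * ‖u‖ ^ 2 * (b + ‖x‖ ^ 2)

theorem exists_featureBound {n m d : ℕ} {f : Fin d → Euc n → Euc m}
    (hf : ∀ k, ∃ L : ℝ≥0, LipschitzWith L (f k)) {b : ℝ} (hb : b = 1 ∨ b = 0 ∧ ∀ k, f k 0 = 0) :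
    ∃ Λ, FeatureBound f Λ b := by
  choose L hL using hf
  set σ : ℝ := ∑ k, (L k : ℝ) with hσ
  set τ : ℝ := ∑ k, ‖f k 0‖ with hτ
  have hσ0 : 0 ≤ σ := Finset.sum_nonneg fun k _ => (L k).2
  have hτ0 : 0 ≤ τ := Finset.sum_nonneg fun k _ => norm_nonneg _
  have hlip : ∀ u x y, ‖linPolicy f u x - linPolicy f u y‖ ≤ σ * ‖u‖ * ‖x - y‖ := by
    intro u x y
    rw [linPolicy, linPolicy, ← Finset.sum_sub_distrib, hσ, Finset.sum_mul, Finset.sum_mul]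
    refine norm_sum_le_of_le _ fun k _ => ?_
    rw [← smul_sub, norm_smul]
    have h1 : ‖f k x - f k y‖ ≤ L k * ‖x - y‖ := (hL k).norm_sub_le x y
    have h2 : ‖u k‖ ≤ ‖u‖ := PiLp.norm_apply_le u k
    calc ‖u k‖ * ‖f k x - f k y‖ ≤ ‖u‖ * (L k * ‖x - y‖) := by gcongr
      _ = _ := by ring
  have hzero : ∀ u, ‖linPolicy f u 0‖ ≤ τ * ‖u‖ := by
    intro u
    rw [linPolicy, hτ, Finset.sum_mul]
    refine norm_sum_le_of_le _ fun k _ => ?_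
    rw [norm_smul, mul_comm]
    gcongr
    exact PiLp.norm_apply_le u k
  refine ⟨2 * (σ ^ 2 + τ ^ 2), by positivity, ?_, fun u x y => ?_, fun u x => ?_⟩
  · rcases hb with rfl | ⟨rfl, -⟩ <;> norm_num
  · have h1 := pow_le_pow_left₀ (norm_nonneg _) (hlip u x y) 2
    rw [mul_pow, mul_pow] at h1
    refine h1.trans ?_
    gcongr
    nlinarith [sq_nonneg σ, sq_nonneg τ]
  · have h1 : ‖linPolicy f u x‖ ≤ σ * ‖u‖ * ‖x‖ + τ * ‖u‖ := by
      have h2 := hlip u x 0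
      rw [sub_zero] at h2
      have h3 := norm_add_le (linPolicy f u x - linPolicy f u 0) (linPolicy f u 0)
      rw [sub_add_cancel] at h3
      linarith [hzero u]
    have hτb : τ ^ 2 ≤ τ ^ 2 * b := by
      rcases hb with rfl | ⟨rfl, h0⟩
      · simp
      · simp [hτ, h0]
    have hb0 : 0 ≤ b := by rcases hb with rfl | ⟨rfl, -⟩ <;> norm_num
    have h2 := pow_le_pow_left₀ (norm_nonneg _) h1 2
    refine h2.trans ?_
    have h3 : (σ * ‖u‖ * ‖x‖ + τ * ‖u‖) ^ 2 ≤ 2 * ‖u‖ ^ 2 * (σ ^ 2 * ‖x‖ ^ 2 + τ ^ 2) := by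
      nlinarith [mul_nonneg (sq_nonneg ‖u‖) (sq_nonneg (σ * ‖x‖ - τ))]
    refine h3.trans ?_
    have h4 : σ ^ 2 * ‖x‖ ^ 2 + τ ^ 2 ≤ (σ ^ 2 + τ ^ 2) * (b + ‖x‖ ^ 2) := by
      nlinarith [mul_nonneg (sq_nonneg σ) hb0, mul_nonneg (sq_nonneg τ) (sq_nonneg ‖x‖)]
    have := mul_le_mul_of_nonneg_left h4 (by positivity : 0 ≤ 2 * ‖u‖ ^ 2)
    linarith

namespace LQR

variable {n m d : ℕ} {S : LQR n m}

theorem riccati_fixed_ge (hR : IsPosDefOp S.R) {γ : ℝ} (hγ : 0 ≤ γ)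
    {P : Euc n →L[ℝ] Euc n} (hP : IsPosSemidefOp P) (hfix : S.riccati γ P = P) (x : Euc n) :
    ⟪x, S.Q x⟫ + γ * ⟪S.closedLoop (S.gain γ P) x, P (S.closedLoop (S.gain γ P) x)⟫ ≤ ⟪x, P x⟫ := by
  have h := stageCost_add_eq hR hγ hP x (S.gain γ P x)
  rw [hfix, sub_self, inner_zero_left, add_zero, stageCost] at h
  have h1 := hR.isPosSemidefOp.2 (S.gain γ P x)
  have h2 : S.closedLoop (S.gain γ P) x = S.A x + S.B (S.gain γ P x) := rfl
  rw [h2]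
  linarith

/-- The optimal closed loop contracts the quadratic form of the value function, up to the
discount. -/
theorem exists_contraction (hQ : IsPosDefOp S.Q) (hR : IsPosDefOp S.R) {γ : ℝ} (hγ : 0 ≤ γ)
    {P : Euc n →L[ℝ] Euc n} (hP : IsPosSemidefOp P) (hfix : S.riccati γ P = P) :
    ∃ α, 0 ≤ α ∧ γ * α < 1 ∧ ∀ x, ⟪S.closedLoop (S.gain γ P) x,
      P (S.closedLoop (S.gain γ P) x)⟫ ≤ α * ⟪x, P x⟫ := by
  obtain ⟨c, hc, hcQ⟩ := hQ.exists_pos_le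
  have hlow := riccati_fixed_ge hR hγ hP hfix
  have hup := inner_map_self_le P
  have hN := norm_nonneg P
  set T := S.closedLoop (S.gain γ P)
  -- For `γ = 0` any finite rate is admissible. Otherwise the cost `Q` paid in one step is a fixed
  -- fraction of `P`; the summand `c` in `‖P‖ + c` covers `‖P‖ = 0`.
  rcases hγ.eq_or_lt with rfl | hpos
  · refine ⟨‖P‖ * ‖T‖ ^ 2 / c, by positivity, by simp, fun x => ?_⟩
    have h1 : c * ‖x‖ ^ 2 ≤ ⟪x, P x⟫ := by
      have := hlow x
      rw [zero_mul, add_zero] at this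
      exact (hcQ x).trans this
    calc ⟪T x, P (T x)⟫ ≤ ‖P‖ * ‖T x‖ ^ 2 := hup _
      _ ≤ ‖P‖ * (‖T‖ * ‖x‖) ^ 2 := by gcongr; exact T.le_opNorm x
      _ = ‖P‖ * ‖T‖ ^ 2 / c * (c * ‖x‖ ^ 2) := by field_simp
      _ ≤ _ := by gcongr
  · have hκ : c / (‖P‖ + c) ≤ 1 := by rw [div_le_one (by positivity)]; linarith
    have hκ0 : 0 < c / (‖P‖ + c) := by positivity
    refine ⟨(1 - c / (‖P‖ + c)) / γ, div_nonneg (by linarith) hγ, ?_, fun x => ?_⟩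
    · rw [mul_div_cancel₀ _ hpos.ne']
      linarith
    · have h1 : c / (‖P‖ + c) * ⟪x, P x⟫ ≤ c * ‖x‖ ^ 2 := by
        rw [div_mul_eq_mul_div, div_le_iff₀ (by positivity)]
        have := mul_le_mul_of_nonneg_left (hup x) hc.le
        nlinarith [mul_nonneg hc.le (mul_nonneg hc.le (sq_nonneg ‖x‖))]
      rw [div_mul_eq_mul_div, le_div_iff₀ hpos]
      have := hlow x
      have := hcQ x
      linarith

theorem exists_young {α α' : ℝ} (hα : 0 ≤ α) (h : α < α') : ∃ η > 0, (1 + η) * α < α' := by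
  refine ⟨(α' - α) / (2 * (α + 1)), div_pos (by linarith) (by linarith), ?_⟩
  rw [add_mul, div_mul_eq_mul_div, one_mul, ← lt_sub_iff_add_lt', div_lt_iff₀ (by linarith)]
  nlinarith [mul_pos (sub_pos.2 h) (show 0 < α + 1 by linarith)]

theorem norm_sq_clm_le {k l : ℕ} (T : Euc k →L[ℝ] Euc l) (x : Euc k) :
    ‖T x‖ ^ 2 ≤ ‖T‖ ^ 2 * ‖x‖ ^ 2 := by
  rw [← mul_pow]
  exact pow_le_pow_left₀ (norm_nonneg _) (T.le_opNorm x) 2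

set_option maxHeartbeats 1000000 in
/-- Uniform bounds on discounted trajectories for parameters and discount factors close to the
optimal ones. -/
theorem exists_trajectory_bound (hQ : IsPosDefOp S.Q) (hR : IsPosDefOp S.R) {γ₁ : ℝ}
    (hγ₁ : 0 ≤ γ₁) {P : Euc n →L[ℝ] Euc n} (hP : IsPosSemidefOp P) (hfix : S.riccati γ₁ P = P)
    {f : Fin d → Euc n → Euc m} {Λ b : ℝ} (hΛ : FeatureBound f Λ b) (hb : b = 0 ∨ γ₁ < 1)
    {θ₁ : Euc d} (hθ₁ : ∀ x, linPolicy f θ₁ x = S.gain γ₁ P x) :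
    ∃ ε > 0, ∃ r > 0, ∃ C ≥ 0, ∀ γ ∈ Icc (0 : ℝ) 1, |γ - γ₁| < ε → ∀ θ ∈ Metric.ball θ₁ r,
      (∀ x₀ T, ∑ t ∈ Finset.range T, γ ^ t * (b + ‖S.traj (linPolicy f θ) x₀ t‖ ^ 2) ≤
        C * (1 + ‖x₀‖ ^ 2)) ∧
      ∀ θ' ∈ Metric.ball θ₁ r, ∀ x₀ T, ∑ t ∈ Finset.range T, γ ^ t *
        ‖S.traj (linPolicy f θ) x₀ t - S.traj (linPolicy f θ') x₀ t‖ ^ 2 ≤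
        C * ‖θ - θ'‖ ^ 2 * (1 + ‖x₀‖ ^ 2) := by
  obtain ⟨c, hc, hcQ⟩ := hQ.exists_pos_le
  have hlow : ∀ x, c * ‖x‖ ^ 2 ≤ ⟪x, P x⟫ := fun x => by
    have h1 := riccati_fixed_ge hR hγ₁ hP hfix x
    have h2 := mul_nonneg hγ₁ (hP.2 (S.closedLoop (S.gain γ₁ P) x))
    linarith [hcQ x]
  obtain ⟨α₀, hα₀, hγα₀, hcontr⟩ := exists_contraction hQ hR hγ₁ hP hfix
  have hev : ∀ α : ℝ, 0 ≤ α → γ₁ * α < 1 → ∃ α', α < α' ∧ γ₁ * α' < 1 := by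
    intro α hα h
    have h1 : Tendsto (fun a : ℝ => γ₁ * a) (𝓝[>] α) (𝓝 (γ₁ * α)) :=
      (tendsto_id.const_mul _).mono_left nhdsWithin_le_nhds
    obtain ⟨a, ha1, ha2⟩ := ((h1.eventually_lt_const h).and self_mem_nhdsWithin).exists
    exact ⟨a, ha2, ha1⟩
  -- Two successive losses of rate: `α₁` absorbs the perturbation of the policy, `α₂` the comparison
  -- of two trajectories.
  obtain ⟨α₁, hα₁, hγα₁⟩ := hev α₀ hα₀ hγα₀
  obtain ⟨α₂, hα₂, hγα₂⟩ := hev α₁ (hα₀.trans hα₁.le) hγα₁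
  obtain ⟨η₁, hη₁, hη₁α⟩ := exists_young hα₀ hα₁
  obtain ⟨η₂, hη₂, hη₂α⟩ := exists_young (hα₀.trans hα₁.le) hα₂
  set N : ℝ := ‖P‖ * ‖S.B‖ ^ 2 * Λ with hN
  have hN0 : 0 ≤ N := by have := hΛ.nonneg; positivity
  obtain ⟨r, hr, hr1⟩ : ∃ r > 0, (1 + η₁⁻¹) * (N * r ^ 2) / c ≤ α₁ - (1 + η₁) * α₀ := by
    have h1 : Tendsto (fun r : ℝ => (1 + η₁⁻¹) * (N * r ^ 2) / c) (𝓝[>] 0)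
        (𝓝 ((1 + η₁⁻¹) * (N * 0 ^ 2) / c)) :=
      (Continuous.tendsto (by fun_prop) _).mono_left nhdsWithin_le_nhds
    obtain ⟨r, hr, hr0⟩ := ((h1.eventually_lt_const
      (show _ < α₁ - (1 + η₁) * α₀ by simpa using hη₁α)).and self_mem_nhdsWithin).exists
    exact ⟨r, hr0, hr.le⟩
  -- The midpoint between `γ₁ α₂` and `1` leaves room for `γ` to vary.
  set ς := (1 + γ₁ * α₂) / 2 with hς
  have hς1 : ς < 1 := by rw [hς]; linarith
  obtain ⟨ε, hε, hε'⟩ : ∃ ε > 0, ∀ γ, |γ - γ₁| < ε → γ * α₂ ≤ ς ∧ (b = 0 ∨ γ ≤ (1 + γ₁) / 2) := by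
    have h1 : ∀ᶠ γ in 𝓝 γ₁, γ * α₂ < ς :=
      (tendsto_id.mul_const α₂).eventually_lt_const (show γ₁ * α₂ < ς by rw [hς]; linarith)
    have h2 : ∀ᶠ γ in 𝓝 γ₁, b = 0 ∨ γ ≤ (1 + γ₁) / 2 := by
      rcases hb with hb | hb
      · exact Eventually.of_forall fun _ => Or.inl hb
      · filter_upwards [eventually_lt_nhds (show γ₁ < (1 + γ₁) / 2 by linarith)] with γ h
        exact Or.inr h.le
    obtain ⟨ε, hε, h⟩ := Metric.eventually_nhds_iff.1 (h1.and h2)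
    exact ⟨ε, hε, fun γ hγ => ⟨(h (by rwa [Real.dist_eq])).1.le, (h (by rwa [Real.dist_eq])).2⟩⟩
  -- The offset contributes `∑ γ ^ t b`: a geometric series away from `γ = 1`, and nothing when `b =
  -- 0`. This is the obstruction at `γ = 1`.
  obtain ⟨Γ, hΓ, hΓb⟩ : ∃ Γ ≥ 0, ∀ γ ∈ Icc (0 : ℝ) 1, |γ - γ₁| < ε → ∀ T : ℕ,
      ∑ t ∈ Finset.range T, γ ^ t * b ≤ Γ := by
    rcases hb with hb | hb
    · exact ⟨0, le_rfl, fun γ _ _ T => by simp [hb]⟩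
    · have hb0 := hΛ.offset_nonneg
      have h1' : (0 : ℝ) < 1 - (1 + γ₁) / 2 := by linarith
      refine ⟨(1 - (1 + γ₁) / 2)⁻¹ * b, by positivity, fun γ hγ hγε T => ?_⟩
      rcases (hε' γ hγε).2 with h0 | h1
      · simp [h0]
      · rw [← Finset.sum_mul]
        gcongr
        have h2 : γ < 1 := by linarith
        refine ((summable_geometric_of_lt_one hγ.1 h2).sum_le_tsum _
          fun t _ => pow_nonneg hγ.1 t).trans ?_
        rw [tsum_geometric_of_lt_one hγ.1 h2]
        gcongr
  have hς1' : 0 < 1 - ς := by linarith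
  set β := (1 + η₁⁻¹) * (N * r ^ 2) with hβ
  have hβ0 : 0 ≤ β := by positivity
  set C₁ := c⁻¹ * ((1 - ς)⁻¹ * (‖P‖ + β * Γ)) + Γ with hC₁
  have hC₁0 : 0 ≤ C₁ := by positivity
  set C₂ := c⁻¹ * ((1 - ς)⁻¹ * ((1 + η₂⁻¹) * N * C₁)) with hC₂
  have hC₂0 : 0 ≤ C₂ := by positivity
  have hstep : ∀ θ x, S.A x + S.B (linPolicy f θ x) =
      S.closedLoop (S.gain γ₁ P) x + S.B (linPolicy f (θ - θ₁) x) := by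
    intro θ x
    rw [linPolicy_sub, hθ₁]
    simp [closedLoop]
  have hqB : ∀ w : Euc m, ⟪S.B w, P (S.B w)⟫ ≤ ‖P‖ * ‖S.B‖ ^ 2 * ‖w‖ ^ 2 := by
    intro w
    refine (inner_map_self_le P _).trans ?_
    rw [mul_assoc]
    exact mul_le_mul_of_nonneg_left (norm_sq_clm_le S.B w) (norm_nonneg P)
  have hball : ∀ θ ∈ Metric.ball θ₁ r, ‖θ - θ₁‖ ^ 2 ≤ r ^ 2 := fun θ hθ => by
    rw [Metric.mem_ball, dist_eq_norm] at hθ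
    gcongr
  have hgrow : ∀ θ ∈ Metric.ball θ₁ r, ∀ x,
      ⟪S.A x + S.B (linPolicy f θ x), P (S.A x + S.B (linPolicy f θ x))⟫ ≤
        α₁ * ⟪x, P x⟫ + β * b := by
    intro θ hθ x
    rw [hstep]
    refine (hP.inner_add_le hη₁ _ _).trans ?_
    have h1 := mul_le_mul_of_nonneg_left (hcontr x) (by positivity : 0 ≤ 1 + η₁)
    have h2 : ⟪S.B (linPolicy f (θ - θ₁) x), P (S.B (linPolicy f (θ - θ₁) x))⟫ ≤
        N * r ^ 2 * (b + ‖x‖ ^ 2) := by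
      refine (hqB _).trans ?_
      have hb0 := hΛ.offset_nonneg
      have hΛ0 := hΛ.nonneg
      calc ‖P‖ * ‖S.B‖ ^ 2 * ‖linPolicy f (θ - θ₁) x‖ ^ 2
          ≤ ‖P‖ * ‖S.B‖ ^ 2 * (Λ * ‖θ - θ₁‖ ^ 2 * (b + ‖x‖ ^ 2)) := by
            gcongr; exact hΛ.growth _ _
        _ ≤ ‖P‖ * ‖S.B‖ ^ 2 * (Λ * r ^ 2 * (b + ‖x‖ ^ 2)) := by
            gcongr ‖P‖ * ‖S.B‖ ^ 2 * (Λ * ?_ * _); exact hball θ hθ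
        _ = _ := by rw [hN]; ring
    have h3 : (1 + η₁⁻¹) * ⟪S.B (linPolicy f (θ - θ₁) x), P (S.B (linPolicy f (θ - θ₁) x))⟫ ≤
        β * b + β * ‖x‖ ^ 2 := by
      have := mul_le_mul_of_nonneg_left h2 (by positivity : 0 ≤ 1 + η₁⁻¹)
      rw [hβ]
      linarith
    have h4 : β * ‖x‖ ^ 2 ≤ β / c * ⟪x, P x⟫ := by
      rw [div_mul_eq_mul_div, le_div_iff₀ hc]
      have := mul_le_mul_of_nonneg_left (hlow x) hβ0
      linarith
    have h5 := mul_le_mul_of_nonneg_right hr1 (hP.2 x)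
    linarith
  have hcontrθ : ∀ θ ∈ Metric.ball θ₁ r, ∀ x y,
      ⟪(S.A x + S.B (linPolicy f θ x)) - (S.A y + S.B (linPolicy f θ y)),
        P ((S.A x + S.B (linPolicy f θ x)) - (S.A y + S.B (linPolicy f θ y)))⟫ ≤
        α₁ * ⟪x - y, P (x - y)⟫ := by
    intro θ hθ x y
    have e : (S.A x + S.B (linPolicy f θ x)) - (S.A y + S.B (linPolicy f θ y)) =
        S.closedLoop (S.gain γ₁ P) (x - y) +
          S.B (linPolicy f (θ - θ₁) x - linPolicy f (θ - θ₁) y) := by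
      rw [hstep, hstep, map_sub, map_sub]; abel
    rw [e]
    refine (hP.inner_add_le hη₁ _ _).trans ?_
    have h1 := mul_le_mul_of_nonneg_left (hcontr (x - y)) (by positivity : 0 ≤ 1 + η₁)
    have h2 : ⟪S.B (linPolicy f (θ - θ₁) x - linPolicy f (θ - θ₁) y),
        P (S.B (linPolicy f (θ - θ₁) x - linPolicy f (θ - θ₁) y))⟫ ≤ N * r ^ 2 * ‖x - y‖ ^ 2 := by
      refine (hqB _).trans ?_
      have hΛ0 := hΛ.nonneg
      calc ‖P‖ * ‖S.B‖ ^ 2 * ‖linPolicy f (θ - θ₁) x - linPolicy f (θ - θ₁) y‖ ^ 2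
          ≤ ‖P‖ * ‖S.B‖ ^ 2 * (Λ * ‖θ - θ₁‖ ^ 2 * ‖x - y‖ ^ 2) := by
            gcongr; exact hΛ.lipschitz _ _ _
        _ ≤ ‖P‖ * ‖S.B‖ ^ 2 * (Λ * r ^ 2 * ‖x - y‖ ^ 2) := by
            gcongr ‖P‖ * ‖S.B‖ ^ 2 * (Λ * ?_ * _); exact hball θ hθ
        _ = _ := by rw [hN]; ring
    have h3 : (1 + η₁⁻¹) * ⟪S.B (linPolicy f (θ - θ₁) x - linPolicy f (θ - θ₁) y),
        P (S.B (linPolicy f (θ - θ₁) x - linPolicy f (θ - θ₁) y))⟫ ≤ β * ‖x - y‖ ^ 2 := by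
      have := mul_le_mul_of_nonneg_left h2 (by positivity : 0 ≤ 1 + η₁⁻¹)
      rw [hβ]
      linarith
    have h4 : β * ‖x - y‖ ^ 2 ≤ β / c * ⟪x - y, P (x - y)⟫ := by
      rw [div_mul_eq_mul_div, le_div_iff₀ hc]
      have := mul_le_mul_of_nonneg_left (hlow (x - y)) hβ0
      linarith
    have h5 := mul_le_mul_of_nonneg_right hr1 (hP.2 (x - y))
    linarith
  have hnormsum : ∀ {γ : ℝ}, 0 ≤ γ → ∀ (z : ℕ → Euc n) (T : ℕ),
      ∑ t ∈ Finset.range T, γ ^ t * ‖z t‖ ^ 2 ≤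
        c⁻¹ * ∑ t ∈ Finset.range T, γ ^ t * ⟪z t, P (z t)⟫ := by
    intro γ hγ z T
    rw [Finset.mul_sum]
    refine Finset.sum_le_sum fun t _ => ?_
    rw [← div_eq_inv_mul, le_div_iff₀ hc]
    have := mul_le_mul_of_nonneg_left (hlow (z t)) (pow_nonneg hγ t)
    linarith
  have hstate : ∀ γ ∈ Icc (0 : ℝ) 1, |γ - γ₁| < ε → ∀ θ ∈ Metric.ball θ₁ r, ∀ x₀ T,
      ∑ t ∈ Finset.range T, γ ^ t * (b + ‖S.traj (linPolicy f θ) x₀ t‖ ^ 2) ≤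
        C₁ * (1 + ‖x₀‖ ^ 2) := by
    intro γ hγ hγε θ hθ x₀ T
    have hγα : γ * α₁ ≤ ς :=
      (mul_le_mul_of_nonneg_left hα₂.le hγ.1).trans (hε' γ hγε).1
    have h1 := discounted_sum_le (a := fun t => ⟪S.traj (linPolicy f θ) x₀ t,
        P (S.traj (linPolicy f θ) x₀ t)⟫) (c := fun _ => β * b) hγ.1 hγ.2 (fun t => hP.2 _)
      (fun t => mul_nonneg hβ0 hΛ.offset_nonneg) (fun t => hgrow θ hθ _) hγα hς1 T
    have h2 : ∑ t ∈ Finset.range T, γ ^ t * (β * b) ≤ β * Γ := by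
      have : ∑ t ∈ Finset.range T, γ ^ t * (β * b) = β * ∑ t ∈ Finset.range T, γ ^ t * b := by
        rw [Finset.mul_sum]; exact Finset.sum_congr rfl fun t _ => by ring
      rw [this]
      exact mul_le_mul_of_nonneg_left (hΓb γ hγ hγε T) hβ0
    have h3 := hnormsum hγ.1 (S.traj (linPolicy f θ) x₀) T
    have h4 : ⟪S.traj (linPolicy f θ) x₀ 0, P (S.traj (linPolicy f θ) x₀ 0)⟫ ≤ ‖P‖ * ‖x₀‖ ^ 2 :=
      inner_map_self_le P x₀
    simp only [mul_add, Finset.sum_add_distrib]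
    have h5 : c⁻¹ * ((1 - ς)⁻¹ * (⟪S.traj (linPolicy f θ) x₀ 0, P (S.traj (linPolicy f θ) x₀ 0)⟫ +
        ∑ t ∈ Finset.range T, γ ^ t * (β * b))) ≤
        c⁻¹ * ((1 - ς)⁻¹ * (‖P‖ * ‖x₀‖ ^ 2 + β * Γ)) := by gcongr
    have h6 := mul_le_mul_of_nonneg_left h1 (inv_nonneg.2 hc.le)
    have h7 : c⁻¹ * ((1 - ς)⁻¹ * (‖P‖ * ‖x₀‖ ^ 2 + β * Γ)) + Γ ≤ C₁ * (1 + ‖x₀‖ ^ 2) := by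
      rw [hC₁]
      have e1 : 0 ≤ c⁻¹ * ((1 - ς)⁻¹ * ‖P‖) := by positivity
      have e2 : 0 ≤ c⁻¹ * ((1 - ς)⁻¹ * (β * Γ)) * ‖x₀‖ ^ 2 := by positivity
      have e3 : 0 ≤ Γ * ‖x₀‖ ^ 2 := by positivity
      nlinarith
    have h8 := hΓb γ hγ hγε T
    linarith
  refine ⟨ε, hε, r, hr, C₁ + C₂, by positivity, fun γ hγ hγε θ hθ => ⟨fun x₀ T => ?_,
    fun θ' hθ' x₀ T => ?_⟩⟩
  · refine (hstate γ hγ hγε θ hθ x₀ T).trans ?_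
    gcongr
    linarith
  · set X := S.traj (linPolicy f θ) x₀ with hX
    set X' := S.traj (linPolicy f θ') x₀ with hX'
    set D := (1 + η₂⁻¹) * N * ‖θ - θ'‖ ^ 2 with hD
    have hD0 : 0 ≤ D := by positivity
    have hrec : ∀ t, ⟪X (t + 1) - X' (t + 1), P (X (t + 1) - X' (t + 1))⟫ ≤
        α₂ * ⟪X t - X' t, P (X t - X' t)⟫ + D * (b + ‖X' t‖ ^ 2) := by
      intro t
      -- The same policy `θ` at two states, which contracts at rate `α₁`, plus the change of policy
      -- at the single state `X' t`.
      have e : X (t + 1) - X' (t + 1) = ((S.A (X t) + S.B (linPolicy f θ (X t))) -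
          (S.A (X' t) + S.B (linPolicy f θ (X' t)))) + S.B (linPolicy f (θ - θ') (X' t)) := by
        rw [linPolicy_sub, map_sub]
        show (S.A (X t) + S.B (linPolicy f θ (X t))) -
          (S.A (X' t) + S.B (linPolicy f θ' (X' t))) = _
        abel
      rw [e]
      refine (hP.inner_add_le hη₂ _ _).trans ?_
      have h1 := mul_le_mul_of_nonneg_left (hcontrθ θ hθ (X t) (X' t))
        (by positivity : 0 ≤ 1 + η₂)
      have h2 : ⟪S.B (linPolicy f (θ - θ') (X' t)), P (S.B (linPolicy f (θ - θ') (X' t)))⟫ ≤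
          N * ‖θ - θ'‖ ^ 2 * (b + ‖X' t‖ ^ 2) := by
        refine (hqB _).trans ?_
        calc ‖P‖ * ‖S.B‖ ^ 2 * ‖linPolicy f (θ - θ') (X' t)‖ ^ 2
            ≤ ‖P‖ * ‖S.B‖ ^ 2 * (Λ * ‖θ - θ'‖ ^ 2 * (b + ‖X' t‖ ^ 2)) := by
              gcongr; exact hΛ.growth _ _
          _ = _ := by rw [hN]; ring
      have h3 := mul_le_mul_of_nonneg_left h2 (by positivity : 0 ≤ 1 + η₂⁻¹)
      have h4 := mul_le_mul_of_nonneg_right hη₂α.le (hP.2 (X t - X' t))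
      rw [hD]
      linarith
    have h1 := discounted_sum_le (a := fun t => ⟪X t - X' t, P (X t - X' t)⟫) hγ.1 hγ.2
      (fun t => hP.2 _) (fun t => mul_nonneg hD0 (add_nonneg hΛ.offset_nonneg (sq_nonneg _)))
      hrec (hε' γ hγε).1 hς1 T
    have h0 : X 0 - X' 0 = 0 := sub_self x₀
    simp only [h0, inner_zero_left, zero_add] at h1
    have h2 : ∑ t ∈ Finset.range T, γ ^ t * (D * (b + ‖X' t‖ ^ 2)) ≤
        D * (C₁ * (1 + ‖x₀‖ ^ 2)) := by
      have : ∑ t ∈ Finset.range T, γ ^ t * (D * (b + ‖X' t‖ ^ 2)) =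
          D * ∑ t ∈ Finset.range T, γ ^ t * (b + ‖X' t‖ ^ 2) := by
        rw [Finset.mul_sum]; exact Finset.sum_congr rfl fun t _ => by ring
      rw [this]
      exact mul_le_mul_of_nonneg_left (hstate γ hγ hγε θ' hθ' x₀ T) hD0
    have h3 := hnormsum hγ.1 (fun t => X t - X' t) T
    have h4 : c⁻¹ * ((1 - ς)⁻¹ * ∑ t ∈ Finset.range T, γ ^ t * (D * (b + ‖X' t‖ ^ 2))) ≤
        c⁻¹ * ((1 - ς)⁻¹ * (D * (C₁ * (1 + ‖x₀‖ ^ 2)))) := by gcongr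
    have h5 := mul_le_mul_of_nonneg_left h1 (inv_nonneg.2 hc.le)
    have h6 : c⁻¹ * ((1 - ς)⁻¹ * (D * (C₁ * (1 + ‖x₀‖ ^ 2)))) =
        C₂ * ‖θ - θ'‖ ^ 2 * (1 + ‖x₀‖ ^ 2) := by rw [hC₂, hD]; ring
    have h7 : C₂ * ‖θ - θ'‖ ^ 2 * (1 + ‖x₀‖ ^ 2) ≤
        (C₁ + C₂) * ‖θ - θ'‖ ^ 2 * (1 + ‖x₀‖ ^ 2) := by gcongr; linarith
    linarith

end LQR

/-! ### Coercivity in `L²` and the discounted occupation measure. -/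

/-- A nondegenerate finite-dimensional family of continuous functions has a coercive `L²` norm. -/
theorem exists_pos_le_integral_linPolicy {n m d : ℕ} (ρ : Measure (Euc n)) [IsProbabilityMeasure ρ]
    [ρ.IsOpenPosMeasure] (hρ : Integrable (fun x => ‖x‖ ^ 2) ρ) {f : Fin d → Euc n → Euc m}
    (hfc : ∀ k, Continuous (f k)) (hindep : LinearIndependent ℝ f) {Λ : ℝ}
    (hΛ : FeatureBound f Λ 1) :
    ∃ c > 0, ∀ u, c * ‖u‖ ^ 2 ≤ ∫ x, ‖linPolicy f u x‖ ^ 2 ∂ρ := by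
  have hcont : ∀ u, Continuous (linPolicy f u) := fun u => by unfold linPolicy; fun_prop
  have hint : ∀ u, Integrable (fun x => ‖linPolicy f u x‖ ^ 2) ρ := fun u => by
    refine (((integrable_const (1 : ℝ)).add hρ).const_mul (Λ * ‖u‖ ^ 2)).mono'
      ((hcont u).norm.pow 2).aestronglyMeasurable (Eventually.of_forall fun x => ?_)
    rw [Real.norm_of_nonneg (by positivity)]
    exact hΛ.growth u x
  -- By full support a continuous function vanishing almost everywhere vanishes identically, which
  -- contradicts linear independence.
  have hpos : ∀ u, u ≠ 0 → 0 < ∫ x, ‖linPolicy f u x‖ ^ 2 ∂ρ := by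
    intro u hu
    refine lt_of_le_of_ne (integral_nonneg fun x => by positivity) fun h0 => hu ?_
    have h1 := (integral_eq_zero_iff_of_nonneg (fun x => by positivity) (hint u)).1 h0.symm
    have h2 := (Continuous.ae_eq_iff_eq ρ ((hcont u).norm.pow 2) continuous_const).1 h1
    have h3 : ∑ k, u k • f k = 0 := by
      ext1 x
      have h4 := congrFun h2 x
      have h5 : ‖linPolicy f u x‖ ^ 2 = 0 := h4
      rw [pow_eq_zero_iff two_ne_zero, norm_eq_zero] at h5
      simpa [linPolicy] using h5
    have h4 := Fintype.linearIndependent_iff.1 hindep _ h3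
    ext k
    exact h4 k
  rcases (Metric.sphere (0 : Euc d) 1).eq_empty_or_nonempty with he | hne
  · refine ⟨1, one_pos, fun u => ?_⟩
    have : u = 0 := by
      by_contra hu
      have : ‖u‖⁻¹ • u ∈ Metric.sphere (0 : Euc d) 1 := by
        simp [norm_smul, inv_mul_cancel₀ (norm_ne_zero_iff.2 hu)]
      rw [he] at this
      exact this
    simp only [this, norm_zero, ne_eq, OfNat.ofNat_ne_zero, not_false_eq_true, zero_pow, mul_zero]
    exact integral_nonneg fun x => by positivity
  · have hco : ContinuousOn (fun u => ∫ x, ‖linPolicy f u x‖ ^ 2 ∂ρ)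
        (Metric.sphere (0 : Euc d) 1) := by
      refine continuousOn_of_dominated (bound := fun x => Λ * (1 + ‖x‖ ^ 2))
        (fun u _ => ((hcont u).norm.pow 2).aestronglyMeasurable)
        (fun u hu => Eventually.of_forall fun x => ?_)
        (((integrable_const (1 : ℝ)).add hρ).const_mul Λ) (Eventually.of_forall fun x => ?_)
      · rw [Real.norm_of_nonneg (by positivity)]
        have := hΛ.growth u x
        rw [mem_sphere_zero_iff_norm.1 hu] at this
        simpa using this
      · unfold linPolicy
        fun_prop
    obtain ⟨z, hz, hmin⟩ := (isCompact_sphere (0 : Euc d) 1).exists_isMinOn hne hco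
    have hz0 : z ≠ 0 := by
      rintro rfl
      simp at hz
    refine ⟨_, hpos z hz0, fun u => ?_⟩
    rcases eq_or_ne u 0 with rfl | hu
    · simp only [norm_zero, ne_eq, OfNat.ofNat_ne_zero, not_false_eq_true, zero_pow, mul_zero]
      exact integral_nonneg fun x => by positivity
    have h1 : ‖u‖⁻¹ • u ∈ Metric.sphere (0 : Euc d) 1 := by
      simp [norm_smul, inv_mul_cancel₀ (norm_ne_zero_iff.2 hu)]
    have h2 : ∫ x, ‖linPolicy f z x‖ ^ 2 ∂ρ ≤ ∫ x, ‖linPolicy f (‖u‖⁻¹ • u) x‖ ^ 2 ∂ρ := hmin h1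
    have h3 : ∫ x, ‖linPolicy f (‖u‖⁻¹ • u) x‖ ^ 2 ∂ρ =
        (‖u‖ ^ 2)⁻¹ * ∫ x, ‖linPolicy f u x‖ ^ 2 ∂ρ := by
      rw [← integral_const_mul]
      congr 1
      ext x
      rw [linPolicy_smul, norm_smul, mul_pow, norm_inv, norm_norm, inv_pow]
    rw [h3, ← div_eq_inv_mul, le_div_iff₀ (by have := norm_pos_iff.2 hu; positivity)] at h2
    exact h2

/-- Discounted occupation measure on initial states and times. -/
def discountedMeasure {n : ℕ} (ρ : Measure (Euc n)) (γ : ℝ) : Measure (Euc n × ℕ) :=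
  ρ.prod ((Measure.count : Measure ℕ).withDensity fun t => ENNReal.ofReal (γ ^ t))

theorem lintegral_discountedMeasure {n : ℕ} (ρ : Measure (Euc n)) [SFinite ρ] (γ : ℝ)
    {F : Euc n × ℕ → ℝ≥0∞} (hF : Measurable F) :
    ∫⁻ p, F p ∂(discountedMeasure ρ γ) = ∫⁻ x, ∑' t, ENNReal.ofReal (γ ^ t) * F (x, t) ∂ρ := by
  rw [discountedMeasure, lintegral_prod _ hF.aemeasurable]
  congr 1
  ext x
  rw [lintegral_withDensity_eq_lintegral_mul _ (measurable_of_countable _) (measurable_of_countable _),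
    lintegral_count]
  rfl

theorem discountedMeasure_integrable {n : ℕ} (ρ : Measure (Euc n)) [IsProbabilityMeasure ρ]
    (hρ : Integrable (fun x => ‖x‖ ^ 2) ρ) {γ : ℝ} (hγ : 0 ≤ γ) {φ : Euc n × ℕ → ℝ}
    (hφ : Measurable φ) (hφ0 : ∀ p, 0 ≤ φ p) {C : ℝ} (hC : 0 ≤ C)
    (h : ∀ x T, ∑ t ∈ Finset.range T, γ ^ t * φ (x, t) ≤ C * (1 + ‖x‖ ^ 2)) :
    Integrable φ (discountedMeasure ρ γ) ∧
      ∫ p, φ p ∂(discountedMeasure ρ γ) ≤ C * ∫ x, (1 + ‖x‖ ^ 2) ∂ρ := by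
  have hint : Integrable (fun x : Euc n => C * (1 + ‖x‖ ^ 2)) ρ :=
    ((integrable_const (1 : ℝ)).add hρ).const_mul C
  have hle : ∫⁻ p, ENNReal.ofReal (φ p) ∂(discountedMeasure ρ γ) ≤
      ENNReal.ofReal (C * ∫ x, (1 + ‖x‖ ^ 2) ∂ρ) := by
    rw [lintegral_discountedMeasure ρ γ hφ.ennreal_ofReal, ← integral_const_mul,
      ofReal_integral_eq_lintegral_ofReal hint (Eventually.of_forall fun x => by positivity)]
    refine lintegral_mono fun x => ?_
    rw [ENNReal.tsum_eq_iSup_nat]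
    refine iSup_le fun T => ?_
    simp_rw [← ENNReal.ofReal_mul (pow_nonneg hγ _)]
    rw [← ENNReal.ofReal_sum_of_nonneg fun t _ => mul_nonneg (pow_nonneg hγ _) (hφ0 _)]
    exact ENNReal.ofReal_le_ofReal (h x T)
  constructor
  · refine ⟨hφ.aestronglyMeasurable, ?_⟩
    rw [hasFiniteIntegral_iff_ofReal (Eventually.of_forall hφ0)]
    exact lt_of_le_of_lt hle ENNReal.ofReal_lt_top
  · rw [integral_eq_lintegral_of_nonneg_ae (Eventually.of_forall hφ0) hφ.aestronglyMeasurable]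
    exact ENNReal.toReal_le_of_le_ofReal
      (mul_nonneg hC (integral_nonneg fun x => by positivity)) hle

/-- Young's inequality with a free weight. It is applied with `s = ‖y - y'‖`: the squared difference
is then of order `s²`, and both terms become linear in `s`. -/
theorem abs_inner_map_sub_le {k : ℕ} {M : Euc k →L[ℝ] Euc k} (hM : ∀ x y, ⟪M x, y⟫ = ⟪x, M y⟫)
    {s : ℝ} (hs : 0 < s) (v w : Euc k) :
    |⟪v, M v⟫ - ⟪w, M w⟫| ≤ ‖M‖ * (s⁻¹ * ‖v - w‖ ^ 2 + s * (‖v‖ ^ 2 + ‖w‖ ^ 2)) := by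
  have e : ⟪v, M v⟫ - ⟪w, M w⟫ = ⟪v - w, M (v + w)⟫ := by
    have : ⟪v, M w⟫ = ⟪w, M v⟫ := by rw [← hM, real_inner_comm]
    simp only [map_add, inner_sub_left, inner_add_right, this]
    ring
  rw [e]
  refine (abs_real_inner_le_norm _ _).trans ?_
  have h1 : ‖M (v + w)‖ ≤ ‖M‖ * (‖v‖ + ‖w‖) :=
    (M.le_opNorm _).trans (mul_le_mul_of_nonneg_left (norm_add_le _ _) (norm_nonneg _))
  have h2 : ‖v - w‖ * (‖v‖ + ‖w‖) ≤ s⁻¹ * ‖v - w‖ ^ 2 + s * (‖v‖ ^ 2 + ‖w‖ ^ 2) := by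
    have h3 : 0 ≤ s⁻¹ * ((‖v - w‖ - s * ((‖v‖ + ‖w‖) / 2)) ^ 2) := by positivity
    have h4 : s⁻¹ * ((‖v - w‖ - s * ((‖v‖ + ‖w‖) / 2)) ^ 2) =
        s⁻¹ * ‖v - w‖ ^ 2 - ‖v - w‖ * (‖v‖ + ‖w‖) + s * ((‖v‖ + ‖w‖) / 2) ^ 2 := by
      field_simp; ring
    have h5 : s * ((‖v‖ + ‖w‖) / 2) ^ 2 ≤ s * (‖v‖ ^ 2 + ‖w‖ ^ 2) := by
      gcongr
      nlinarith [sq_nonneg (‖v‖ - ‖w‖), sq_nonneg (‖v‖ + ‖w‖)]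
    linarith
  calc ‖v - w‖ * ‖M (v + w)‖ ≤ ‖v - w‖ * (‖M‖ * (‖v‖ + ‖w‖)) := by gcongr
    _ = ‖M‖ * (‖v - w‖ * (‖v‖ + ‖w‖)) := by ring
    _ ≤ _ := by gcongr

/-! ### The cost as an expected quadratic deviation. -/

namespace LQR

variable {n m d : ℕ} {S : LQR n m}

theorem continuous_traj {π : Euc n → Euc m} (hπ : Continuous π) (t : ℕ) :
    Continuous fun x₀ => S.traj π x₀ t := by
  induction t with
  | zero => exact continuous_id
  | succ t ih =>
    simp only [traj]
    fun_prop

theorem measurable_traj_prod {π : Euc n → Euc m} (hπ : Continuous π) :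
    Measurable fun p : Euc n × ℕ => S.traj π p.1 p.2 :=
  measurable_from_prod_countable_left fun t => (continuous_traj hπ t).measurable

theorem continuous_linPolicy {f : Fin d → Euc n → Euc m} (hfc : ∀ k, Continuous (f k)) (u : Euc d) :
    Continuous (linPolicy f u) := by
  unfold linPolicy; fun_prop

/-- The expected discounted quadratic deviation `⟨π_u, M π_u⟩` along the trajectories of `π_y`. -/
def deviation (S : LQR n m) (ρ : Measure (Euc n)) (f : Fin d → Euc n → Euc m) (γ : ℝ)
    (M : Euc m →L[ℝ] Euc m) (y u : Euc d) : ℝ :=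
  ∫ p, ⟪linPolicy f u (S.traj (linPolicy f y) p.1 p.2),
    M (linPolicy f u (S.traj (linPolicy f y) p.1 p.2))⟫ ∂(discountedMeasure ρ γ)

section deviation

variable {ρ : Measure (Euc n)} [IsProbabilityMeasure ρ] {f : Fin d → Euc n → Euc m} {γ Λ b C : ℝ}
  {M : Euc m →L[ℝ] Euc m} {y : Euc d}

theorem measurable_deviation (hfc : ∀ k, Continuous (f k)) (u : Euc d) :
    Measurable fun p : Euc n × ℕ => ⟪linPolicy f u (S.traj (linPolicy f y) p.1 p.2),
      M (linPolicy f u (S.traj (linPolicy f y) p.1 p.2))⟫ := by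
  have h1 : Continuous fun w : Euc m => ⟪w, M w⟫ := by fun_prop
  exact h1.measurable.comp ((continuous_linPolicy hfc u).measurable.comp
    (measurable_traj_prod (continuous_linPolicy hfc y)))

theorem deviation_integrable (hρ : Integrable (fun x => ‖x‖ ^ 2) ρ)
    (hfc : ∀ k, Continuous (f k)) (hΛ : FeatureBound f Λ b) (hγ : 0 ≤ γ) (hC : 0 ≤ C)
    (hM : IsPosSemidefOp M)
    (hy : ∀ x₀ T, ∑ t ∈ Finset.range T, γ ^ t * (b + ‖S.traj (linPolicy f y) x₀ t‖ ^ 2) ≤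
        C * (1 + ‖x₀‖ ^ 2)) (u : Euc d) :
    Integrable (fun p : Euc n × ℕ => ⟪linPolicy f u (S.traj (linPolicy f y) p.1 p.2),
      M (linPolicy f u (S.traj (linPolicy f y) p.1 p.2))⟫) (discountedMeasure ρ γ) ∧
    S.deviation ρ f γ M y u ≤ ‖M‖ * Λ * C * (∫ x, (1 + ‖x‖ ^ 2) ∂ρ) * ‖u‖ ^ 2 := by
  have hΛ0 := hΛ.nonneg
  have h := discountedMeasure_integrable ρ hρ hγ (measurable_deviation (S := S) (M := M) (y := y)
    hfc u) (fun p => hM.2 _) (C := ‖M‖ * Λ * ‖u‖ ^ 2 * C) (by positivity) (fun x T => ?_)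
  · refine ⟨h.1, h.2.trans (le_of_eq (by ring))⟩
  · calc ∑ t ∈ Finset.range T, γ ^ t * ⟪linPolicy f u (S.traj (linPolicy f y) x t),
          M (linPolicy f u (S.traj (linPolicy f y) x t))⟫
        ≤ ∑ t ∈ Finset.range T, ‖M‖ * Λ * ‖u‖ ^ 2 *
          (γ ^ t * (b + ‖S.traj (linPolicy f y) x t‖ ^ 2)) := by
          refine Finset.sum_le_sum fun t _ => ?_
          have h1 := (inner_map_self_le M (linPolicy f u (S.traj (linPolicy f y) x t))).trans
            (mul_le_mul_of_nonneg_left (hΛ.growth u _) (norm_nonneg M))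
          have h2 := mul_le_mul_of_nonneg_left h1 (pow_nonneg hγ t)
          linarith
      _ ≤ ‖M‖ * Λ * ‖u‖ ^ 2 * (C * (1 + ‖x‖ ^ 2)) := by
          rw [← Finset.mul_sum]
          exact mul_le_mul_of_nonneg_left (hy x T) (by positivity)
      _ = _ := by ring

theorem deviation_convexOn (hρ : Integrable (fun x => ‖x‖ ^ 2) ρ)
    (hfc : ∀ k, Continuous (f k)) (hΛ : FeatureBound f Λ b) (hγ : 0 ≤ γ) (hC : 0 ≤ C)
    (hM : IsPosSemidefOp M)
    (hy : ∀ x₀ T, ∑ t ∈ Finset.range T, γ ^ t * (b + ‖S.traj (linPolicy f y) x₀ t‖ ^ 2) ≤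
        C * (1 + ‖x₀‖ ^ 2)) : ConvexOn ℝ univ (S.deviation ρ f γ M y) := by
  refine ⟨convex_univ, fun u _ v _ α β hα hβ hαβ => ?_⟩
  have hint := fun u => (deviation_integrable hρ hfc hΛ hγ hC hM hy u).1
  rw [deviation, deviation, deviation, smul_eq_mul, smul_eq_mul, ← integral_const_mul,
    ← integral_const_mul, ← integral_add ((hint u).const_mul α) ((hint v).const_mul β)]
  refine integral_mono (hint _) (((hint u).const_mul α).add ((hint v).const_mul β)) fun p => ?_
  have := hM.convexOn.2 (mem_univ (linPolicy f u (S.traj (linPolicy f y) p.1 p.2)))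
    (mem_univ (linPolicy f v (S.traj (linPolicy f y) p.1 p.2))) hα hβ hαβ
  dsimp only
  rw [linPolicy_add, linPolicy_smul, linPolicy_smul]
  simpa using this

/-- Only the term `t = 0` is kept; there the state has law `ρ` whatever the policy `y`. -/
theorem deviation_lower (hρ : Integrable (fun x => ‖x‖ ^ 2) ρ)
    (hfc : ∀ k, Continuous (f k)) (hΛ : FeatureBound f Λ b) (hγ : 0 ≤ γ) (hC : 0 ≤ C)
    (hM : IsPosSemidefOp M)
    (hy : ∀ x₀ T, ∑ t ∈ Finset.range T, γ ^ t * (b + ‖S.traj (linPolicy f y) x₀ t‖ ^ 2) ≤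
        C * (1 + ‖x₀‖ ^ 2)) {c : ℝ} (hc : 0 ≤ c) (hMc : ∀ w, c * ‖w‖ ^ 2 ≤ ⟪w, M w⟫) (u : Euc d) :
    c * ∫ x, ‖linPolicy f u x‖ ^ 2 ∂ρ ≤ S.deviation ρ f γ M y u := by
  have hmeas := measurable_deviation (S := S) (M := M) (y := y) hfc u
  have hint := (deviation_integrable hρ hfc hΛ hγ hC hM hy u).1
  have hcont : Continuous fun x => c * ‖linPolicy f u x‖ ^ 2 :=
    ((continuous_linPolicy hfc u).norm.pow 2).const_mul c
  rw [deviation, integral_eq_lintegral_of_nonneg_ae (Eventually.of_forall fun p => hM.2 _)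
    hmeas.aestronglyMeasurable, ← integral_const_mul,
    integral_eq_lintegral_of_nonneg_ae (Eventually.of_forall fun p => by positivity)
    hcont.aestronglyMeasurable]
  refine ENNReal.toReal_mono ?_ ?_
  · have := hint.2
    rw [hasFiniteIntegral_iff_ofReal (Eventually.of_forall fun p => hM.2 _)] at this
    exact this.ne
  · rw [lintegral_discountedMeasure ρ γ hmeas.ennreal_ofReal]
    refine lintegral_mono fun x => ?_
    refine le_trans ?_ (ENNReal.le_tsum 0)
    simp only [pow_zero, ENNReal.ofReal_one, one_mul, traj]
    exact ENNReal.ofReal_le_ofReal (hMc _)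

/-- The factor `3` counts one contribution from the distance of the trajectories and one from the
size of each. -/
theorem deviation_sub_le (hρ : Integrable (fun x => ‖x‖ ^ 2) ρ)
    (hfc : ∀ k, Continuous (f k)) (hΛ : FeatureBound f Λ b) (hγ : 0 ≤ γ) (hC : 0 ≤ C)
    (hM : IsPosSemidefOp M)
    (hy : ∀ x₀ T, ∑ t ∈ Finset.range T, γ ^ t * (b + ‖S.traj (linPolicy f y) x₀ t‖ ^ 2) ≤
        C * (1 + ‖x₀‖ ^ 2)) {y' : Euc d}
    (hy' : ∀ x₀ T, ∑ t ∈ Finset.range T, γ ^ t * (b + ‖S.traj (linPolicy f y') x₀ t‖ ^ 2) ≤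
        C * (1 + ‖x₀‖ ^ 2))
    (hyy' : ∀ x₀ T, ∑ t ∈ Finset.range T, γ ^ t *
        ‖S.traj (linPolicy f y) x₀ t - S.traj (linPolicy f y') x₀ t‖ ^ 2 ≤
        C * ‖y - y'‖ ^ 2 * (1 + ‖x₀‖ ^ 2)) (u : Euc d) :
    |S.deviation ρ f γ M y u - S.deviation ρ f γ M y' u| ≤
      3 * (‖M‖ * Λ * C * ∫ x, (1 + ‖x‖ ^ 2) ∂ρ) * ‖y - y'‖ * ‖u‖ ^ 2 := by
  rcases eq_or_ne y y' with rfl | hne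
  · simp
  have hs : 0 < ‖y - y'‖ := norm_pos_iff.2 (sub_ne_zero.2 hne)
  have hΛ0 := hΛ.nonneg
  have hint := (deviation_integrable hρ hfc hΛ hγ hC hM hy u).1
  have hint' := (deviation_integrable hρ hfc hΛ hγ hC hM hy' u).1
  set s := ‖y - y'‖
  have hX := measurable_traj_prod (S := S) (continuous_linPolicy hfc y)
  have hX' := measurable_traj_prod (S := S) (continuous_linPolicy hfc y')
  have hW := discountedMeasure_integrable ρ hρ hγ
    (φ := fun p => b + ‖S.traj (linPolicy f y) p.1 p.2‖ ^ 2) ((hX.norm.pow_const 2).const_add b)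
    (fun p => add_nonneg hΛ.offset_nonneg (sq_nonneg _)) hC hy
  have hW' := discountedMeasure_integrable ρ hρ hγ
    (φ := fun p => b + ‖S.traj (linPolicy f y') p.1 p.2‖ ^ 2) ((hX'.norm.pow_const 2).const_add b)
    (fun p => add_nonneg hΛ.offset_nonneg (sq_nonneg _)) hC hy'
  have hD := discountedMeasure_integrable ρ hρ hγ
    (φ := fun p => ‖S.traj (linPolicy f y) p.1 p.2 - S.traj (linPolicy f y') p.1 p.2‖ ^ 2)
    ((hX.sub hX').norm.pow_const 2) (fun p => sq_nonneg _) (by positivity) hyy'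
  rw [deviation, deviation, ← integral_sub hint hint', ← Real.norm_eq_abs]
  refine (norm_integral_le_of_norm_le
    (((hD.1.const_mul s⁻¹).add ((hW.1.add hW'.1).const_mul s)).const_mul (‖M‖ * (Λ * ‖u‖ ^ 2)))
    (Eventually.of_forall fun p => ?_)).trans ?_
  · rw [Real.norm_eq_abs]
    refine (abs_inner_map_sub_le hM.1 hs _ _).trans ?_
    have h1 := hΛ.lipschitz u (S.traj (linPolicy f y) p.1 p.2) (S.traj (linPolicy f y') p.1 p.2)
    have h2 := hΛ.growth u (S.traj (linPolicy f y) p.1 p.2)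
    have h3 := hΛ.growth u (S.traj (linPolicy f y') p.1 p.2)
    rw [mul_assoc]
    refine mul_le_mul_of_nonneg_left ?_ (norm_nonneg M)
    have h4 := mul_le_mul_of_nonneg_left h1 (inv_nonneg.2 hs.le)
    have h5 := mul_le_mul_of_nonneg_left (add_le_add h2 h3) hs.le
    refine (add_le_add h4 h5).trans (le_of_eq ?_)
    simp only [Pi.add_apply]
    ring
  · rw [integral_const_mul, integral_add' (hD.1.const_mul s⁻¹) ((hW.1.add hW'.1).const_mul s),
      integral_const_mul, integral_const_mul, integral_add' hW.1 hW'.1]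
    have h1 := mul_le_mul_of_nonneg_left hD.2 (inv_nonneg.2 hs.le)
    have h2 := mul_le_mul_of_nonneg_left (add_le_add hW.2 hW'.2) hs.le
    have h3 := mul_le_mul_of_nonneg_left (add_le_add h1 h2)
      (by positivity : 0 ≤ ‖M‖ * (Λ * ‖u‖ ^ 2))
    refine h3.trans (le_of_eq ?_)
    field_simp
    ring

/-- Since policies are linear in the parameter, the deviation of `π_y` from the optimal gain is
`π_{y - θ₁}`; this makes the performance difference a quadratic form in `y - θ₁`. -/
theorem paramCost_eq (hQ : IsPosDefOp S.Q) (hR : IsPosDefOp S.R)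
    (hρ : Integrable (fun x => ‖x‖ ^ 2) ρ)
    (hfc : ∀ k, Continuous (f k)) (hΛ : FeatureBound f Λ b) (hγ : 0 ≤ γ) (hC : 0 ≤ C)
    {P : Euc n →L[ℝ] Euc n} (hP : IsPosSemidefOp P) (hfix : S.riccati γ P = P)
    {θ₁ : Euc d} (hθ₁ : ∀ x, linPolicy f θ₁ x = S.gain γ P x)
    (hy : ∀ x₀ T, ∑ t ∈ Finset.range T, γ ^ t * (b + ‖S.traj (linPolicy f y) x₀ t‖ ^ 2) ≤
        C * (1 + ‖x₀‖ ^ 2)) :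
    S.paramCost ρ f γ y ≠ ∞ ∧ (S.paramCost ρ f γ y).toReal =
      (∫⁻ x, ENNReal.ofReal ⟪x, P x⟫ ∂ρ).toReal + S.deviation ρ f γ (S.hess γ P) y (y - θ₁) := by
  have hM := (isPosDefOp_hess hR hγ hP).isPosSemidefOp
  have hΛ0 := hΛ.nonneg
  have hfin : ∀ x₀, S.costFrom γ (linPolicy f y) x₀ ≠ ∞ := by
    intro x₀
    refine ne_top_of_le_ne_top (ENNReal.ofReal_ne_top
      (r := (‖S.Q‖ + ‖S.R‖ * (Λ * ‖y‖ ^ 2)) * (C * (1 + ‖x₀‖ ^ 2)))) ?_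
    rw [costFrom, ENNReal.tsum_eq_iSup_nat]
    refine iSup_le fun T => ?_
    rw [← ENNReal.ofReal_sum_of_nonneg fun t _ =>
      mul_nonneg (pow_nonneg hγ _) (stageCost_nonneg hQ hR _ _)]
    refine ENNReal.ofReal_le_ofReal ?_
    refine le_trans ?_ (mul_le_mul_of_nonneg_left (hy x₀ T) (by positivity))
    rw [Finset.mul_sum]
    refine Finset.sum_le_sum fun t _ => ?_
    set x := S.traj (linPolicy f y) x₀ t
    have h1 := inner_map_self_le S.Q x
    have h2 := (inner_map_self_le S.R (linPolicy f y x)).trans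
      (mul_le_mul_of_nonneg_left (hΛ.growth y x) (norm_nonneg _))
    have h3 : S.stageCost x (linPolicy f y x) ≤
        (‖S.Q‖ + ‖S.R‖ * (Λ * ‖y‖ ^ 2)) * (b + ‖x‖ ^ 2) := by
      rw [stageCost]
      have := mul_nonneg (norm_nonneg S.Q) hΛ.offset_nonneg
      linarith
    have := mul_le_mul_of_nonneg_left h3 (pow_nonneg hγ t)
    linarith
  have hmeas := measurable_deviation (S := S) (M := S.hess γ P) (y := y) hfc (y - θ₁)
  have hint := (deviation_integrable hρ hfc hΛ hγ hC hM hy (y - θ₁)).1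
  have hqm : Measurable fun x : Euc n => ENNReal.ofReal ⟪x, P x⟫ := by
    have : Continuous fun x : Euc n => ⟪x, P x⟫ := by fun_prop
    exact this.measurable.ennreal_ofReal
  have heq : S.paramCost ρ f γ y = ∫⁻ x, ENNReal.ofReal ⟪x, P x⟫ ∂ρ +
      ∫⁻ p, ENNReal.ofReal ⟪linPolicy f (y - θ₁) (S.traj (linPolicy f y) p.1 p.2),
        S.hess γ P (linPolicy f (y - θ₁) (S.traj (linPolicy f y) p.1 p.2))⟫
          ∂(discountedMeasure ρ γ) := by
    rw [lintegral_discountedMeasure ρ γ hmeas.ennreal_ofReal, ← lintegral_add_left hqm, paramCost,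
      cost]
    congr 1
    ext x₀
    rw [costFrom_eq hQ hR hγ hP hfix (hfin x₀)]
    congr 2
    ext t
    rw [ENNReal.ofReal_mul (pow_nonneg hγ t), linPolicy_sub, hθ₁]
  have h1 : ∫⁻ x, ENNReal.ofReal ⟪x, P x⟫ ∂ρ ≠ ∞ := by
    refine ne_top_of_le_ne_top ?_ (lintegral_mono fun x =>
      ENNReal.ofReal_le_ofReal (inner_map_self_le P x))
    have := (hρ.const_mul ‖P‖).2
    rw [hasFiniteIntegral_iff_ofReal (Eventually.of_forall fun x => by positivity)] at this
    exact this.ne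
  have h2 := hint.2
  rw [hasFiniteIntegral_iff_ofReal (Eventually.of_forall fun p => hM.2 _)] at h2
  refine ⟨by rw [heq]; exact ENNReal.add_ne_top.2 ⟨h1, h2.ne⟩, ?_⟩
  rw [heq, ENNReal.toReal_add h1 h2.ne, deviation,
    integral_eq_lintegral_of_nonneg_ae (Eventually.of_forall fun p => hM.2 _)
      hmeas.aestronglyMeasurable]

end deviation

end LQR

/-! ### Convergence of policy gradient: locally in general, globally for `γ = 0`. -/

namespace LQR

variable {n m d : ℕ} {S : LQR n m}

theorem hess_ge {γ : ℝ} (hγ : 0 ≤ γ) {P : Euc n →L[ℝ] Euc n} (hP : IsPosSemidefOp P) (w : Euc m) :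
    ⟪w, S.R w⟫ ≤ ⟪w, S.hess γ P w⟫ := by
  have h2 := mul_nonneg hγ (hP.2 (S.B w))
  simp only [hess, add_apply, smul_apply, ContinuousLinearMap.coe_comp, Function.comp,
    inner_add_right, inner_smul_right, ContinuousLinearMap.adjoint_inner_right]
  linarith

/-- Policy gradient converges locally, uniformly in the discount factor. -/
theorem exists_policyGradientYields_nhds (hQ : IsPosDefOp S.Q) (hR : IsPosDefOp S.R)
    (ρ : Measure (Euc n)) [IsProbabilityMeasure ρ] [ρ.IsOpenPosMeasure]
    (hρ : Integrable (fun x => ‖x‖ ^ 2) ρ) {f : Fin d → Euc n → Euc m}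
    (hf : ∀ k, ∃ L : ℝ≥0, LipschitzWith L (f k)) (hindep : LinearIndependent ℝ f)
    {P : ℝ → Euc n →L[ℝ] Euc n} (hPc : ContinuousOn P (Icc 0 1))
    (hP : ∀ γ ∈ Icc (0 : ℝ) 1, IsPosSemidefOp (P γ) ∧ S.riccati γ (P γ) = P γ)
    {θs : ℝ → Euc d} (hθc : ContinuousOn θs (Icc 0 1))
    (hθ : ∀ γ ∈ Icc (0 : ℝ) 1, ∀ x, linPolicy f (θs γ) x = S.gain γ (P γ) x)
    {γ₁ : ℝ} (hγ₁ : γ₁ ∈ Icc (0 : ℝ) 1) (hb : γ₁ < 1 ∨ ∀ k, f k 0 = 0) :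
    ∃ ε > 0, ∃ r > 0, ∀ γ ∈ Icc (0 : ℝ) 1, |γ - γ₁| < ε → ∀ θ₀ ∈ Metric.ball (θs γ₁) r,
      PolicyGradientYields (S.paramCost ρ f γ) θ₀ (θs γ) := by
  have hfc : ∀ k, Continuous (f k) := fun k => by
    obtain ⟨L, hL⟩ := hf k
    exact hL.continuous
  obtain ⟨Λ₁, hΛ₁⟩ := exists_featureBound hf (b := 1) (Or.inl rfl)
  obtain ⟨b, Λ, hΛ, hb'⟩ : ∃ b Λ, FeatureBound f Λ b ∧ (b = 0 ∨ γ₁ < 1) := by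
    rcases hb with hb | hb
    · exact ⟨1, Λ₁, hΛ₁, Or.inr hb⟩
    · obtain ⟨Λ, hΛ⟩ := exists_featureBound hf (b := 0) (Or.inr ⟨rfl, hb⟩)
      exact ⟨0, Λ, hΛ, Or.inl rfl⟩
  obtain ⟨ε₀, hε₀, r₀, hr₀, C, hC, hbd⟩ := exists_trajectory_bound hQ hR hγ₁.1 (hP γ₁ hγ₁).1
    (hP γ₁ hγ₁).2 hΛ hb' (hθ γ₁ hγ₁)
  obtain ⟨c₀, hc₀, hc₀'⟩ := exists_pos_le_integral_linPolicy ρ hρ hfc hindep hΛ₁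
  obtain ⟨cR, hcR, hcR'⟩ := hR.exists_pos_le
  have hhc : ContinuousOn (fun γ => S.hess γ (P γ)) (Icc 0 1) := by
    unfold hess
    fun_prop
  obtain ⟨N, hN⟩ := isCompact_Icc.exists_bound_of_continuousOn hhc
  have hN0 : 0 ≤ N := (norm_nonneg _).trans (hN γ₁ hγ₁)
  set m₂ := ∫ x, (1 + ‖x‖ ^ 2) ∂ρ with hm₂
  have hm₂0 : 0 ≤ m₂ := integral_nonneg fun x => by positivity
  have hΛ0 := hΛ.nonneg
  set L' := N * Λ * C * m₂ with hL'
  have hL'0 : 0 ≤ L' := by positivity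
  -- The first bound keeps the ball around the moving centre `θs γ` inside the ball of radius `r₀`
  -- around `θs γ₁`; the second gives `3 L' r ≤ cR c₀ / 2`, the `+ 1` covering `L' = 0`.
  set r := min (r₀ / 2) (cR * c₀ / (2 * (3 * L' + 1))) with hr
  have hr0 : 0 < r := lt_min (by positivity) (by positivity)
  have hLr : 3 * L' * r ≤ cR * c₀ / 2 := by
    have h1 : r ≤ cR * c₀ / (2 * (3 * L' + 1)) := min_le_right _ _
    rw [le_div_iff₀ (by positivity)] at h1
    nlinarith
  obtain ⟨ε₁, hε₁, hε₁'⟩ := Metric.continuousWithinAt_iff.1 (hθc γ₁ hγ₁) (r / 2) (by positivity)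
  refine ⟨min ε₀ ε₁, lt_min hε₀ hε₁, r / 2, by positivity, fun γ hγ hγε θ₀ hθ₀ => ?_⟩
  have hdist : dist (θs γ) (θs γ₁) < r / 2 :=
    hε₁' hγ (by rw [Real.dist_eq]; exact hγε.trans_le (min_le_right _ _))
  have hsub : Metric.ball (θs γ) r ⊆ Metric.ball (θs γ₁) r₀ := by
    apply Metric.ball_subset_ball'
    have : r ≤ r₀ / 2 := min_le_left _ _
    linarith
  have hbd' := hbd γ hγ (hγε.trans_le (min_le_left _ _))
  have hPγ := hP γ hγ
  have hM := (isPosDefOp_hess hR hγ.1 hPγ.1).isPosSemidefOp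
  have hNγ := hN γ hγ
  refine policyGradientYields_of_quadratic (r := r) (m := cR * c₀) (L' := L') (L := 3 * L')
    (H := S.deviation ρ f γ (S.hess γ (P γ))) (by positivity) (by positivity) hL'0
    (fun y hy => (paramCost_eq hQ hR hρ hfc hΛ hγ.1 hC hPγ.1 hPγ.2 (hθ γ hγ)
      (hbd' y (hsub hy)).1).1)
    (fun y hy => (paramCost_eq hQ hR hρ hfc hΛ hγ.1 hC hPγ.1 hPγ.2 (hθ γ hγ)
      (hbd' y (hsub hy)).1).2)
    (fun y hy => deviation_convexOn hρ hfc hΛ hγ.1 hC hM (hbd' y (hsub hy)).1)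
    (fun y hy u => ?_) (fun y hy u => ?_) (fun y hy y' hy' u => ?_) hLr ?_
  · have h1 := deviation_lower hρ hfc hΛ hγ.1 hC hM (hbd' y (hsub hy)).1 hcR.le
      (fun w => (hcR' w).trans (hess_ge hγ.1 hPγ.1 w)) u
    have h2 := mul_le_mul_of_nonneg_left (hc₀' u) hcR.le
    linarith
  · refine (deviation_integrable hρ hfc hΛ hγ.1 hC hM (hbd' y (hsub hy)).1 u).2.trans ?_
    rw [hL']
    gcongr
  · refine (deviation_sub_le hρ hfc hΛ hγ.1 hC hM (hbd' y (hsub hy)).1 (hbd' y' (hsub hy')).1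
      ((hbd' y (hsub hy)).2 y' (hsub hy')) u).trans ?_
    rw [hL']
    gcongr
  · rw [Metric.mem_ball] at hθ₀ ⊢
    have := dist_triangle_right θ₀ (θs γ) (θs γ₁)
    linarith

theorem sum_zero_pow_mul_le {a : ℕ → ℝ} (ha : 0 ≤ a 0) (T : ℕ) :
    ∑ t ∈ Finset.range T, (0 : ℝ) ^ t * a t ≤ a 0 := by
  cases T with
  | zero => simpa using ha
  | succ T => simp [Finset.sum_range_succ']

/-- Policy gradient converges globally for the myopic problem. -/
theorem policyGradientYields_zero (hQ : IsPosDefOp S.Q) (hR : IsPosDefOp S.R)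
    (ρ : Measure (Euc n)) [IsProbabilityMeasure ρ] [ρ.IsOpenPosMeasure]
    (hρ : Integrable (fun x => ‖x‖ ^ 2) ρ) {f : Fin d → Euc n → Euc m}
    (hf : ∀ k, ∃ L : ℝ≥0, LipschitzWith L (f k)) (hindep : LinearIndependent ℝ f)
    {P : Euc n →L[ℝ] Euc n} (hP : IsPosSemidefOp P) (hfix : S.riccati 0 P = P)
    {θ₁ : Euc d} (hθ : ∀ x, linPolicy f θ₁ x = S.gain 0 P x) (θ₀ : Euc d) :
    PolicyGradientYields (S.paramCost ρ f 0) θ₀ θ₁ := by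
  have hfc : ∀ k, Continuous (f k) := fun k => by
    obtain ⟨L, hL⟩ := hf k
    exact hL.continuous
  obtain ⟨Λ, hΛ⟩ := exists_featureBound hf (b := 1) (Or.inl rfl)
  obtain ⟨c₀, hc₀, hc₀'⟩ := exists_pos_le_integral_linPolicy ρ hρ hfc hindep hΛ
  obtain ⟨cR, hcR, hcR'⟩ := hR.exists_pos_le
  have hM := (isPosDefOp_hess hR le_rfl hP).isPosSemidefOp
  have hΛ0 := hΛ.nonneg
  have hbd : ∀ y x₀ T, ∑ t ∈ Finset.range T, (0 : ℝ) ^ t *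
      (1 + ‖S.traj (linPolicy f y) x₀ t‖ ^ 2) ≤ 1 * (1 + ‖x₀‖ ^ 2) := fun y x₀ T => by
    rw [one_mul]
    exact sum_zero_pow_mul_le (a := fun t => 1 + ‖S.traj (linPolicy f y) x₀ t‖ ^ 2)
      (by positivity) T
  -- As `0 ^ 0 = 1`, exactly the initial time survives. The deviation is independent of `y`, so `L =
  -- 0` puts no limit on the radius.
  have hconst : ∀ y u, S.deviation ρ f 0 (S.hess 0 P) y u = (∫⁻ x, ENNReal.ofReal
      ⟪linPolicy f u x, S.hess 0 P (linPolicy f u x)⟫ ∂ρ).toReal := by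
    intro y u
    have hmeas := measurable_deviation (S := S) (M := S.hess 0 P) (y := y) hfc u
    rw [deviation, integral_eq_lintegral_of_nonneg_ae (Eventually.of_forall fun p => hM.2 _)
      hmeas.aestronglyMeasurable, lintegral_discountedMeasure ρ 0 hmeas.ennreal_ofReal]
    congr 2
    ext x
    rw [tsum_eq_single 0 fun t ht => by simp [zero_pow ht]]
    simp [traj]
  have hm₂0 : 0 ≤ ∫ x, (1 + ‖x‖ ^ 2) ∂ρ := integral_nonneg fun x => by positivity
  refine policyGradientYields_of_quadratic (r := dist θ₀ θ₁ + 1) (m := cR * c₀)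
    (L' := ‖S.hess 0 P‖ * Λ * 1 * ∫ x, (1 + ‖x‖ ^ 2) ∂ρ) (L := 0)
    (H := S.deviation ρ f 0 (S.hess 0 P)) (by positivity) le_rfl (by positivity)
    (fun y _ => (paramCost_eq hQ hR hρ hfc hΛ le_rfl zero_le_one hP hfix hθ (hbd y)).1)
    (fun y _ => (paramCost_eq hQ hR hρ hfc hΛ le_rfl zero_le_one hP hfix hθ (hbd y)).2)
    (fun y _ => deviation_convexOn hρ hfc hΛ le_rfl zero_le_one hM (hbd y))
    (fun y _ u => ?_)
    (fun y _ u => (deviation_integrable hρ hfc hΛ le_rfl zero_le_one hM (hbd y) u).2)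
    (fun y _ y' _ u => by rw [hconst, hconst]; simp) (by rw [zero_mul]; positivity) ?_
  · have h1 := deviation_lower hρ hfc hΛ le_rfl zero_le_one hM (hbd y) hcR.le
      (fun w => (hcR' w).trans (hess_ge le_rfl hP w)) u
    have h2 := mul_le_mul_of_nonneg_left (hc₀' u) hcR.le
    linarith
  · rw [Metric.mem_ball]
    exact lt_add_one _

/-! ### Optimal policies -/

theorem isOptimalPolicy_gain (hQ : IsPosDefOp S.Q) (hR : IsPosDefOp S.R) (ρ : Measure (Euc n))
    {γ : ℝ} (hγ : 0 ≤ γ) {P : Euc n →L[ℝ] Euc n} (hP : IsPosSemidefOp P)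
    (hfix : S.riccati γ P = P) : S.IsOptimalPolicy ρ γ fun x => S.gain γ P x := by
  intro π _
  refine lintegral_mono fun x => ?_
  rw [costFrom_gain hQ hR hγ hP hfix]
  exact le_costFrom hQ hR hγ hP hfix π x

theorem isOptimalPolicy_linPolicy_iff (hQ : IsPosDefOp S.Q) (hR : IsPosDefOp S.R)
    (ρ : Measure (Euc n)) [IsProbabilityMeasure ρ] [ρ.IsOpenPosMeasure]
    (hρ : Integrable (fun x => ‖x‖ ^ 2) ρ) {f : Fin d → Euc n → Euc m}
    (hf : ∀ k, ∃ L : ℝ≥0, LipschitzWith L (f k)) (hindep : LinearIndependent ℝ f) {γ : ℝ}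
    (hγ : 0 ≤ γ) {P : Euc n →L[ℝ] Euc n} (hP : IsPosSemidefOp P) (hfix : S.riccati γ P = P)
    {θ₁ : Euc d} (hθ : ∀ x, linPolicy f θ₁ x = S.gain γ P x) (θ : Euc d) :
    S.IsOptimalPolicy ρ γ (linPolicy f θ) ↔ θ = θ₁ := by
  have hfc : ∀ k, Continuous (f k) := fun k => by
    obtain ⟨L, hL⟩ := hf k
    exact hL.continuous
  constructor
  swap
  · rintro rfl
    have : linPolicy f θ = fun x => S.gain γ P x := funext hθ
    rw [this]
    exact isOptimalPolicy_gain hQ hR ρ hγ hP hfix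
  intro hopt
  obtain ⟨Λ, hΛ⟩ := exists_featureBound hf (b := 1) (Or.inl rfl)
  obtain ⟨c₀, hc₀, hc₀'⟩ := exists_pos_le_integral_linPolicy ρ hρ hfc hindep hΛ
  obtain ⟨cR, hcR, hcR'⟩ := hR.exists_pos_le
  have h1 := hopt (fun x => S.gain γ P x) (S.gain γ P).continuous.measurable
  have hqm : Measurable fun x : Euc n => ENNReal.ofReal ⟪x, P x⟫ := by
    have : Continuous fun x : Euc n => ⟪x, P x⟫ := by fun_prop
    exact this.measurable.ennreal_ofReal
  have hqfin : ∫⁻ x, ENNReal.ofReal ⟪x, P x⟫ ∂ρ ≠ ∞ := by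
    refine ne_top_of_le_ne_top ?_ (lintegral_mono fun x =>
      ENNReal.ofReal_le_ofReal (inner_map_self_le P x))
    have := (hρ.const_mul ‖P‖).2
    rw [hasFiniteIntegral_iff_ofReal (Eventually.of_forall fun x => by positivity)] at this
    exact this.ne
  -- Optimality leaves no room for even the deviation of the first step; the finite optimal value
  -- can then be cancelled.
  have h2 : ∫⁻ x, ENNReal.ofReal ⟪x, P x⟫ ∂ρ +
      ∫⁻ x, ENNReal.ofReal (cR * ‖linPolicy f (θ - θ₁) x‖ ^ 2) ∂ρ ≤
      ∫⁻ x, ENNReal.ofReal ⟪x, P x⟫ ∂ρ + 0 := by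
    rw [add_zero, ← lintegral_add_left hqm]
    have h3 : S.cost ρ γ (fun x => S.gain γ P x) = ∫⁻ x, ENNReal.ofReal ⟪x, P x⟫ ∂ρ :=
      lintegral_congr fun x => costFrom_gain hQ hR hγ hP hfix x
    rw [← h3]
    refine le_trans (lintegral_mono fun x => ?_) h1
    by_cases hx : S.costFrom γ (linPolicy f θ) x = ∞
    · rw [hx]; exact le_top
    · rw [costFrom_eq hQ hR hγ hP hfix hx]
      refine add_le_add le_rfl (le_trans ?_ (ENNReal.le_tsum 0))
      refine ENNReal.ofReal_le_ofReal ?_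
      simp only [pow_zero, one_mul, traj]
      rw [← hθ, ← linPolicy_sub]
      exact (hcR' _).trans (hess_ge hγ hP _)
  have h3 := le_antisymm (ENNReal.le_of_add_le_add_left hqfin h2) zero_le
  have hint : Integrable (fun x => ‖linPolicy f (θ - θ₁) x‖ ^ 2) ρ := by
    refine (((integrable_const (1 : ℝ)).add hρ).const_mul (Λ * ‖θ - θ₁‖ ^ 2)).mono'
      ((continuous_linPolicy hfc _).norm.pow 2).aestronglyMeasurable
      (Eventually.of_forall fun x => ?_)
    rw [Real.norm_of_nonneg (by positivity)]
    exact hΛ.growth _ x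
  have h4 : ∫ x, cR * ‖linPolicy f (θ - θ₁) x‖ ^ 2 ∂ρ = 0 := by
    rw [integral_eq_lintegral_of_nonneg_ae (Eventually.of_forall fun p => by positivity)
      (hint.const_mul cR).aestronglyMeasurable, h3, ENNReal.toReal_zero]
  rw [integral_const_mul, mul_eq_zero, or_iff_right hcR.ne'] at h4
  have h5 := hc₀' (θ - θ₁)
  rw [h4] at h5
  have h6 : ‖θ - θ₁‖ ^ 2 ≤ 0 := by
    by_contra h
    exact absurd h5 (not_le.2 (mul_pos hc₀ (not_le.1 h)))
  have h7 : ‖θ - θ₁‖ = 0 := by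
    have := le_antisymm h6 (sq_nonneg _)
    rwa [pow_eq_zero_iff two_ne_zero] at this
  exact sub_eq_zero.1 (norm_eq_zero.1 h7)

/-- If the undiscounted cost is finite, then the policy vanishes at the origin. -/
theorem linPolicy_zero_of_paramCost_ne_top (hQ : IsPosDefOp S.Q) (hR : IsPosDefOp S.R)
    (ρ : Measure (Euc n)) [IsProbabilityMeasure ρ] {f : Fin d → Euc n → Euc m}
    (hfc : ∀ k, Continuous (f k)) {θ : Euc d} (h : S.paramCost ρ f 1 θ ≠ ∞) :
    linPolicy f θ 0 = 0 := by
  have hcont := continuous_linPolicy hfc θ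
  have hmeas : Measurable fun x => S.costFrom 1 (linPolicy f θ) x := by
    unfold costFrom
    refine Measurable.tsum fun t => Measurable.ennreal_ofReal ?_
    have h1 := continuous_traj (S := S) hcont t
    have : Continuous fun x => 1 ^ t * S.stageCost (S.traj (linPolicy f θ) x t)
        (linPolicy f θ (S.traj (linPolicy f θ) x t)) := by
      unfold stageCost
      fun_prop
    exact this.measurable
  -- From one initial state of finite cost, states and actions both tend to zero; continuity of the
  -- policy then gives its value at the origin.
  obtain ⟨x, hx⟩ := (ae_lt_top hmeas h).exists
  have h1 := tendsto_pow_mul_norm_sq hQ hR zero_le_one hx.ne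
  simp only [one_pow, one_mul] at h1
  have h2 := h1.1.sqrt
  have h3 := h1.2.sqrt
  simp only [Real.sqrt_sq (norm_nonneg _), Real.sqrt_zero] at h2 h3
  have h4 := (hcont.tendsto 0).comp (tendsto_zero_iff_norm_tendsto_zero.2 h2)
  exact tendsto_nhds_unique h4 (tendsto_zero_iff_norm_tendsto_zero.2 h3)

/-- Moving the `k`-th parameter alone changes the policy at the origin by a nonzero multiple of `f k
0`, and both policies vanish there. -/
theorem feature_zero_of_eventually (hQ : IsPosDefOp S.Q) (hR : IsPosDefOp S.R)
    (ρ : Measure (Euc n)) [IsProbabilityMeasure ρ] {f : Fin d → Euc n → Euc m}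
    (hfc : ∀ k, Continuous (f k)) {θ₁ : Euc d} (h : ∀ᶠ θ in 𝓝 θ₁, S.paramCost ρ f 1 θ ≠ ∞)
    (k : Fin d) : f k 0 = 0 := by
  have h1 : Tendsto (fun s : ℝ => θ₁ + s • EuclideanSpace.single k (1 : ℝ)) (𝓝[≠] 0) (𝓝 θ₁) := by
    have : Tendsto (fun s : ℝ => θ₁ + s • EuclideanSpace.single k (1 : ℝ)) (𝓝 0)
        (𝓝 (θ₁ + (0 : ℝ) • EuclideanSpace.single k (1 : ℝ))) :=
      Continuous.tendsto (by fun_prop) _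
    rw [zero_smul, add_zero] at this
    exact this.mono_left nhdsWithin_le_nhds
  obtain ⟨s, hs, hs0⟩ := ((h1.eventually h).and self_mem_nhdsWithin).exists
  have h2 := linPolicy_zero_of_paramCost_ne_top hQ hR ρ hfc hs
  have h3 := linPolicy_zero_of_paramCost_ne_top hQ hR ρ hfc h.self_of_nhds
  rw [linPolicy_add, h3, zero_add, linPolicy_smul, smul_eq_zero, or_iff_right (show ¬s = 0 from hs0)] at h2
  simpa [linPolicy] using h2

end LQR

/-! ### Step sizes and schedules. -/

/-- A positive antitone step bound admits a schedule. -/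
theorem exists_isSchedule {δ : ℝ → ℝ} (hδ : ∀ γ ∈ Ico (0 : ℝ) 1, 0 < δ γ)
    (hanti : AntitoneOn δ (Ico (0 : ℝ) 1)) : ∃ γ : ℕ → ℝ, IsSchedule δ γ := by
  set γ : ℕ → ℝ := fun k => Nat.rec 0 (fun _ x => x + min (δ x) ((1 - x) / 2)) k with hγ
  have hs : ∀ k, γ (k + 1) = γ k + min (δ (γ k)) ((1 - γ k) / 2) := fun k => rfl
  have hmem : ∀ k, γ k ∈ Ico (0 : ℝ) 1 := by
    intro k
    induction k with
    | zero => exact ⟨le_rfl, one_pos⟩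
    | succ k ih =>
      have h1 := min_le_right (δ (γ k)) ((1 - γ k) / 2)
      have h2 : 0 < min (δ (γ k)) ((1 - γ k) / 2) := lt_min (hδ _ ih) (by linarith [ih.2])
      rw [hs]
      exact ⟨by linarith [ih.1], by linarith [ih.2]⟩
  have hlt : ∀ k, γ k < γ (k + 1) := fun k => by
    rw [hs]
    exact lt_add_of_pos_right _ (lt_min (hδ _ (hmem k)) (by linarith [(hmem k).2]))
  have hmono := strictMono_nat_of_lt_succ hlt
  refine ⟨γ, rfl, hmono, fun k => (hmem k).2, ?_, fun k => ?_⟩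
  · have hlim := tendsto_atTop_ciSup hmono.monotone
      ⟨1, forall_mem_range.2 fun k => (hmem k).2.le⟩
    set l := ⨆ k, γ k
    have hle : ∀ k, γ k ≤ l := fun k => hmono.monotone.ge_of_tendsto hlim k
    have hl1 : l ≤ 1 := le_of_tendsto' hlim fun k => (hmem k).2.le
    rcases hl1.eq_or_lt with h | h
    · rwa [h] at hlim
    · exfalso
      have hlm : l ∈ Ico (0 : ℝ) 1 := ⟨hle 0, h⟩
      have h1 : Tendsto (fun k => γ (k + 1) - γ k) atTop (𝓝 (l - l)) :=
        ((tendsto_add_atTop_iff_nat 1).2 hlim).sub hlim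
      rw [sub_self] at h1
      -- A limit `l < 1` would bound all steps below by this positive number, because `δ` is
      -- antitone, whereas convergence makes the steps tend to zero.
      have h2 : min (δ l) ((1 - l) / 2) ≤ 0 := by
        refine ge_of_tendsto' h1 fun k => ?_
        rw [hs, add_sub_cancel_left]
        exact min_le_min (hanti (hmem k) hlm (hle k)) (by linarith [hle k])
      exact absurd h2 (not_le.2 (lt_min (hδ l hlm) (by linarith)))
  · rw [hs, add_sub_cancel_left]
    exact min_le_left _ _

/-- A relation between parameters in `[0, 1)` which holds at small distances, uniformly on each
`[0, T]` with `T < 1`, holds at distances bounded by an antitone function. -/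
theorem exists_antitone_step {R : ℝ → ℝ → Prop}
    (h : ∀ T ∈ Ico (0 : ℝ) 1, ∃ δ > 0, ∀ a ∈ Icc 0 T, ∀ b ∈ Icc 0 T, |b - a| < δ → R a b) :
    ∃ δ : ℝ → ℝ, (∀ γ ∈ Ico (0 : ℝ) 1, 0 < δ γ) ∧ AntitoneOn δ (Ico (0 : ℝ) 1) ∧
      ∀ a ∈ Ico (0 : ℝ) 1, ∀ b ∈ Ico (0 : ℝ) 1, a ≤ b → b - a ≤ δ a → R a b := by
  -- Step sizes admissible for every start up to `γ`. The sets shrink as `γ` grows, so their suprema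
  -- are antitone; half the supremum lies below some admissible step.
  set D : ℝ → Set ℝ := fun γ => {δ | 0 < δ ∧ δ ≤ 1 ∧
    ∀ a ∈ Icc 0 γ, ∀ b ∈ Ico (0 : ℝ) 1, a ≤ b → b - a ≤ δ → R a b} with hD
  have hbdd : ∀ γ, BddAbove (D γ) := fun γ => ⟨1, fun δ hδ => hδ.2.1⟩
  have hne : ∀ γ ∈ Ico (0 : ℝ) 1, (D γ).Nonempty := by
    intro γ hγ
    -- The end `b` of a step may exceed `γ`, so uniformity is taken up to the midpoint between `γ`
    -- and `1`.
    obtain ⟨δ, hδ, hR⟩ := h ((1 + γ) / 2) ⟨by linarith [hγ.1], by linarith [hγ.2]⟩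
    refine ⟨min (δ / 2) ((1 - γ) / 2), lt_min (by positivity) (by linarith [hγ.2]),
      (min_le_right _ _).trans (by linarith [hγ.1]), fun a ha b hb hab hba => ?_⟩
    have h1 := hba.trans (min_le_left _ _)
    have h2 := hba.trans (min_le_right _ _)
    refine hR a ⟨ha.1, by linarith [ha.2, hγ.2]⟩ b ⟨hb.1, by linarith [ha.2]⟩ ?_
    rw [abs_of_nonneg (by linarith)]
    linarith
  have hpos : ∀ γ ∈ Ico (0 : ℝ) 1, 0 < sSup (D γ) := fun γ hγ => by
    obtain ⟨δ, hδ⟩ := hne γ hγ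
    exact hδ.1.trans_le (le_csSup (hbdd γ) hδ)
  refine ⟨fun γ => sSup (D γ) / 2, fun γ hγ => half_pos (hpos γ hγ), fun γ hγ γ' hγ' hle => ?_,
    fun a ha b hb hab hba => ?_⟩
  · refine div_le_div_of_nonneg_right (csSup_le_csSup (hbdd γ) (hne γ' hγ') ?_) two_pos.le
    exact fun δ hδ => ⟨hδ.1, hδ.2.1, fun a ha => hδ.2.2 a ⟨ha.1, ha.2.trans hle⟩⟩
  · obtain ⟨δ, hδ, hlt⟩ := exists_lt_of_lt_csSup (hne a ha) (half_lt_self (hpos a ha))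
    exact hδ.2.2 a ⟨ha.1, le_rfl⟩ b hb hab (hba.trans hlt.le)

/-- Around each `c` both a window of discount factors and a basin are available, and continuity puts
`θ a` in the basin for `a` near `c`. A Lebesgue number puts `a` and `b` in a common window. -/
theorem exists_uniform_step {X : Type*} [PseudoMetricSpace X] {θ : ℝ → X}
    (hθ : ContinuousOn θ (Icc 0 1)) {Y : ℝ → X → Prop} {s : Set ℝ} (hs : IsCompact s)
    (hs1 : s ⊆ Icc 0 1) (h : ∀ c ∈ s, ∃ ε > 0, ∃ r > 0, ∀ γ ∈ Icc (0 : ℝ) 1, |γ - c| < ε →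
      ∀ x ∈ Metric.ball (θ c) r, Y γ x) :
    ∃ δ > 0, ∀ a ∈ s, ∀ b ∈ s, |b - a| < δ → Y b (θ a) := by
  have h' : ∀ c : s, ∃ e > 0, ∀ a ∈ Icc (0 : ℝ) 1, ∀ b ∈ Icc (0 : ℝ) 1, a ∈ Metric.ball (c : ℝ) e →
      b ∈ Metric.ball (c : ℝ) e → Y b (θ a) := by
    rintro ⟨c, hc⟩
    obtain ⟨ε, hε, r, hr, hY⟩ := h c hc
    obtain ⟨e, he, he'⟩ := Metric.continuousWithinAt_iff.1 (hθ c (hs1 hc)) r hr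
    refine ⟨min ε e, lt_min hε he, fun a ha b hb hac hbc => hY b hb ?_ _ (he' ha ?_)⟩
    · have := hbc.trans_le (min_le_left ε e)
      rwa [Real.dist_eq] at this
    · exact hac.trans_le (min_le_right ε e)
  choose e he hY using h'
  obtain ⟨δ, hδ, hleb⟩ := lebesgue_number_lemma_of_metric hs
    (c := fun c : s => Metric.ball (c : ℝ) (e c)) (fun _ => Metric.isOpen_ball)
    (fun c hc => mem_iUnion.2 ⟨⟨c, hc⟩, Metric.mem_ball_self (he _)⟩)
  refine ⟨δ, hδ, fun a ha b hb hab => ?_⟩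
  obtain ⟨c, hc⟩ := hleb a ha
  exact hY c a (hs1 ha) b (hs1 hb) (hc (Metric.mem_ball_self hδ))
    (hc (by rwa [Metric.mem_ball, Real.dist_eq]))

/-- An injective linear map from a finite-dimensional space is an embedding, so pointwise continuity
of the policies controls the parameters. -/
theorem continuousOn_of_linPolicy {n m d : ℕ} {f : Fin d → Euc n → Euc m}
    (hindep : LinearIndependent ℝ f) {θ : ℝ → Euc d} {s : Set ℝ}
    (h : ∀ x, ContinuousOn (fun γ => linPolicy f (θ γ) x) s) : ContinuousOn θ s := by
  set Φ : Euc d →ₗ[ℝ] (Euc n → Euc m) :=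
    { toFun := fun u => linPolicy f u
      map_add' := fun u v => funext fun x => linPolicy_add f u v x
      map_smul' := fun c u => funext fun x => linPolicy_smul f c u x } with hΦ
  have hker : LinearMap.ker Φ = ⊥ := by
    rw [LinearMap.ker_eq_bot']
    intro u hu
    have h1 : ∑ k, u k • f k = 0 := by
      ext1 x
      have : linPolicy f u x = 0 := congrFun hu x
      simpa [linPolicy] using this
    ext k
    exact Fintype.linearIndependent_iff.1 hindep _ h1 k
  have hemb := (LinearMap.isClosedEmbedding_of_injective hker).isEmbedding
  rw [hemb.continuousOn_iff]
  exact continuousOn_pi.2 h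

end

/-! ### Assembly of the homotopy argument. -/

theorem theorem3 {n m d : ℕ} (S : LQR n m)
    (hQ : IsPosDefOp S.Q) (hR : IsPosDefOp S.R) (hAB : S.Controllable)
    (ρ : Measure (Euc n)) [IsProbabilityMeasure ρ] [ρ.IsOpenPosMeasure]
    (hρ : Integrable (fun x => ‖x‖ ^ 2) ρ)
    (f : Fin d → Euc n → Euc m)
    (hf : ∀ k, ∃ L : ℝ≥0, LipschitzWith L (f k))
    (hindep : LinearIndependent ℝ f)
    (hspan : ∀ γ ∈ Icc (0 : ℝ) 1, ∀ K : Euc n →L[ℝ] Euc m,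
      S.IsOptimalPolicy ρ γ (fun x => K x) →
        (fun x => K x) ∈ Submodule.span ℝ (range f)) :
    ∃ θopt : Euc d,
      (∀ θ : Euc d, S.IsOptimalPolicy ρ 1 (linPolicy f θ) ↔ θ = θopt) ∧
      (∃ δ : ℝ → ℝ, (∀ γ ∈ Ico (0 : ℝ) 1, 0 < δ γ) ∧ AntitoneOn δ (Ico (0 : ℝ) 1) ∧
        (∃ γ : ℕ → ℝ, IsSchedule δ γ) ∧
        ∀ γ : ℕ → ℝ, IsSchedule δ γ → ∀ θ₀ : Euc d, ∃ ϑ : ℕ → Euc d,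
          IsHomotopyRun (S.paramCost ρ f) γ ⊤ θ₀ ϑ ∧ Tendsto ϑ atTop (𝓝 θopt)) ∧
      ((∀ᶠ θ in 𝓝 θopt, S.paramCost ρ f 1 θ ≠ ∞) →
        ∃ δ : ℝ, 0 < δ ∧ ∀ (N : ℕ) (γ : ℕ → ℝ), IsFiniteSchedule δ N γ →
          ∀ θ₀ : Euc d, ∃ ϑ : ℕ → Euc d,
            IsHomotopyRun (S.paramCost ρ f) γ ((N + 1 : ℕ) : ℕ∞) θ₀ ϑ ∧ ϑ (N + 1) = θopt) := by
  have hfc : ∀ k, Continuous (f k) := fun k => by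
    obtain ⟨L, hL⟩ := hf k
    exact hL.continuous
  obtain ⟨P, hPc, hP⟩ := LQR.exists_continuousOn_riccati_fixed hQ hR hAB
  have hex : ∀ γ : ℝ, ∃ θ : Euc d, γ ∈ Icc (0 : ℝ) 1 →
      ∀ x, linPolicy f θ x = S.gain γ (P γ) x := fun γ => by
    by_cases hγ : γ ∈ Icc (0 : ℝ) 1
    · have h1 := hspan γ hγ _
        (LQR.isOptimalPolicy_gain hQ hR ρ hγ.1 (hP γ hγ).1 (hP γ hγ).2)
      obtain ⟨c, hc⟩ := (Submodule.mem_span_range_iff_exists_fun ℝ).1 h1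
      refine ⟨WithLp.toLp 2 c, fun _ x => ?_⟩
      have h2 := congrFun hc x
      rw [← h2]
      simp [linPolicy]
    · exact ⟨0, fun h => absurd h hγ⟩
  choose θs hθ using hex
  have h0 : (0 : ℝ) ∈ Icc (0 : ℝ) 1 := ⟨le_rfl, zero_le_one⟩
  have h1 : (1 : ℝ) ∈ Icc (0 : ℝ) 1 := ⟨zero_le_one, le_rfl⟩
  have hθc : ContinuousOn θs (Icc 0 1) := by
    refine continuousOn_of_linPolicy hindep fun x => ?_
    have hg : ContinuousOn (fun γ => S.gain γ (P γ)) (Icc 0 1) := fun γ hγ =>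
      ContinuousAt.comp_continuousWithinAt (f := fun γ => (γ, P γ))
        (LQR.continuousAt_gain hR hγ.1 (hP γ hγ).1)
        (continuousWithinAt_id.prodMk (hPc γ hγ))
    exact (hg.clm_apply continuousOn_const).congr fun γ hγ => hθ γ hγ x
  have hzero : ∀ θ₀, PolicyGradientYields (S.paramCost ρ f 0) θ₀ (θs 0) :=
    LQR.policyGradientYields_zero hQ hR ρ hρ hf hindep (hP 0 h0).1 (hP 0 h0).2 (hθ 0 h0)
  have hloc := fun (γ₁ : ℝ) (hγ₁ : γ₁ ∈ Icc (0 : ℝ) 1) =>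
    LQR.exists_policyGradientYields_nhds hQ hR ρ hρ hf hindep hPc hP hθc hθ hγ₁
  refine ⟨θs 1, LQR.isOptimalPolicy_linPolicy_iff hQ hR ρ hρ hf hindep zero_le_one (hP 1 h1).1
    (hP 1 h1).2 (hθ 1 h1), ?_, fun hfin => ?_⟩
  · obtain ⟨δ, hδ, hanti, hstep⟩ := exists_antitone_step
      (R := fun a b => PolicyGradientYields (S.paramCost ρ f b) (θs a) (θs b)) fun T hT =>
        exists_uniform_step (Y := fun γ x => PolicyGradientYields (S.paramCost ρ f γ) x (θs γ)) hθc
          (isCompact_Icc (a := (0 : ℝ)) (b := T)) (Icc_subset_Icc_right hT.2.le) fun c hc =>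
            hloc c ⟨hc.1, hc.2.trans hT.2.le⟩ (Or.inl (hc.2.trans_lt hT.2))
    refine ⟨δ, hδ, hanti, exists_isSchedule hδ hanti, fun γ hγ θ₀ => ?_⟩
    have hmem : ∀ k, γ k ∈ Ico (0 : ℝ) 1 := fun k =>
      ⟨hγ.zero ▸ hγ.strictMono.monotone (Nat.zero_le k), hγ.lt_one k⟩
    -- Each stage ends exactly at the optimum of its own discount factor, so the index lags by one
    -- and errors never accumulate.
    refine ⟨fun k => Nat.casesOn k θ₀ fun j => θs (γ j), ⟨rfl, fun k _ => ?_⟩, ?_⟩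
    · cases k with
      | zero =>
        have := hzero θ₀
        rw [← hγ.zero] at this
        exact this
      | succ j =>
        exact hstep _ (hmem j) _ (hmem (j + 1)) (hγ.strictMono (Nat.lt_succ_self j)).le (hγ.step j)
    · rw [← tendsto_add_atTop_iff_nat 1]
      exact (hθc 1 h1).tendsto.comp (tendsto_nhdsWithin_iff.2
        ⟨hγ.tendsto_one, Eventually.of_forall fun k => ⟨(hmem k).1, (hmem k).2.le⟩⟩)
  · have hf0 := LQR.feature_zero_of_eventually hQ hR ρ hfc hfin
    obtain ⟨δ, hδ, hstep⟩ := exists_uniform_step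
      (Y := fun γ x => PolicyGradientYields (S.paramCost ρ f γ) x (θs γ)) hθc
      (isCompact_Icc (a := (0 : ℝ)) (b := 1)) subset_rfl fun c hc => hloc c hc (Or.inr hf0)
    -- The halving turns the non-strict step bound of a schedule into the strict one of `hstep`.
    refine ⟨δ / 2, half_pos hδ, fun N γ hγ θ₀ => ?_⟩
    have hmono : ∀ i j, i + j ≤ N → γ i ≤ γ (i + j) := by
      intro i j
      induction j with
      | zero => intro _; exact le_rfl
      | succ j ih => exact fun h => (ih (by omega)).trans (hγ.lt_succ (i + j) (by omega)).le
    have hmem : ∀ k ≤ N, γ k ∈ Icc (0 : ℝ) 1 := by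
      intro k hk
      have e1 := hmono 0 k (by omega)
      have e2 := hmono k (N - k) (by omega)
      rw [zero_add, hγ.zero] at e1
      rw [Nat.add_sub_cancel' hk, hγ.last] at e2
      exact ⟨e1, e2⟩
    refine ⟨fun k => Nat.casesOn k θ₀ fun j => θs (γ j), ⟨rfl, fun k hk => ?_⟩, ?_⟩
    · cases k with
      | zero =>
        have := hzero θ₀
        rw [← hγ.zero] at this
        exact this
      | succ j =>
        have hj : j < N := by
          have : j + 1 < N + 1 := by exact_mod_cast hk
          omega
        refine hstep _ (hmem j hj.le) _ (hmem (j + 1) hj) ?_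
        rw [abs_of_pos (sub_pos.2 (hγ.lt_succ j hj))]
        have := hγ.step j hj
        linarith
    · exact congrArg θs hγ.last
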